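/- Let $k$ be a field of characteristic $0$ and $K=k[[h]]$. A topological Hopf algebra over $K$ is an $h$-adically complete and separated $K$-algebra with a coproduct $\Delta:A\to A\,\widehat\otimes_K A$ (an algebra morphism into the $h$-adically completed tensor product), a counit $\varepsilon_h$ (an algebra morphism to $K$) and a $K$-linear antipode $S_h$ satisfying the Hopf algebra axioms in completed tensor products; as usual for quantum groups, antipodes are assumed bijective. A topological Hopf deformation of a Hopf algebra $A_0$ over $k$ is a topological Hopf algebra $A_h$ over $K$ with $A_h\simeq A_0[[h]]$ as $K$-modules and $A_h/hA_h\simeq A_0$ as Hopf algebras. Modules are left modules unless stated otherwise. For a ring $R$ and an $R$-module $M$, $\mathrm{Ext}^i_R(M,R)$ and $R\mathrm{Hom}_R(M,R)$ carry the right $R$-module structure given by right multiplication on $R$. Let $A_h$, $B_h$ be topological Hopf deformations of Hopf algebras $A_0$, $B_0$ over $k$, and let $B_h\to A_h$ be a morphism of topological Hopf algebras such that $A_h$ is flat as a right $B_h$-module. Assume that $B_0$ is noetherian and that there is an integer $d\ge 0$ such that, $k$ being the $B_0$-module given by the counit, $\mathrm{Ext}^i_{B_0}(k,B_0)=0$ for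 $i\neq d$ and $\mathrm{Ext}^d_{B_0}(k,B_0)\simeq k$. Let $B_h$ act on $K$ by its counit and put $\Omega_{B_h}=\mathrm{Ext}^d_{B_h}(K,B_h)$, $d_{B_h}=d$. Let $V$ be a $B_h$-module that is free of finite rank over $K$, and $V^*=\mathrm{Hom}_K(V,K)$ with the right $B_h$-action $(f\cdot b)(v)=f(bv)$. Then: a) $\mathrm{Ext}^i_{A_h}(A_h\otimes_{B_h}V,A_h)=0$ for all $i\neq d_{B_h}$. b) $\Omega_{B_h}$ is a free $K$-module of rank one, on which $B_h$ acts on the right through a character, i.e. a $K$-algebra morphism $\theta_{B_h}:B_h\to K$ with $\omega\cdot u=\theta_{B_h}(u)\,\omega$. There is a $K$-linear right $B_h$-module structure on $\Omega_{B_h}\otimes_K V^*$ given by $$(\omega\otimes f)\cdot u=\lim_{n\to\infty}\sum_j\theta_{B_h}(u'_{j,n})\,\omega\otimes f\cdot S_h^2(u''_{j,n})\qquad\text{whenever}\qquad \Delta(u)=\lim_{n\to\infty}\sum_j u'_{j,n}\otimes u''_{j,n}$$ ($h$-adic limits, $S_h$ the antipode of $B_h$), and for it there is an isomorphism of right $A_h$-modules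 $$\mathrm{Ext}^{d_{B_h}}_{A_h}(A_h\otimes_{B_h}V,A_h)\simeq(\Omega_{B_h}\otimes_K V^*)\otimes_{B_h}A_h .$$ c) More precisely, $R\mathrm{Hom}_{A_h}(A_h\otimes_{B_h}V,A_h)\simeq\big((\Omega_{B_h}\otimes_K V^*)\otimes_{B_h}A_h\big)[-d_{B_h}]$ in the derived category of right $A_h$-modules. -/

import Mathlib

open CategoryTheory MulOpposite
open scoped TensorProduct PowerSeries

universe u w

noncomputable section

/-! ### Completed tensor products over `K = k⟦X⟧` (the deformation parameter `h` is `X`) -/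

section Completion

variable (k : Type u) [Field k]

/-- The reduction `R / h ^ n R`, written as the `K`-algebra `K / (h ^ n) ⊗ R`. -/
abbrev HTrunc (R : Type u) [Ring R] [Algebra k⟦X⟧ R] (n : ℕ) : Type u :=
  (k⟦X⟧ ⧸ Ideal.span {(PowerSeries.X : k⟦X⟧) ^ n}) ⊗[k⟦X⟧] R

/-- The projection `R / h ^ n R → R / h ^ m R` for `m ≤ n`. -/
def hTransition (R : Type u) [Ring R] [Algebra k⟦X⟧ R] {m n : ℕ} (hmn : m ≤ n) :
    HTrunc k R n →ₐ[k⟦X⟧] HTrunc k R m :=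
  Algebra.TensorProduct.map
    (Ideal.Quotient.factorₐ k⟦X⟧
      (Ideal.span_singleton_le_span_singleton.2 (pow_dvd_pow (PowerSeries.X : k⟦X⟧) hmn)))
    (AlgHom.id k⟦X⟧ R)

/-- The `h`-adic completion `lim R / h ^ n R` of a `K`-algebra `R`, as an algebra. For
`R = A ⊗ B` this is the completed tensor product of `A` and `B`. -/
def HCompletion (R : Type u) [Ring R] [Algebra k⟦X⟧ R] :
    Subalgebra k⟦X⟧ (∀ n : ℕ, HTrunc k R n) where
  carrier := {x | ∀ (m n : ℕ) (hmn : m ≤ n), hTransition k R hmn (x n) = x m}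
  mul_mem' := by
    intro x y hx hy m n hmn
    simp only [Pi.mul_apply, map_mul, hx m n hmn, hy m n hmn]
  add_mem' := by
    intro x y hx hy m n hmn
    simp only [Pi.add_apply, map_add, hx m n hmn, hy m n hmn]
  algebraMap_mem' := by
    intro r m n hmn
    simp only [Pi.algebraMap_apply, AlgHom.commutes]

namespace HCompletion

/-- The projection of the completion of `R` onto `R / h ^ n R`. -/
def proj (R : Type u) [Ring R] [Algebra k⟦X⟧ R] (n : ℕ) :
    HCompletion k R →ₐ[k⟦X⟧] HTrunc k R n :=
  (Pi.evalAlgHom k⟦X⟧ (fun n : ℕ => HTrunc k R n) n).comp (HCompletion k R).val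

/-- The canonical map from `R` to its `h`-adic completion. -/
def of (R : Type u) [Ring R] [Algebra k⟦X⟧ R] : R →ₐ[k⟦X⟧] HCompletion k R :=
  AlgHom.codRestrict
    (AlgHom.pi (A := fun n : ℕ => HTrunc k R n)
      (fun _ => Algebra.TensorProduct.includeRight))
    (HCompletion k R)
    (by
      intro r m n hmn
      simp [hTransition])

variable {k}

theorem transition_liftBaseChange {R S : Type u} [Ring R] [Algebra k⟦X⟧ R] [Ring S]
    [Algebra k⟦X⟧ S] (f : R →ₗ[k⟦X⟧] HCompletion k S) {m n : ℕ} (hmn : m ≤ n)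
    (x : HTrunc k R n) :
    hTransition k S hmn (LinearMap.liftBaseChange _ ((proj k S n).toLinearMap ∘ₗ f) x) =
      LinearMap.liftBaseChange _ ((proj k S m).toLinearMap ∘ₗ f) (hTransition k R hmn x) := by
  induction x using TensorProduct.induction_on with
  | zero => simp
  | add x y hx hy => simp only [map_add, hx, hy]
  | tmul c r =>
    obtain ⟨c, rfl⟩ := Ideal.Quotient.mk_surjective c
    have h1 : ∀ (j : ℕ) (y : HTrunc k S j),
        (Ideal.Quotient.mk (Ideal.span {(PowerSeries.X : k⟦X⟧) ^ j}) c) • y = c • y := by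
      intro j y
      exact algebraMap_smul _ c y
    have h2 := (f r).2 m n hmn
    have h3 : hTransition k R hmn
        ((Ideal.Quotient.mk (Ideal.span {(PowerSeries.X : k⟦X⟧) ^ n}) c) ⊗ₜ[k⟦X⟧] r) =
        (Ideal.Quotient.mk (Ideal.span {(PowerSeries.X : k⟦X⟧) ^ m}) c) ⊗ₜ[k⟦X⟧] r := rfl
    rw [h3, LinearMap.liftBaseChange_tmul, LinearMap.liftBaseChange_tmul, h1, h1, map_smul]
    exact congrArg (c • ·) h2

/-- The `h`-adically continuous extension of a `K`-linear map `R → lim S / h ^ n S` to the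
completion of `R`. -/
def extend {R S : Type u} [Ring R] [Algebra k⟦X⟧ R] [Ring S] [Algebra k⟦X⟧ S]
    (f : R →ₗ[k⟦X⟧] HCompletion k S) : HCompletion k R →ₗ[k⟦X⟧] HCompletion k S :=
  LinearMap.codRestrict (Subalgebra.toSubmodule (HCompletion k S))
    (LinearMap.pi fun n =>
      ((LinearMap.liftBaseChange _ ((proj k S n).toLinearMap ∘ₗ f)).restrictScalars k⟦X⟧) ∘ₗ
        (proj k R n).toLinearMap)
    (by
      intro x m n hmn
      refine (transition_liftBaseChange f hmn (proj k R n x)).trans ?_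
      exact congrArg _ (x.2 m n hmn))

/-- The map of completions induced by a `K`-linear map. -/
def map {R S : Type u} [Ring R] [Algebra k⟦X⟧ R] [Ring S] [Algebra k⟦X⟧ S]
    (f : R →ₗ[k⟦X⟧] S) : HCompletion k R →ₗ[k⟦X⟧] HCompletion k S :=
  extend ((of k S).toLinearMap ∘ₗ f)

/-- `x` is the `h`-adic limit of the sequence `t` of elements of `R`. -/
def IsLimit {R : Type u} [Ring R] [Algebra k⟦X⟧ R] (t : ℕ → R) (x : HCompletion k R) : Prop :=
  ∀ N : ℕ, ∃ n₀ : ℕ, ∀ n ≥ n₀, proj k R N x = proj k R N (of k R (t n))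

/-- For `f : R → lim S / h ^ n S` and `g : R' → lim S / h ^ n S`, the continuous map on the
completed tensor product of `R` and `R'` with `a ⊗ b ↦ f a * g b`. -/
def mulMap {R R' S : Type u} [Ring R] [Algebra k⟦X⟧ R] [Ring R'] [Algebra k⟦X⟧ R']
    [Ring S] [Algebra k⟦X⟧ S]
    (f : R →ₗ[k⟦X⟧] HCompletion k S) (g : R' →ₗ[k⟦X⟧] HCompletion k S) :
    HCompletion k (R ⊗[k⟦X⟧] R') →ₗ[k⟦X⟧] HCompletion k S :=
  extend (LinearMap.mul' k⟦X⟧ (HCompletion k S) ∘ₗ TensorProduct.map f g)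

end HCompletion

end Completion

/-! ### Topological Hopf algebras and Hopf deformations -/

section Hopf

/-- A topological Hopf algebra over `K = k⟦X⟧`: an `h`-adically complete and separated
`K`-algebra with coproduct `Δ : A → A ⊗̂ A`, counit and antipode satisfying the Hopf algebra
axioms in completed tensor products. -/
class TopologicalHopfAlgebra (k : Type u) [Field k] (A : Type u) [Ring A] [Algebra k⟦X⟧ A] where
  isAdicComplete : IsAdicComplete (Ideal.span {(PowerSeries.X : k⟦X⟧)}) A
  comul : A →ₐ[k⟦X⟧] HCompletion k (A ⊗[k⟦X⟧] A)
  counit : A →ₐ[k⟦X⟧] k⟦X⟧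
  antipode : A →ₗ[k⟦X⟧] A
  /-- `(Δ ⊗ id) ∘ Δ = (id ⊗ Δ) ∘ Δ` -/
  coassoc : ∀ a : A,
    HCompletion.mulMap
        (HCompletion.map
            (TensorProduct.map LinearMap.id
              (Algebra.TensorProduct.includeLeft (R := k⟦X⟧) (S := k⟦X⟧)
                (A := A) (B := A)).toLinearMap) ∘ₗ comul.toLinearMap)
        ((HCompletion.of k (A ⊗[k⟦X⟧] (A ⊗[k⟦X⟧] A))).toLinearMap ∘ₗ
          ((Algebra.TensorProduct.includeRight (R := k⟦X⟧) (A := A)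
              (B := A ⊗[k⟦X⟧] A)).comp
            (Algebra.TensorProduct.includeRight (R := k⟦X⟧) (A := A) (B := A))).toLinearMap)
        (comul a) =
      HCompletion.mulMap
        ((HCompletion.of k (A ⊗[k⟦X⟧] (A ⊗[k⟦X⟧] A))).toLinearMap ∘ₗ
          (Algebra.TensorProduct.includeLeft (R := k⟦X⟧) (S := k⟦X⟧) (A := A)
            (B := A ⊗[k⟦X⟧] A)).toLinearMap)
        (HCompletion.map
            (Algebra.TensorProduct.includeRight (R := k⟦X⟧) (A := A)
              (B := A ⊗[k⟦X⟧] A)).toLinearMap ∘ₗ comul.toLinearMap)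
        (comul a)
  /-- `(ε ⊗ id) ∘ Δ = id` -/
  counit_comul : ∀ a : A,
    HCompletion.map
        (LinearMap.mul' k⟦X⟧ A ∘ₗ
          TensorProduct.map (Algebra.linearMap k⟦X⟧ A ∘ₗ counit.toLinearMap) LinearMap.id)
        (comul a) = HCompletion.of k A a
  /-- `(id ⊗ ε) ∘ Δ = id` -/
  comul_counit : ∀ a : A,
    HCompletion.map
        (LinearMap.mul' k⟦X⟧ A ∘ₗ
          TensorProduct.map LinearMap.id (Algebra.linearMap k⟦X⟧ A ∘ₗ counit.toLinearMap))
        (comul a) = HCompletion.of k A a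
  /-- `m ∘ (S ⊗ id) ∘ Δ = η ∘ ε` -/
  antipode_comul : ∀ a : A,
    HCompletion.map (LinearMap.mul' k⟦X⟧ A ∘ₗ TensorProduct.map antipode LinearMap.id)
        (comul a) = HCompletion.of k A (algebraMap k⟦X⟧ A (counit a))
  /-- `m ∘ (id ⊗ S) ∘ Δ = η ∘ ε` -/
  comul_antipode : ∀ a : A,
    HCompletion.map (LinearMap.mul' k⟦X⟧ A ∘ₗ TensorProduct.map LinearMap.id antipode)
        (comul a) = HCompletion.of k A (algebraMap k⟦X⟧ A (counit a))

/-- A morphism of topological Hopf algebras (a `K`-linear map is `h`-adically continuous). -/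
structure TopologicalHopfHom (k : Type u) [Field k] (B A : Type u) [Ring B] [Algebra k⟦X⟧ B]
    [TopologicalHopfAlgebra k B] [Ring A] [Algebra k⟦X⟧ A] [TopologicalHopfAlgebra k A] where
  toAlgHom : B →ₐ[k⟦X⟧] A
  map_comul : ∀ b : B,
    HCompletion.map (TensorProduct.map toAlgHom.toLinearMap toAlgHom.toLinearMap)
        (TopologicalHopfAlgebra.comul (k := k) b) =
      TopologicalHopfAlgebra.comul (k := k) (toAlgHom b)
  map_counit : ∀ b : B, TopologicalHopfAlgebra.counit (k := k) (toAlgHom b) =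
    TopologicalHopfAlgebra.counit (k := k) b
  map_antipode : ∀ b : B, toAlgHom (TopologicalHopfAlgebra.antipode (k := k) b) =
    TopologicalHopfAlgebra.antipode (k := k) (toAlgHom b)

/-- The data making a topological Hopf algebra `A` over `k⟦X⟧` a deformation of the Hopf
algebra `A₀` over `k`: a `k⟦X⟧`-module isomorphism `A ≃ A₀⟦X⟧`, and an isomorphism of Hopf
algebras `A / h A ≃ A₀`, the latter given by a surjection `red : A → A₀` with kernel `h A`
that is compatible with all the structure. -/
structure HopfDeformation (k : Type u) [Field k] (A₀ A : Type u) [Ring A₀] [HopfAlgebra k A₀]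
    [Ring A] [Algebra k⟦X⟧ A] [TopologicalHopfAlgebra k A] where
  equiv : A ≃+ A₀⟦X⟧
  equiv_smul : ∀ (f : k⟦X⟧) (a : A),
    equiv (f • a) = PowerSeries.map (algebraMap k A₀) f * equiv a
  red : A →+* A₀
  red_surjective : Function.Surjective red
  red_eq_zero_iff : ∀ a : A, red a = 0 ↔ ∃ b : A, a = (PowerSeries.X : k⟦X⟧) • b
  red_smul : ∀ (f : k⟦X⟧) (a : A), red (f • a) = PowerSeries.constantCoeff f • red a
  /-- `Δ₀ ∘ red = (red ⊗ red) ∘ Δ`, computed on any tensor representing `Δ a` modulo `h` -/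
  red_comul : ∀ (a : A) (t : A ⊗[k⟦X⟧] A),
    HCompletion.proj k (A ⊗[k⟦X⟧] A) 1 (TopologicalHopfAlgebra.comul (k := k) a) =
        HCompletion.proj k (A ⊗[k⟦X⟧] A) 1 (HCompletion.of k (A ⊗[k⟦X⟧] A) t) →
      Coalgebra.comul (R := k) (red a) =
        TensorProduct.map (σ₁₂ := (PowerSeries.constantCoeff : k⟦X⟧ →+* k))
          { toFun := red, map_add' := map_add red, map_smul' := red_smul }
          { toFun := red, map_add' := map_add red, map_smul' := red_smul } t
  red_counit : ∀ a : A, Coalgebra.counit (R := k) (red a) =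
    PowerSeries.constantCoeff (TopologicalHopfAlgebra.counit (k := k) a)
  red_antipode : ∀ a : A, HopfAlgebraStruct.antipode k (red a) =
    red (TopologicalHopfAlgebra.antipode (k := k) a)

end Hopf

/-! ### Induced modules and flatness over noncommutative rings -/

section Induced

/-- The relations `s φ(r) ⊗ m = s ⊗ r m` in `S ⊗_ℤ M`. -/
def inducedRelations {R S : Type u} [Ring R] [Ring S] (φ : R →+* S) (M : Type u)
    [AddCommGroup M] [Module R M] : Submodule S (S ⊗[ℤ] M) :=
  Submodule.span S {x | ∃ (s : S) (r : R) (m : M), x = (s * φ r) ⊗ₜ[ℤ] m - s ⊗ₜ[ℤ] (r • m)}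

/-- The `S`-module `S ⊗_R M` for a homomorphism `φ : R → S` of (noncommutative) rings and a left
`R`-module `M`. For a right `R`-module `W`, i.e. a left `Rᵐᵒᵖ`-module, the right `S`-module
`W ⊗_R S` is `InducedModule φ.op W`. -/
def InducedModule {R S : Type u} [Ring R] [Ring S] (φ : R →+* S) (M : Type u)
    [AddCommGroup M] [Module R M] : Type u :=
  (S ⊗[ℤ] M) ⧸ inducedRelations φ M

instance {R S : Type u} [Ring R] [Ring S] (φ : R →+* S) (M : Type u)
    [AddCommGroup M] [Module R M] : AddCommGroup (InducedModule φ M) :=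
  inferInstanceAs (AddCommGroup ((S ⊗[ℤ] M) ⧸ inducedRelations φ M))

instance {R S : Type u} [Ring R] [Ring S] (φ : R →+* S) (M : Type u)
    [AddCommGroup M] [Module R M] : Module S (InducedModule φ M) :=
  inferInstanceAs (Module S ((S ⊗[ℤ] M) ⧸ inducedRelations φ M))

/-- The map `S ⊗_R M → S ⊗_R N` induced by an `R`-linear map `M → N`. -/
def InducedModule.map {R S : Type u} [Ring R] [Ring S] (φ : R →+* S) {M N : Type u}
    [AddCommGroup M] [Module R M] [AddCommGroup N] [Module R N] (f : M →ₗ[R] N) :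
    InducedModule φ M →ₗ[S] InducedModule φ N :=
  Submodule.mapQ (inducedRelations φ M) (inducedRelations φ N)
    (TensorProduct.AlgebraTensorModule.map (LinearMap.id : S →ₗ[S] S)
      (f.toAddMonoidHom.toIntLinearMap))
    (by
      refine Submodule.span_le.2 ?_
      rintro _ ⟨s, r, m, rfl⟩
      refine Submodule.subset_span ⟨s, r, f m, ?_⟩
      simp)

/-- `S` is flat as a right `R`-module (an `Rᵐᵒᵖ`-module) through `φ : R → S`: the functor
`S ⊗_R -` preserves injections. -/
def IsRightFlat {R S : Type u} [Ring R] [Ring S] (φ : R →+* S) : Prop :=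
  ∀ (M N : Type u) [AddCommGroup M] [Module R M] [AddCommGroup N] [Module R N]
    (f : M →ₗ[R] N), Function.Injective f → Function.Injective (InducedModule.map φ f)

end Induced

/-! ### `Ext` with values in the ring, and the duality functor -/

section ExtDual

/-- Right multiplication by `a`, as an endomorphism of the left `R`-module `R`. -/
def rightMul (R : Type u) [Ring R] (a : R) : ModuleCat.of R R ⟶ ModuleCat.of R R :=
  ModuleCat.ofHom (LinearMap.toSpanSingleton R R a)

theorem rightMul_one (R : Type u) [Ring R] : rightMul R 1 = 𝟙 _ := by
  ext; simp [rightMul]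

theorem rightMul_mul (R : Type u) [Ring R] (a b : R) :
    rightMul R (a * b) = rightMul R a ≫ rightMul R b := by
  ext; simp [rightMul]

theorem rightMul_add (R : Type u) [Ring R] (a b : R) :
    rightMul R (a + b) = rightMul R a + rightMul R b := by
  ext; simp [rightMul]

theorem rightMul_zero (R : Type u) [Ring R] : rightMul R 0 = 0 := by
  ext; simp [rightMul]

/-- The group `Ext^i_R(M, R)`. -/
def ExtDual {R : Type u} [Ring R] (M : ModuleCat.{u} R) (i : ℕ) : Type u :=
  Abelian.Ext.{u} M (ModuleCat.of R R) i

instance {R : Type u} [Ring R] (M : ModuleCat.{u} R) (i : ℕ) : AddCommGroup (ExtDual M i) :=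
  inferInstanceAs (AddCommGroup (Abelian.Ext.{u} M (ModuleCat.of R R) i))

/-- The right action on `Ext^i_R(M, R)` by right multiplication on `R`. -/
def extRightSMul {R : Type u} [Ring R] {M : ModuleCat.{u} R} {i : ℕ} (a : R)
    (x : Abelian.Ext.{u} M (ModuleCat.of R R) i) : Abelian.Ext.{u} M (ModuleCat.of R R) i :=
  x.comp (Abelian.Ext.mk₀ (rightMul R a)) (add_zero i)

theorem extRightSMul_mul {R : Type u} [Ring R] {M : ModuleCat.{u} R} {i : ℕ} (a b : R)
    (x : Abelian.Ext.{u} M (ModuleCat.of R R) i) :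
    extRightSMul (a * b) x = extRightSMul b (extRightSMul a x) := by
  simp only [extRightSMul, rightMul_mul, Abelian.Ext.comp_assoc_of_third_deg_zero,
    Abelian.Ext.mk₀_comp_mk₀]

/-- The right `R`-module structure on `Ext^i_R(M, R)`, by right multiplication on `R`. -/
instance ExtDual.instModule {R : Type u} [Ring R] (M : ModuleCat.{u} R) (i : ℕ) :
    Module Rᵐᵒᵖ (ExtDual M i) where
  smul a x := extRightSMul (R := R) (M := M) (i := i) a.unop x
  one_smul x := (congrArg (fun f => Abelian.Ext.comp (X := M) (a := i) x
    (Abelian.Ext.mk₀ f) (add_zero i)) (rightMul_one R)).trans (Abelian.Ext.comp_mk₀_id _)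
  mul_smul a b x := extRightSMul_mul (M := M) (i := i) b.unop a.unop x
  smul_zero _ := Abelian.Ext.zero_comp M i _ i (add_zero i)
  smul_add _ x y := Abelian.Ext.add_comp (X := M) (n := i) x y _ (add_zero i)
  add_smul a b x := (congrArg (fun f => Abelian.Ext.comp (X := M) (a := i) x f (add_zero i))
    ((congrArg Abelian.Ext.mk₀ (rightMul_add R a.unop b.unop)).trans
      (Abelian.Ext.mk₀_add _ _))).trans (Abelian.Ext.comp_add (X := M) (n := i) x _ _ _)
  zero_smul x := (congrArg (fun f => Abelian.Ext.comp (X := M) (a := i) x f (add_zero i))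
    ((congrArg Abelian.Ext.mk₀ (rightMul_zero R)).trans
      (Abelian.Ext.mk₀_zero _ _))).trans (Abelian.Ext.comp_zero (X := M) (n := i) x _ _ _ _)

/-- For an algebra `R` over a commutative ring `K`, the resulting `K`-module structure on
`Ext^i_R(M, R)`. -/
instance ExtDual.instModuleBase {K : Type u} [CommRing K] {R : Type u} [Ring R] [Algebra K R]
    (M : ModuleCat.{u} R) (i : ℕ) : Module K (ExtDual M i) :=
  Module.compHom (ExtDual M i) (algebraMap K Rᵐᵒᵖ)

/-- The contravariant functor `Hom_R(-, R)` from left to right `R`-modules. -/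
def homDual (R : Type u) [Ring R] : (ModuleCat.{u} R)ᵒᵖ ⥤ ModuleCat.{u} Rᵐᵒᵖ where
  obj M := ModuleCat.of Rᵐᵒᵖ (M.unop →ₗ[R] R)
  map f := ModuleCat.ofHom
    { toFun := fun g => g ∘ₗ f.unop.hom
      map_add' := fun _ _ => rfl
      map_smul' := fun _ _ => rfl }
  map_id _ := rfl
  map_comp _ _ := rfl

instance (R : Type u) [Ring R] : (homDual R).Additive where
  map_add {_ _ f g} := by
    refine ModuleCat.hom_ext (LinearMap.ext fun φ => LinearMap.ext fun x => ?_)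
    exact LinearMap.map_add φ (f.unop.hom x) (g.unop.hom x)

/-- The cochain complex `Hom_R(P, R)` of right `R`-modules for a projective resolution `P`. -/
def homDualComplex {R : Type u} [Ring R] {M : ModuleCat.{u} R} (P : ProjectiveResolution M) :
    CochainComplex (ModuleCat.{u} Rᵐᵒᵖ) ℕ :=
  ((homDual R).mapHomologicalComplex _).obj P.complex.op

/-- The object `RHom_R(M, R)` of the derived category of right `R`-modules, computed by a
projective resolution of `M`. -/
def rHomDual {R : Type u} [Ring R] [HasDerivedCategory.{w} (ModuleCat.{u} Rᵐᵒᵖ)]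
    {M : ModuleCat.{u} R} (P : ProjectiveResolution M) :
    DerivedCategory (ModuleCat.{u} Rᵐᵒᵖ) :=
  DerivedCategory.Q.obj ((homDualComplex P).extend ComplexShape.embeddingUpNat)

end ExtDual

/-! ### The twisted right action on `Ω ⊗ V*` -/

section Twisted

/-- The ring `S`, viewed as a left `R`-module through a ring homomorphism `R → S`. -/
abbrev characterModule {R S : Type u} [Ring R] [Ring S] (χ : R →+* S) : ModuleCat.{u} R :=
  (ModuleCat.restrictScalars χ).obj (ModuleCat.of S S)

/-- `Ω_B = Ext^d_B(K, B)`, where `B` acts on `K = k⟦X⟧` by the counit. -/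
abbrev Omega (k : Type u) [Field k] (B : Type u) [Ring B] [Algebra k⟦X⟧ B]
    [TopologicalHopfAlgebra k B] (d : ℕ) : Type u :=
  ExtDual (characterModule
    (TopologicalHopfAlgebra.counit (k := k) (A := B)).toRingHom) d

/-- The left `R`-module given by a representation `ρ : R → End_K(W)`. -/
@[nolint unusedArguments]
def RepModule {K R W : Type u} [CommRing K] [Ring R] [Algebra K R] [AddCommGroup W] [Module K W]
    (_ : R →ₐ[K] Module.End K W) : Type u := W

instance {K R W : Type u} [CommRing K] [Ring R] [Algebra K R] [AddCommGroup W] [Module K W]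
    (ρ : R →ₐ[K] Module.End K W) : AddCommGroup (RepModule ρ) :=
  inferInstanceAs (AddCommGroup W)

instance {K R W : Type u} [CommRing K] [Ring R] [Algebra K R] [AddCommGroup W] [Module K W]
    (ρ : R →ₐ[K] Module.End K W) : Module R (RepModule ρ) :=
  Module.compHom W ρ.toRingHom

variable {k : Type u} [Field k]

/-- `y` is the limit of the sequence `t` for the `h`-adic topology of `W`. -/
def IsHAdicLimit {W : Type u} [AddCommGroup W] [Module k⟦X⟧ W] (t : ℕ → W) (y : W) : Prop :=
  ∀ N : ℕ, ∃ n₀ : ℕ, ∀ n ≥ n₀, ∃ z : W, y - t n = (PowerSeries.X : k⟦X⟧) ^ N • z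

/-- The endomorphism `ω ⊗ f ↦ ∑ θ(x_j) ω ⊗ f · S²(y_j)` of `Ω ⊗ V*` attached to a tensor
`∑ x_j ⊗ y_j`, where `(f · b)(v) = f (b v)`. -/
def twist {B : Type u} [Ring B] [Algebra k⟦X⟧ B] [TopologicalHopfAlgebra k B]
    (θ : B →ₐ[k⟦X⟧] k⟦X⟧) (Ω : Type u) [AddCommGroup Ω] [Module k⟦X⟧ Ω]
    (V : Type u) [AddCommGroup V] [Module k⟦X⟧ V] [Module B V] [IsScalarTower k⟦X⟧ B V] :
    B ⊗[k⟦X⟧] B →ₗ[k⟦X⟧] Module.End k⟦X⟧ (Ω ⊗[k⟦X⟧] Module.Dual k⟦X⟧ V) :=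
  TensorProduct.lift
    (((LinearMap.lsmul k⟦X⟧ (Module.End k⟦X⟧ (Ω ⊗[k⟦X⟧] Module.Dual k⟦X⟧ V))) ∘ₗ
        θ.toLinearMap).compl₂
      (LinearMap.lTensorHom Ω ∘ₗ Module.Dual.transpose ∘ₗ
        (Algebra.lsmul k⟦X⟧ k⟦X⟧ V : B →ₐ[k⟦X⟧] Module.End k⟦X⟧ V).toLinearMap ∘ₗ
        TopologicalHopfAlgebra.antipode (k := k) ∘ₗ TopologicalHopfAlgebra.antipode (k := k)))

theorem twist_tmul {B : Type u} [Ring B] [Algebra k⟦X⟧ B] [TopologicalHopfAlgebra k B]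
    (θ : B →ₐ[k⟦X⟧] k⟦X⟧) (Ω : Type u) [AddCommGroup Ω] [Module k⟦X⟧ Ω]
    (V : Type u) [AddCommGroup V] [Module k⟦X⟧ V] [Module B V] [IsScalarTower k⟦X⟧ B V]
    (x y : B) (ω : Ω) (f : Module.Dual k⟦X⟧ V) :
    twist θ Ω V (x ⊗ₜ y) (ω ⊗ₜ f) =
      (θ x • ω) ⊗ₜ (f ∘ₗ Algebra.lsmul k⟦X⟧ k⟦X⟧ V
        (TopologicalHopfAlgebra.antipode (k := k)
          (TopologicalHopfAlgebra.antipode (k := k) y))) := by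
  rfl

/-- The right action `ρ` of `B` on `Ω ⊗ V*` is the twisted one:
`(ω ⊗ f) · u = lim_n ∑_j θ(u'_{j,n}) ω ⊗ f · S²(u''_{j,n})` whenever
`Δ(u) = lim_n ∑_j u'_{j,n} ⊗ u''_{j,n}`. -/
def IsTwistedAction {B : Type u} [Ring B] [Algebra k⟦X⟧ B] [TopologicalHopfAlgebra k B]
    (θ : B →ₐ[k⟦X⟧] k⟦X⟧) (Ω : Type u) [AddCommGroup Ω] [Module k⟦X⟧ Ω]
    (V : Type u) [AddCommGroup V] [Module k⟦X⟧ V] [Module B V] [IsScalarTower k⟦X⟧ B V]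
    (ρ : Bᵐᵒᵖ →ₐ[k⟦X⟧] Module.End k⟦X⟧ (Ω ⊗[k⟦X⟧] Module.Dual k⟦X⟧ V)) : Prop :=
  ∀ (u : B) (t : ℕ → B ⊗[k⟦X⟧] B),
    HCompletion.IsLimit t (TopologicalHopfAlgebra.comul (k := k) u) →
      ∀ (ω : Ω) (f : Module.Dual k⟦X⟧ V),
        IsHAdicLimit (k := k) (fun n => twist θ Ω V (t n) (ω ⊗ₜ f)) (ρ (op u) (ω ⊗ₜ f))

end Twisted

end

/-! The trivial `B`-module `K` has a resolution `F` by finite free modules. Since `B₀` is noetherian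
and `B` is `h`-complete and torsion free, every saturated submodule of `B ^ m` is finitely generated
(`exists_generators`), and kernels of matrices are saturated. As `K` and `B` have no `h`-torsion,
`F` reduces modulo `h` to a resolution of `k` over `B₀` (`FlatReduction.reduce`). Successive
`h`-adic approximation in the dual complex lifts the hypothesis on `Ext(k, B₀)`: `Ext^i_B(K, B)`
vanishes for `i ≠ d` and is free of rank one over `K` for `i = d`. The right action on a module of
rank one is given by a character `θ`.

To replace `K` by `V`, one would tensor `F` with `V` and untwist the diagonal action to recover free
modules. Here this is done with matrices. Let `ρ` be the matrix of coefficients of `V` in a basis.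
Then `τ(b)_{ij} = ∑ b' ρ_{ji}(S b'')` and `σ(b)_{ij} = ∑ b' ρ_{ij}(S² b'')` define ring morphisms
from `B` to matrices over `B`. Applying `τ` to the entries of the differentials of `F` gives a
complex which, on rows, is additively `F^ι` (`vecMul_expand`); it is therefore exact and resolves
`V`. On columns it is the dual of `F` in each component, with the right action twisted by `σ`
(`colTwist_colMap`). Hence `Ext^i_B(V, B)` is `Ext^i_B(K, B)^ι` with the action through `σ`; for `i
= d` this is `Ω ⊗ V*` with its `θ` and `S²` twist (`twistedEquiv`).

Flatness of `A` on the right makes the induced complex a resolution of `A ⊗_B V`. Its dual is the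
dual over `B` tensored with `A` on the other side, so flatness on the left is needed to take
cohomology; bijective antipodes supply it (`isRightFlat_op`). A complex with cohomology in a single
degree is a shifted module in the derived category (`nonempty_rHomDual_iso_single`).

Identities in completed tensor products are checked modulo each `h ^ n`, where the coproduct of an
element is represented by an honest tensor, and then deduced from separatedness. -/

noncomputable section

/-! ### `Ext` into the ring and resolutions by finite free modules -/

section Cohomology

variable {R : Type u} [Ring R] {X Y Z X' Y' Z' H H' : Type u} [AddCommGroup X] [Module R X]
  [AddCommGroup Y] [Module R Y] [AddCommGroup Z] [Module R Z] [AddCommGroup H] [Module R H]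
  [AddCommGroup X'] [Module R X'] [AddCommGroup Y'] [Module R Y'] [AddCommGroup Z'] [Module R Z']
  [AddCommGroup H'] [Module R H']

/-- `H` is isomorphic to the cohomology `ker g / im f` of `X → Y → Z`. -/
def IsCohomology (f : X →ₗ[R] Y) (g : Y →ₗ[R] Z) (H : Type u) [AddCommGroup H] [Module R H] :
    Prop :=
  ∃ p : LinearMap.ker g →ₗ[R] H, Function.Surjective p ∧ ∀ z, p z = 0 ↔ ∃ x, f x = z.1

namespace IsCohomology

variable {f : X →ₗ[R] Y} {g : Y →ₗ[R] Z} {f' : X' →ₗ[R] Y'} {g' : Y' →ₗ[R] Z'}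

theorem nonempty_linearEquiv (h : IsCohomology f g H) (h' : IsCohomology f g H') :
    Nonempty (H ≃ₗ[R] H') := by
  obtain ⟨p, hp, hp0⟩ := h
  obtain ⟨p', hp', hp0'⟩ := h'
  have hk : LinearMap.ker p = LinearMap.ker p' := by
    ext z
    rw [LinearMap.mem_ker, LinearMap.mem_ker, hp0, hp0']
  exact ⟨(p.quotKerEquivOfSurjective hp).symm.trans
    ((Submodule.quotEquivOfEq _ _ hk).trans (p'.quotKerEquivOfSurjective hp'))⟩

theorem congr_left (h : IsCohomology f g H) (e₁ : X ≃ₗ[R] X') (e₂ : Y ≃ₗ[R] Y')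
    (e₃ : Z ≃ₗ[R] Z') (hf : ∀ x, e₂ (f x) = f' (e₁ x)) (hg : ∀ y, e₃ (g y) = g' (e₂ y)) :
    IsCohomology f' g' H := by
  obtain ⟨p, hp, hp0⟩ := h
  let q : LinearMap.ker g' →ₗ[R] LinearMap.ker g :=
    LinearMap.restrict e₂.symm.toLinearMap (fun y hy => by
      rw [LinearMap.mem_ker] at hy ⊢
      apply e₃.injective
      rw [hg, map_zero]
      exact (congrArg g' (e₂.apply_symm_apply y)).trans hy)
  refine ⟨p ∘ₗ q, hp.comp ?_, fun z => (hp0 _).trans ?_⟩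
  · rintro ⟨y, hy⟩
    refine ⟨⟨e₂ y, ?_⟩, Subtype.ext (e₂.symm_apply_apply y)⟩
    rw [LinearMap.mem_ker] at hy ⊢
    rw [← hg, hy, map_zero]
  · constructor
    · rintro ⟨x, hx⟩
      refine ⟨e₁ x, ?_⟩
      rw [← hf, hx]
      exact e₂.apply_symm_apply z.1
    · rintro ⟨x, hx⟩
      refine ⟨e₁.symm x, e₂.injective ?_⟩
      rw [hf, e₁.apply_symm_apply, hx]
      exact (e₂.apply_symm_apply z.1).symm

theorem subsingleton_iff (h : IsCohomology f g H) :
    Subsingleton H ↔ ∀ y, g y = 0 → ∃ x, f x = y := by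
  obtain ⟨p, hp, hp0⟩ := h
  constructor
  · intro _ y hy
    exact (hp0 ⟨y, hy⟩).1 (Subsingleton.elim _ _)
  · intro h
    refine ⟨fun a b => ?_⟩
    obtain ⟨a, rfl⟩ := hp a
    obtain ⟨b, rfl⟩ := hp b
    rw [(hp0 a).2 (h a.1 a.2), (hp0 b).2 (h b.1 b.2)]

end IsCohomology

end Cohomology

/-! ### Row and column vectors over a noncommutative ring -/

section Matrices

variable {R : Type u} [Ring R] {m n : Type}

/-- The left linear map `x ↦ x M` on row vectors. -/
def rowMap [Fintype m] (M : Matrix m n R) : (m → R) →ₗ[R] (n → R) where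
  toFun x := Matrix.vecMul x M
  map_add' x y := Matrix.add_vecMul M x y
  map_smul' c x := Matrix.smul_vecMul c x M

/-- The right linear map `y ↦ M y` on column vectors. -/
def colMap [Fintype n] (M : Matrix m n R) : (n → R) →ₗ[Rᵐᵒᵖ] (m → R) where
  toFun y := Matrix.mulVec M y
  map_add' x y := Matrix.mulVec_add M x y
  map_smul' c y := Matrix.mulVec_smul M c y

@[simp] theorem rowMap_apply [Fintype m] (M : Matrix m n R) (x : m → R) :
    rowMap M x = Matrix.vecMul x M := rfl

@[simp] theorem colMap_apply [Fintype n] (M : Matrix m n R) (y : n → R) :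
    colMap M y = Matrix.mulVec M y := rfl

/-- Column vectors are the linear forms on row vectors. -/
def colDual (R : Type u) [Ring R] (n : Type) [Fintype n] :
    (n → R) ≃ₗ[Rᵐᵒᵖ] ((n → R) →ₗ[R] R) where
  toFun y :=
    { toFun := fun x => dotProduct x y
      map_add' := fun x x' => add_dotProduct x x' y
      map_smul' := fun c x => smul_dotProduct c x y }
  map_add' y y' := LinearMap.ext fun x => dotProduct_add x y y'
  map_smul' c y := LinearMap.ext fun x => dotProduct_smul c x y
  invFun f := by
    classical exact fun a => f (Pi.single a 1)
  left_inv y := by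
    classical
    funext a
    simp
  right_inv f := by
    classical
    refine LinearMap.ext fun x => ?_
    conv_rhs => rw [← Finset.univ_sum_single x, map_sum]
    refine Finset.sum_congr rfl fun a _ => ?_
    rw [← smul_eq_mul, ← map_smul, ← Pi.single_smul, smul_eq_mul, mul_one]

theorem colDual_comp_rowMap [Fintype m] [Fintype n] (M : Matrix m n R) (y : n → R) :
    colDual R n y ∘ₗ rowMap M = colDual R m (colMap M y) := by
  refine LinearMap.ext fun x => ?_
  exact (Matrix.dotProduct_mulVec x M y).symm

end Matrices

/-! ### Resolutions by finite free modules -/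

/-- A resolution of `M` by finite free modules of row vectors. The module in homological
degree `i` is `κ (i + 1) → R`; the index type `κ 0` is empty. -/
structure FreeResolution (R : Type u) [Ring R] (M : Type u) [AddCommGroup M] [Module R M] where
  κ : ℕ → Type
  fintype : ∀ i, Fintype (κ i)
  -- The empty `κ 0` puts a zero module in degree `-1`, so that `Ext^i` is the cohomology at `κ (i +
  -- 1)` for every `i`, including `i = 0`.
  isEmpty : IsEmpty (κ 0)
  mat : ∀ i, Matrix (κ (i + 1)) (κ i) R
  aug : (κ 1 → R) →ₗ[R] M
  aug_surjective : Function.Surjective aug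
  aug_eq_zero_iff : ∀ x, aug x = 0 ↔ ∃ y, Matrix.vecMul y (mat 1) = x
  exact : ∀ i x, Matrix.vecMul x (mat (i + 1)) = 0 ↔ ∃ y, Matrix.vecMul y (mat (i + 2)) = x

attribute [instance] FreeResolution.fintype FreeResolution.isEmpty

namespace FreeResolution

variable {R : Type u} [Ring R] {M : ModuleCat.{u} R} (F : FreeResolution R M)

theorem rowMap_comp (i : ℕ) : rowMap (F.mat (i + 1)) ∘ₗ rowMap (F.mat (i + 2)) = 0 :=
  LinearMap.ext fun x => (F.exact i _).2 ⟨x, rfl⟩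

theorem aug_comp : F.aug ∘ₗ rowMap (F.mat 1) = 0 :=
  LinearMap.ext fun x => (F.aug_eq_zero_iff _).2 ⟨x, rfl⟩

theorem colMap_colMap (i : ℕ) (y : F.κ i → R) :
    colMap (F.mat (i + 1)) (colMap (F.mat i) y) = 0 := by
  cases i with
  | zero =>
    have : y = 0 := Subsingleton.elim _ _
    rw [this, map_zero, map_zero]
  | succ i =>
    apply (colDual R _).injective
    rw [← colDual_comp_rowMap, ← colDual_comp_rowMap, LinearMap.comp_assoc, F.rowMap_comp,
      LinearMap.comp_zero, map_zero]

/-- The chain complex of modules of row vectors. -/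
def chainComplex : ChainComplex (ModuleCat.{u} R) ℕ :=
  ChainComplex.of (fun i => ModuleCat.of R (F.κ (i + 1) → R))
    (fun i => ModuleCat.ofHom (rowMap (F.mat (i + 1))))
    (fun i => ModuleCat.hom_ext (F.rowMap_comp i))

theorem chainComplex_d (i : ℕ) :
    F.chainComplex.d (i + 1) i = ModuleCat.ofHom (rowMap (F.mat (i + 1))) := by
  simp [chainComplex]

theorem chainComplex_d_comp_aug : F.chainComplex.d 1 0 ≫ ModuleCat.ofHom F.aug = 0 := by
  rw [F.chainComplex_d]
  exact ModuleCat.hom_ext F.aug_comp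

/-- The projective resolution given by a resolution by finite free modules. -/
def toProjectiveResolution : ProjectiveResolution M where
  complex := F.chainComplex
  projective i := by
    change Projective (ModuleCat.of R (F.κ (i + 1) → R))
    infer_instance
  π := (ChainComplex.toSingle₀Equiv _ _).symm ⟨ModuleCat.ofHom F.aug,
    F.chainComplex_d_comp_aug⟩
  quasiIso := ⟨fun i => by
    cases i with
    | zero =>
      -- In degree zero, being a quasi-isomorphism means that `aug` is surjective with kernel the
      -- image of `mat 1`; in positive degrees the target vanishes and exactness is what is
      -- required.
      rw [ChainComplex.quasiIsoAt₀_iff, ShortComplex.quasiIso_iff_of_zeros']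
      · refine (ShortComplex.exact_and_epi_g_iff_of_iso
          (S₂ := ShortComplex.mk (ModuleCat.ofHom (rowMap (F.mat 1)))
            (ModuleCat.ofHom F.aug) (ModuleCat.hom_ext F.aug_comp)) ?_).2
          ⟨?_, ?_⟩
        · exact ShortComplex.isoMk (Iso.refl _) (Iso.refl _) (Iso.refl _)
            ((Category.id_comp _).trans
              ((F.chainComplex_d 0).symm.trans (Category.comp_id _).symm))
            (by
              refine (Category.id_comp _).trans (Eq.trans ?_ (Category.comp_id _).symm)
              exact (ChainComplex.toSingle₀Equiv_symm_apply_f_zero (C := F.chainComplex) (X := M)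
                (ModuleCat.ofHom F.aug) F.chainComplex_d_comp_aug).symm)
        · rw [ShortComplex.moduleCat_exact_iff]
          exact fun x hx => (F.aug_eq_zero_iff x).1 hx
        · exact (ModuleCat.epi_iff_surjective _).2 F.aug_surjective
      all_goals rfl
    | succ i =>
      rw [quasiIsoAt_iff_exactAt']
      · rw [HomologicalComplex.exactAt_iff' _ (i + 1 + 1) (i + 1) i (by simp) (by simp),
          ShortComplex.moduleCat_exact_iff]
        intro x hx
        change (F.chainComplex.d (i + 1) i).hom x = 0 at hx
        change ∃ y, (F.chainComplex.d (i + 1 + 1) (i + 1)).hom y = x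
        rw [chainComplex_d] at hx ⊢
        exact (F.exact i x).1 hx
      · apply ChainComplex.exactAt_succ_single_obj⟩

end FreeResolution

/-! ### `Ext` into the ring as cohomology of the dual complex -/

namespace CategoryTheory.ProjectiveResolution

variable {R : Type u} [Ring R] {M : ModuleCat.{u} R} (P : ProjectiveResolution M)

/-- There are no nonzero coboundaries in degree zero: they would factor through the term of
cohomological degree `1` of the resolution, which is a zero object. -/
theorem extMk_zero_eq_zero_iff {N : ModuleCat.{u} R} (f : P.complex.X 0 ⟶ N)
    (hf : P.complex.d 1 0 ≫ f = 0) : P.extMk f 1 rfl hf = 0 ↔ f = 0 := by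
  refine ⟨fun h => ?_, fun h => by subst h; exact P.extMk_zero 1 rfl⟩
  rw [← P.extEquivCohomologyClass.apply_eq_iff_eq, extEquivCohomologyClass_extMk,
    extEquivCohomologyClass_zero, CochainComplex.HomComplex.CohomologyClass.mk_eq_zero_iff,
    CochainComplex.HomComplex.Cocycle.toSingleMk_mem_coboundaries_iff _ _ _ _ _ 1 (by simp)] at h
  obtain ⟨g, hg⟩ := h
  have hz : Limits.IsZero (P.cochainComplex.X 1) :=
    CochainComplex.isZero_of_isStrictlyLE _ 0 1 (by simp)
  rw [hz.eq_of_src g 0, Limits.comp_zero] at hg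
  rw [← cancel_epi (P.cochainComplexXIso (-((0 : ℕ) : ℤ)) 0 rfl).hom, Limits.comp_zero]
  exact hg.symm

/-- The class in `Ext^i_R(M, R)` of a cocycle of `Hom_R(P, R)`. -/
def cocycleClass (i : ℕ) :
    LinearMap.ker ((homDualComplex P).d i (i + 1)).hom →ₗ[Rᵐᵒᵖ] ExtDual M i where
  toFun z := P.extMk (ModuleCat.ofHom z.1) (i + 1) rfl (ModuleCat.hom_ext z.2)
  map_add' z z' := (P.add_extMk (ModuleCat.ofHom z.1) (ModuleCat.ofHom z'.1) _ _ _ _).symm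
  map_smul' a z := by
    refine Eq.trans ?_ (P.extMk_comp_mk₀ (ModuleCat.ofHom z.1) (i + 1) rfl
      (ModuleCat.hom_ext z.2) (rightMul R a.unop)).symm
    congr 1

theorem cocycleClass_surjective (i : ℕ) : Function.Surjective (P.cocycleClass i) := by
  intro x
  obtain ⟨f, hf, rfl⟩ := P.extMk_surjective x (i + 1) rfl
  exact ⟨⟨f.hom, congrArg ModuleCat.Hom.hom hf⟩, rfl⟩

theorem cocycleClass_succ_eq_zero_iff (i : ℕ)
    (z : LinearMap.ker ((homDualComplex P).d (i + 1) (i + 1 + 1)).hom) :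
    P.cocycleClass (i + 1) z = 0 ↔ ∃ x, ((homDualComplex P).d i (i + 1)).hom x = z.1 := by
  refine (P.extMk_eq_zero_iff (ModuleCat.ofHom z.1) (i + 1 + 1) rfl
      (ModuleCat.hom_ext z.2) i rfl).trans ?_
  constructor
  · rintro ⟨g, hg⟩
    exact ⟨g.hom, congrArg ModuleCat.Hom.hom hg⟩
  · rintro ⟨x, hx⟩
    exact ⟨ModuleCat.ofHom x, ModuleCat.hom_ext hx⟩

theorem cocycleClass_zero_eq_zero_iff
    (z : LinearMap.ker ((homDualComplex P).d 0 (0 + 1)).hom) :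
    P.cocycleClass 0 z = 0 ↔ z.1 = 0 := by
  refine (P.extMk_zero_eq_zero_iff (ModuleCat.ofHom z.1) (ModuleCat.hom_ext z.2)).trans ?_
  exact ⟨fun h => congrArg ModuleCat.Hom.hom h, fun h => ModuleCat.hom_ext h⟩

theorem cocycleClass_eq_zero_iff (i : ℕ)
    (z : LinearMap.ker ((homDualComplex P).d i (i + 1)).hom) :
    P.cocycleClass i z = 0 ↔
      ∃ x, ((homDualComplex P).d ((ComplexShape.up ℕ).prev i) i).hom x = z.1 := by
  cases i with
  | zero =>
    -- In `ComplexShape.up ℕ` the predecessor of `0` is by default `0` itself, and the differential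
    -- from `0` to `0` vanishes.
    have h0 : (homDualComplex P).d ((ComplexShape.up ℕ).prev 0) 0 = 0 :=
      (homDualComplex P).shape _ _ (by simp)
    rw [cocycleClass_zero_eq_zero_iff]
    constructor
    · intro h
      exact ⟨0, (map_zero _).trans h.symm⟩
    · rintro ⟨x, hx⟩
      rw [← hx, h0]
      rfl
  | succ i =>
    rw [cocycleClass_succ_eq_zero_iff, CochainComplex.prev_nat_succ]

/-- `Ext^i_R(M, R)` is the cohomology of `Hom_R(P, R)`. -/
theorem nonempty_homology_iso_extDual (i : ℕ) :
    Nonempty ((homDualComplex P).homology i ≅ ModuleCat.of Rᵐᵒᵖ (ExtDual M i)) := by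
  let S := (homDualComplex P).sc' ((ComplexShape.up ℕ).prev i) i (i + 1)
  have e1 : (homDualComplex P).homology i ≅ S.homology :=
    ShortComplex.homologyMapIso ((homDualComplex P).isoSc' _ i (i + 1) rfl (by simp))
  let p : LinearMap.ker S.g.hom →ₗ[Rᵐᵒᵖ] ExtDual M i := P.cocycleClass i
  have hp : LinearMap.range S.moduleCatToCycles = LinearMap.ker p := by
    ext z
    rw [LinearMap.mem_ker]
    refine Iff.trans ?_ (P.cocycleClass_eq_zero_iff i z).symm
    constructor
    · rintro ⟨x, rfl⟩
      exact ⟨x, rfl⟩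
    · rintro ⟨x, hx⟩
      exact ⟨x, Subtype.ext hx⟩
  have e2 : (LinearMap.ker S.g.hom ⧸ LinearMap.range S.moduleCatToCycles) ≃ₗ[Rᵐᵒᵖ] ExtDual M i :=
    (Submodule.quotEquivOfEq _ _ hp).trans
      (p.quotKerEquivOfSurjective (P.cocycleClass_surjective i))
  exact ⟨e1 ≪≫ S.moduleCatHomologyIso ≪≫ e2.toModuleIso⟩

end CategoryTheory.ProjectiveResolution

/-- `Ext^i_R(M, R)` is the cohomology of the complex of modules of column vectors dual to a
finite free resolution. -/
theorem FreeResolution.isCohomology_extDual {R : Type u} [Ring R] {M : ModuleCat.{u} R}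
    (F : FreeResolution R M) (i : ℕ) :
    IsCohomology (colMap (F.mat i)) (colMap (F.mat (i + 1))) (ExtDual M i) := by
  let P := F.toProjectiveResolution
  have hd : ∀ (j : ℕ) (y : F.κ (j + 1) → R),
      ((homDualComplex P).d j (j + 1)).hom (colDual R _ y) =
        colDual R _ (colMap (F.mat (j + 1)) y) := by
    intro j y
    rw [← colDual_comp_rowMap]
    change colDual R _ y ∘ₗ (F.chainComplex.d (j + 1) j).hom = _
    rw [F.chainComplex_d]
    rfl
  have hd' : ∀ (j : ℕ) (f : (F.κ (j + 1) → R) →ₗ[R] R),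
      ((homDualComplex P).d j (j + 1)).hom f =
        colDual R _ (colMap (F.mat (j + 1)) ((colDual R _).symm f)) := by
    intro j f
    rw [← hd, LinearEquiv.apply_symm_apply]
  let q : LinearMap.ker (colMap (F.mat (i + 1))) →ₗ[Rᵐᵒᵖ]
      LinearMap.ker ((homDualComplex P).d i (i + 1)).hom :=
    LinearMap.restrict (colDual R (F.κ (i + 1))).toLinearMap (fun y hy => by
      exact (hd i y).trans ((congrArg _ hy).trans (map_zero _)))
  refine ⟨P.cocycleClass i ∘ₗ q, (P.cocycleClass_surjective i).comp ?_, fun z => ?_⟩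
  · rintro ⟨f, hf⟩
    refine ⟨⟨(colDual R (F.κ (i + 1))).symm f, ?_⟩, Subtype.ext
      ((colDual R (F.κ (i + 1))).apply_symm_apply f)⟩
    exact (colDual R _).injective (((hd' i f).symm.trans hf).trans (map_zero _).symm)
  · rw [LinearMap.comp_apply]
    cases i with
    | zero =>
      rw [P.cocycleClass_zero_eq_zero_iff]
      refine ((colDual R (F.κ 1)).map_eq_zero_iff (x := z.1)).trans ?_
      constructor
      · intro h
        exact ⟨0, by rw [h, map_zero]⟩
      · rintro ⟨x, hx⟩
        rw [← hx, Subsingleton.elim x 0, map_zero]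
    | succ i =>
      rw [P.cocycleClass_succ_eq_zero_iff]
      constructor
      · rintro ⟨f, hf⟩
        refine ⟨(colDual R _).symm f, (colDual R _).injective ?_⟩
        exact (hd' i f).symm.trans hf
      · rintro ⟨x, hx⟩
        refine ⟨colDual R _ x, (hd i x).trans ?_⟩
        exact congrArg _ hx

/-- If `Ext^i_R(M, R)` is concentrated in degree `d`, so is `RHom_R(M, R)`. -/
theorem nonempty_rHomDual_iso_single {R : Type u} [Ring R]
    [HasDerivedCategory.{w} (ModuleCat.{u} Rᵐᵒᵖ)] {M : ModuleCat.{u} R}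
    (P : ProjectiveResolution M) (d : ℕ) (h : ∀ i, i ≠ d → Subsingleton (ExtDual M i))
    (N : ModuleCat.{u} Rᵐᵒᵖ) (e : ExtDual M d ≃ₗ[Rᵐᵒᵖ] N) :
    Nonempty (rHomDual P ≅ (DerivedCategory.singleFunctor (ModuleCat.{u} Rᵐᵒᵖ) (d : ℤ)).obj N) := by
  let Y : CochainComplex (ModuleCat.{u} Rᵐᵒᵖ) ℤ :=
    (homDualComplex P).extend ComplexShape.embeddingUpNat
  have hY : ∀ i : ℕ, Nonempty (Y.homology (i : ℤ) ≅ ModuleCat.of Rᵐᵒᵖ (ExtDual M i)) := by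
    intro i
    obtain ⟨f⟩ := P.nonempty_homology_iso_extDual i
    exact ⟨(homDualComplex P).extendHomologyIso ComplexShape.embeddingUpNat rfl ≪≫ f⟩
  have hzero : ∀ i : ℤ, i ≠ d → Limits.IsZero (Y.homology i) := by
    intro i hi
    obtain hi0 | hi0 := lt_or_ge i 0
    · rw [← HomologicalComplex.exactAt_iff_isZero_homology]
      exact HomologicalComplex.extend_exactAt _ _ _ (fun j hj => by
        change (j : ℤ) = i at hj
        lia)
    · obtain ⟨j, rfl⟩ := Int.eq_ofNat_of_zero_le hi0
      obtain ⟨f⟩ := hY j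
      have := h j (by rintro rfl; exact hi rfl)
      exact (ModuleCat.isZero_of_subsingleton (ModuleCat.of Rᵐᵒᵖ (ExtDual M j))).of_iso f
  -- Cohomology concentrated in degree `d` places the object in both halves of the t-structure at
  -- `d`, so it is a shifted module; that module is then recovered as the cohomology in degree `d`.
  have hGE : (DerivedCategory.Q.obj Y).IsGE (d : ℤ) := by
    rw [DerivedCategory.isGE_Q_obj_iff, CochainComplex.isGE_iff]
    intro i hi
    rw [HomologicalComplex.exactAt_iff_isZero_homology]
    exact hzero i hi.ne
  have hLE : (DerivedCategory.Q.obj Y).IsLE (d : ℤ) := by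
    rw [DerivedCategory.isLE_Q_obj_iff, CochainComplex.isLE_iff]
    intro i hi
    rw [HomologicalComplex.exactAt_iff_isZero_homology]
    exact hzero i hi.ne'
  obtain ⟨N', ⟨f⟩⟩ :=
    DerivedCategory.exists_iso_singleFunctor_obj_of_isGE_of_isLE (DerivedCategory.Q.obj Y) (d : ℤ)
  obtain ⟨g⟩ := hY d
  have e1 : N' ≅ N :=
    (HomologicalComplex.homologyFunctorSingleIso _ _ (d : ℤ)).symm.app N' ≪≫
      (DerivedCategory.homologyFunctorFactors _ (d : ℤ)).symm.app _ ≪≫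
      (DerivedCategory.homologyFunctor _ (d : ℤ)).mapIso
        ((DerivedCategory.singleFunctorIsoCompQ _ (d : ℤ)).symm.app N' ≪≫ f.symm) ≪≫
      (DerivedCategory.homologyFunctorFactors _ (d : ℤ)).app Y ≪≫ g ≪≫ e.toModuleIso
  exact ⟨f ≪≫ (DerivedCategory.singleFunctor _ (d : ℤ)).mapIso e1⟩

/-! ### Induced modules -/

namespace InducedModule

variable {R S : Type u} [Ring R] [Ring S] (φ : R →+* S)
variable {M N P : Type u} [AddCommGroup M] [Module R M] [AddCommGroup N] [Module R N]
  [AddCommGroup P] [Module R P]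

/-- The canonical map `M → S ⊗_R M`. -/
def unit (M : Type u) [AddCommGroup M] [Module R M] : M →+ InducedModule φ M :=
  (Submodule.mkQ (inducedRelations φ M)).toAddMonoidHom.comp
    (TensorProduct.mk ℤ S M 1).toAddMonoidHom

theorem unit_smul (r : R) (m : M) : unit φ M (r • m) = φ r • unit φ M m := by
  refine ((Submodule.Quotient.eq (inducedRelations φ M)).2 (Submodule.subset_span
    ⟨1, r, m, ?_⟩)).symm
  change φ r • ((1 : S) ⊗ₜ[ℤ] m) - (1 : S) ⊗ₜ[ℤ] (r • m) = _
  rw [TensorProduct.smul_tmul', smul_eq_mul, mul_one, one_mul]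

variable {φ}

theorem span_unit : Submodule.span S (Set.range (unit φ M)) = ⊤ := by
  rw [eq_top_iff]
  intro x _
  obtain ⟨t, rfl⟩ := Submodule.Quotient.mk_surjective _ x
  induction t using TensorProduct.induction_on with
  | zero => exact Submodule.zero_mem _
  | add x y hx hy => exact Submodule.add_mem _ (hx trivial) (hy trivial)
  | tmul s m =>
    have : Submodule.Quotient.mk (p := inducedRelations φ M) (s ⊗ₜ[ℤ] m) = s • unit φ M m := by
      change _ = Submodule.Quotient.mk (p := inducedRelations φ M) (s • ((1 : S) ⊗ₜ[ℤ] m))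
      rw [TensorProduct.smul_tmul', smul_eq_mul, mul_one]
    rw [this]
    exact Submodule.smul_mem _ _ (Submodule.subset_span ⟨m, rfl⟩)

theorem hom_ext {X : Type u} [AddCommGroup X] [Module S X] {f g : InducedModule φ M →ₗ[S] X}
    (h : ∀ m, f (unit φ M m) = g (unit φ M m)) : f = g :=
  LinearMap.ext_on_range (v := unit φ M) span_unit h

/-- The `S`-linear map `S ⊗_R M → X` given by an `R`-linear map `M → X`. -/
def lift {X : Type u} [AddCommGroup X] [Module S X] (g : M →+ X)
    (hg : ∀ (r : R) (m : M), g (r • m) = φ r • g m) : InducedModule φ M →ₗ[S] X :=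
  Submodule.liftQ (inducedRelations φ M)
    (TensorProduct.AlgebraTensorModule.lift
      { toFun := fun s => s • g.toIntLinearMap
        map_add' := fun s t => add_smul s t _
        map_smul' := fun s t => mul_smul s t _ })
    (by
      refine Submodule.span_le.2 ?_
      rintro _ ⟨s, r, m, rfl⟩
      simp [hg, mul_smul])

@[simp] theorem lift_unit {X : Type u} [AddCommGroup X] [Module S X] (g : M →+ X)
    (hg : ∀ (r : R) (m : M), g (r • m) = φ r • g m) (m : M) :
    lift g hg (unit φ M m) = g m := by
  change (1 : S) • g m = g m
  rw [one_smul]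

@[simp] theorem map_unit (f : M →ₗ[R] N) (m : M) :
    map φ f (unit φ M m) = unit φ N (f m) := rfl

theorem map_comp (g : N →ₗ[R] P) (f : M →ₗ[R] N) :
    map φ (g ∘ₗ f) = map φ g ∘ₗ map φ f :=
  hom_ext fun _ => rfl

theorem map_id : map φ (LinearMap.id : M →ₗ[R] M) = LinearMap.id :=
  hom_ext fun _ => rfl

theorem map_zero_hom : map φ (0 : M →ₗ[R] N) = 0 :=
  hom_ext fun m => by simp

/-- Isomorphic modules induce isomorphic modules. -/
def congr (e : M ≃ₗ[R] N) : InducedModule φ M ≃ₗ[S] InducedModule φ N :=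
  LinearEquiv.ofLinearMap (map φ e.toLinearMap) (map φ e.symm.toLinearMap)
    (by rw [← map_comp, LinearEquiv.comp_symm, map_id])
    (by rw [← map_comp, LinearEquiv.symm_comp, map_id])

theorem map_surjective (f : M →ₗ[R] N) (hf : Function.Surjective f) :
    Function.Surjective (map φ f) := by
  rw [← LinearMap.range_eq_top, eq_top_iff, ← span_unit, Submodule.span_le]
  rintro _ ⟨n, rfl⟩
  obtain ⟨m, rfl⟩ := hf n
  exact ⟨unit φ M m, rfl⟩

/-- The projection onto the cokernel of `map φ f` takes at `unit φ N n` a value depending only on `g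
n`. It therefore factors through `map φ g`, and kills the kernel of `map φ g`. -/
theorem map_exact (f : M →ₗ[R] N) (g : N →ₗ[R] P) (hfg : Function.Exact f g)
    (hg : Function.Surjective g) : Function.Exact (map φ f) (map φ g) := by
  intro x
  constructor
  · intro hx
    let q := Submodule.mkQ (LinearMap.range (map φ f))
    have hker : ∀ n, g n = 0 → q (unit φ N n) = 0 := by
      intro n hn
      obtain ⟨m, rfl⟩ := (hfg n).1 hn
      exact (Submodule.Quotient.mk_eq_zero _).2 ⟨unit φ M m, rfl⟩
    have hwd : ∀ n n', g n = g n' → q (unit φ N n) = q (unit φ N n') := by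
      intro n n' h
      rw [← sub_eq_zero, ← map_sub, ← map_sub]
      exact hker _ (by rw [map_sub, h, sub_self])
    let s := Function.surjInv hg
    have hs : ∀ p, g (s p) = p := Function.surjInv_eq hg
    let l : InducedModule φ P →ₗ[S] (InducedModule φ N ⧸ LinearMap.range (map φ f)) :=
      lift (AddMonoidHom.mk' (fun p => q (unit φ N (s p))) (fun a b => by
        rw [← map_add, ← map_add]
        exact hwd _ _ (by rw [map_add, hs, hs, hs]))) (fun r p => by
          change q (unit φ N (s (r • p))) = φ r • q (unit φ N (s p))
          rw [← map_smul, ← unit_smul]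
          exact hwd _ _ (by rw [map_smul, hs, hs]))
    have hl : l ∘ₗ map φ g = q := hom_ext fun n => by
      rw [LinearMap.comp_apply, map_unit]
      refine (lift_unit _ _ _).trans ?_
      exact hwd _ _ (hs _)
    have : q x = 0 := by
      rw [← hl, LinearMap.comp_apply, hx, _root_.map_zero]
    exact (Submodule.Quotient.mk_eq_zero _).1 this
  · rintro ⟨y, rfl⟩
    rw [← LinearMap.comp_apply, ← map_comp, hfg.linearMap_comp_eq_zero, map_zero_hom]
    rfl

/-- Right exactness applies once `g` is replaced by its corestriction to its range; flatness keeps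
the inclusion of the range injective. -/
theorem map_exact_of_flat (flat : IsRightFlat φ) (f : M →ₗ[R] N) (g : N →ₗ[R] P)
    (hfg : Function.Exact f g) : Function.Exact (map φ f) (map φ g) := by
  have h := map_exact (φ := φ) f g.rangeRestrict
    (fun x => by
      rw [← hfg x]
      exact (Subtype.ext_iff (a1 := g.rangeRestrict x) (a2 := 0))) g.surjective_rangeRestrict
  intro x
  rw [← h x]
  have hg : g = (LinearMap.range g).subtype ∘ₗ g.rangeRestrict := rfl
  conv_lhs => rw [hg, map_comp, LinearMap.comp_apply]
  exact map_eq_zero_iff _ (flat _ _ _ (Submodule.subtype_injective _))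

/-- Flatness identifies the module induced from `ker g` with the kernel of `map φ g`; the quotient
by the image is then handled by right exactness. -/
theorem isCohomology_map (flat : IsRightFlat φ) {f : M →ₗ[R] N} {g : N →ₗ[R] P}
    (hgf : ∀ x, g (f x) = 0) {H : Type u} [AddCommGroup H] [Module R H]
    (h : IsCohomology f g H) : IsCohomology (map φ f) (map φ g) (InducedModule φ H) := by
  obtain ⟨p, hp, hp0⟩ := h
  let i := (LinearMap.ker g).subtype
  have hi : Function.Exact (map φ i) (map φ g) :=
    map_exact_of_flat flat _ _ (fun x => ⟨fun hx => ⟨⟨x, hx⟩, rfl⟩, by rintro ⟨z, rfl⟩; exact z.2⟩)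
  have hinj : Function.Injective (map φ i) := flat _ _ _ (Submodule.subtype_injective _)
  let e : InducedModule φ (LinearMap.ker g) ≃ₗ[S] LinearMap.ker (map φ g) :=
    LinearEquiv.ofBijective
      (LinearMap.codRestrict _ (map φ i) (fun x => (hi _).2 ⟨x, rfl⟩))
      ⟨fun x y hxy => hinj (congrArg Subtype.val hxy), fun z => by
        obtain ⟨x, hx⟩ := (hi z.1).1 z.2
        exact ⟨x, Subtype.ext hx⟩⟩
  let f' : M →ₗ[R] LinearMap.ker g := LinearMap.codRestrict _ f hgf
  have hf' : Function.Exact (map φ f') (map φ p) := map_exact _ _ (fun z => by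
    rw [hp0]
    exact ⟨fun ⟨x, hx⟩ => ⟨x, Subtype.ext hx⟩, fun ⟨x, hx⟩ => ⟨x, congrArg Subtype.val hx⟩⟩) hp
  have hif : map φ f = map φ i ∘ₗ map φ f' := by rw [← map_comp]; rfl
  refine ⟨map φ p ∘ₗ e.symm.toLinearMap, (map_surjective p hp).comp e.symm.surjective,
    fun z => (hf' _).trans ?_⟩
  constructor
  · rintro ⟨x, hx⟩
    refine ⟨x, ?_⟩
    rw [hif]
    refine Eq.trans ?_ (congrArg Subtype.val (e.apply_symm_apply z))
    exact congrArg (map φ i) hx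
  · rintro ⟨x, hx⟩
    refine ⟨x, e.injective (Subtype.ext ?_)⟩
    rw [hif] at hx
    exact hx.trans (congrArg Subtype.val (e.apply_symm_apply z)).symm

theorem lift_bijective_of_basis {ι : Type} (b : Module.Basis ι R M)
    {X : Type u} [AddCommGroup X] [Module S X] (c : Module.Basis ι S X) (g : M →+ X)
    (hg : ∀ (r : R) (m : M), g (r • m) = φ r • g m) (hbc : ∀ i, g (b i) = c i) :
    Function.Bijective (lift g hg) := by
  let h : X →ₗ[S] InducedModule φ M := c.constr ℕ (fun i => unit φ M (b i))
  have hc : ∀ i, h (c i) = unit φ M (b i) := fun i => c.constr_basis ℕ _ i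
  have h1 : h ∘ₗ lift g hg = LinearMap.id := hom_ext fun m => by
    rw [LinearMap.comp_apply, lift_unit, LinearMap.id_apply]
    induction b.mem_span m using Submodule.span_induction with
    | mem x hx =>
      obtain ⟨i, rfl⟩ := hx
      rw [hbc, hc]
    | zero => simp
    | add x y _ _ hx hy => rw [map_add, map_add, hx, hy, map_add]
    | smul r x _ hx => rw [hg, map_smul, hx, unit_smul]
  have h2 : lift g hg ∘ₗ h = LinearMap.id := c.ext fun i => by
    rw [LinearMap.comp_apply, hc, lift_unit, hbc, LinearMap.id_apply]
  exact ⟨Function.LeftInverse.injective (g := h) (LinearMap.congr_fun h1),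
    Function.RightInverse.surjective (g := h) (LinearMap.congr_fun h2)⟩

section RowsAndColumns

variable (φ) (ι : Type) [Fintype ι]

/-- `S ⊗_R R^ι = S^ι`. -/
def rowEquiv : InducedModule φ (ι → R) ≃ₗ[S] (ι → S) :=
  LinearEquiv.ofBijective
    (lift (φ := φ) (RingHom.compLeft φ ι).toAddMonoidHom (fun r m => by
      funext a; exact map_mul φ r (m a)))
    (by
      classical
      refine lift_bijective_of_basis (Pi.basisFun R ι) (Pi.basisFun S ι) _ _ fun i => ?_
      funext a
      by_cases h : a = i
      · subst h; simp
      · simp [h])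

theorem rowEquiv_unit (x : ι → R) : rowEquiv φ ι (unit φ _ x) = φ ∘ x :=
  one_smul S (φ ∘ x)

/-- Column vectors form a free right module. -/
def colBasis (R : Type u) [Ring R] : Module.Basis ι Rᵐᵒᵖ (ι → R) :=
  Module.Basis.ofEquivFun
    { toFun := fun x a => op (x a)
      invFun := fun x a => unop (x a)
      left_inv := fun _ => rfl
      right_inv := fun _ => rfl
      map_add' := fun _ _ => rfl
      map_smul' := fun _ _ => rfl }

theorem colBasis_apply [DecidableEq ι] (i : ι) :
    colBasis ι R i = Pi.single i 1 := by
  rw [colBasis, Module.Basis.coe_ofEquivFun]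
  funext a
  change unop ((Pi.single i 1 : ι → Rᵐᵒᵖ) a) = (Pi.single i 1 : ι → R) a
  by_cases h : a = i
  · subst h; simp
  · simp [h]

/-- `R^ι ⊗_R S = S^ι` for right modules. -/
def colEquiv : InducedModule (RingHom.op φ) (ι → R) ≃ₗ[Sᵐᵒᵖ] (ι → S) :=
  LinearEquiv.ofBijective
    (lift (φ := RingHom.op φ) (RingHom.compLeft φ ι).toAddMonoidHom (fun r m => by
      funext a; exact map_mul φ (m a) r.unop))
    (by
      classical
      refine lift_bijective_of_basis (colBasis ι R) (colBasis ι S) _ _ fun i => ?_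
      rw [colBasis_apply, colBasis_apply]
      funext a
      by_cases h : a = i
      · subst h; simp
      · simp [h])

theorem colEquiv_unit (x : ι → R) : colEquiv φ ι (unit _ _ x) = φ ∘ x :=
  one_smul Sᵐᵒᵖ (φ ∘ x)

variable {ι} {κ : Type} [Fintype κ]

theorem rowEquiv_map (A : Matrix ι κ R) (x : InducedModule φ (ι → R)) :
    rowEquiv φ κ (map φ (rowMap A) x) = rowMap (A.map φ) (rowEquiv φ ι x) := by
  have : (rowEquiv φ κ).toLinearMap ∘ₗ map φ (rowMap A) =
      rowMap (A.map φ) ∘ₗ (rowEquiv φ ι).toLinearMap := hom_ext fun m => by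
    simp only [LinearMap.comp_apply, LinearEquiv.coe_coe, map_unit, rowEquiv_unit]
    funext b
    simp [Matrix.vecMul, dotProduct]
  exact LinearMap.congr_fun this x

theorem colEquiv_map (A : Matrix ι κ R) (x : InducedModule (RingHom.op φ) (κ → R)) :
    colEquiv φ ι (map _ (colMap A) x) = colMap (A.map φ) (colEquiv φ κ x) := by
  have : (colEquiv φ ι).toLinearMap ∘ₗ map _ (colMap A) =
      colMap (A.map φ) ∘ₗ (colEquiv φ κ).toLinearMap := hom_ext fun m => by
    simp only [LinearMap.comp_apply, LinearEquiv.coe_coe, map_unit, colEquiv_unit]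
    funext b
    simp [Matrix.mulVec, dotProduct]
  exact LinearMap.congr_fun this x

end RowsAndColumns

end InducedModule

/-- Flatness is invariant under isomorphism. -/
theorem IsRightFlat.of_ringEquiv {R S R' S' : Type u} [Ring R] [Ring S] [Ring R'] [Ring S']
    {φ : R →+* S} (flat : IsRightFlat φ) (ψ : R' →+* S') (eR : R ≃+* R') (eS : S ≃+* S')
    (h : ∀ r, eS (φ r) = ψ (eR r)) : IsRightFlat ψ := by
  intro M N _ instM _ instN f hf
  let : Module R M := Module.compHom M (eR : R →+* R')
  let : Module R N := Module.compHom N (eR : R →+* R')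
  let f' : M →ₗ[R] N :=
    { toFun := f, map_add' := map_add f, map_smul' := fun r m => map_smul f (eR r) m }
  let : Module S' (InducedModule φ N) := Module.compHom _ (eS.symm : S' →+* S)
  let : Module S (InducedModule ψ M) := Module.compHom _ (eS : S →+* S')
  let : Module S' (InducedModule φ M) := Module.compHom _ (eS.symm : S' →+* S)
  have hψ : ∀ r, eS.symm (ψ r) = φ (eR.symm r) := fun r => by
    rw [RingEquiv.symm_apply_eq, h, RingEquiv.apply_symm_apply]
  -- `α` compares the two induced modules. Injectivity of `α` is needed for `M` only, hence the left
  -- inverse `β` for `M` alone.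
  let α (X : Type u) [AddCommGroup X] [Module R' X] [Module R X] [Module S' (InducedModule φ X)]
    (hX : ∀ (r : R) (x : X), r • x = eR r • x)
    (hX' : ∀ (s : S') (x : InducedModule φ X), s • x = eS.symm s • x) :
    InducedModule ψ X →ₗ[S'] InducedModule φ X :=
    InducedModule.lift (InducedModule.unit φ X) (fun r m => by
      rw [hX', hψ, ← InducedModule.unit_smul, hX, RingEquiv.apply_symm_apply])
  let β : InducedModule φ M →ₗ[S] InducedModule ψ M :=
    InducedModule.lift (InducedModule.unit ψ M) (fun r m =>
      (InducedModule.unit_smul ψ (eR r) m).trans (by rw [← h]; rfl))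
  let αM := α M (fun _ _ => rfl) (fun _ _ => rfl)
  let αN := α N (fun _ _ => rfl) (fun _ _ => rfl)
  let β' : InducedModule φ M →ₗ[S'] InducedModule ψ M :=
    { toFun := β
      map_add' := map_add β
      map_smul' := fun s x => (map_smul β (eS.symm s) x).trans (by
        change eS (eS.symm s) • β x = s • β x
        rw [RingEquiv.apply_symm_apply]) }
  have hβα : β' ∘ₗ αM = LinearMap.id := InducedModule.hom_ext fun m => by
    change β (αM (InducedModule.unit ψ M m)) = _
    rw [show αM (InducedModule.unit ψ M m) = _ from InducedModule.lift_unit _ _ _]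
    exact InducedModule.lift_unit _ _ _
  let F' : InducedModule φ M →ₗ[S'] InducedModule φ N :=
    { toFun := InducedModule.map φ f'
      map_add' := map_add _
      map_smul' := fun s x => map_smul (InducedModule.map φ f') (eS.symm s) x }
  have hnat : αN ∘ₗ InducedModule.map ψ f = F' ∘ₗ αM := InducedModule.hom_ext fun m => by
    rw [LinearMap.comp_apply, LinearMap.comp_apply, InducedModule.map_unit,
      show αM (InducedModule.unit ψ M m) = _ from InducedModule.lift_unit _ _ _,
      show αN (InducedModule.unit ψ N (f m)) = _ from InducedModule.lift_unit _ _ _]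
    rfl
  rw [injective_iff_map_eq_zero]
  intro x hx
  have h1 : InducedModule.map φ f' (αM x) = 0 := by
    have := LinearMap.congr_fun hnat x
    rw [LinearMap.comp_apply, hx, map_zero] at this
    exact this.symm
  have h2 : αM x = 0 := (map_eq_zero_iff _ (flat M N f' hf)).1 h1
  have h3 := LinearMap.congr_fun hβα x
  rw [LinearMap.comp_apply, h2, map_zero] at h3
  exact h3.symm

/-! ### Hopf algebras obtained by base change -/

section BaseChangeHopf

variable {K L : Type u} [CommRing K] [CommRing L] [Algebra K L]

/-- The reduction map `R → L ⊗ R`. -/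
abbrev bq (K L : Type u) [CommRing K] [CommRing L] [Algebra K L] {R : Type u} [Ring R]
    [Algebra K R] : R →ₐ[K] L ⊗[K] R :=
  Algebra.TensorProduct.includeRight

/-- Scalars of `L` come from `K` and can be moved across the tensor sign. This is what allows a
coproduct with values in `L ⊗ (A ⊗ A)` to be represented by an element of `A ⊗ A`. -/
theorem bq_surjective (hL : Function.Surjective (algebraMap K L)) {R : Type u} [Ring R]
    [Algebra K R] : Function.Surjective (bq K L (R := R)) := by
  intro x
  induction x using TensorProduct.induction_on with
  | zero => exact ⟨0, map_zero _⟩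
  | add x y hx hy =>
    obtain ⟨a, rfl⟩ := hx
    obtain ⟨b, rfl⟩ := hy
    exact ⟨a + b, map_add _ _ _⟩
  | tmul c r =>
    obtain ⟨c, rfl⟩ := hL c
    refine ⟨c • r, ?_⟩
    change (1 : L) ⊗ₜ[K] (c • r) = _
    rw [← TensorProduct.smul_tmul, Algebra.smul_def, mul_one]

/-- Extension of an algebra morphism to `L ⊗ R`. -/
def bqLift {R T : Type u} [Ring R] [Algebra K R] [Ring T] [Algebra K T]
    [Algebra L T] [IsScalarTower K L T] (f : R →ₐ[K] T) : L ⊗[K] R →ₐ[L] T :=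
  Algebra.TensorProduct.lift (Algebra.ofId L T) f (fun c s => Algebra.commutes c (f s))

@[simp] theorem bqLift_tmul_one {R T : Type u} [Ring R] [Algebra K R] [Ring T] [Algebra K T]
    [Algebra L T] [IsScalarTower K L T] (f : R →ₐ[K] T) (r : R) :
    bqLift (L := L) f ((1 : L) ⊗ₜ[K] r) = f r := by
  refine (Algebra.TensorProduct.lift_tmul _ _ _ _ _).trans ?_
  rw [map_one, one_mul]

/-- The product `R ⊗ R' → T ⊗ T'` of two algebra morphisms. -/
def bqTensor {R R' T T' : Type u} [Ring R] [Algebra K R] [Ring R'] [Algebra K R']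
    [Ring T] [Algebra K T] [Algebra L T] [IsScalarTower K L T]
    [Ring T'] [Algebra K T'] [Algebra L T'] [IsScalarTower K L T']
    (f : R →ₐ[K] T) (g : R' →ₐ[K] T') : R ⊗[K] R' →ₐ[K] T ⊗[L] T' :=
  Algebra.TensorProduct.lift
    ((Algebra.TensorProduct.includeLeft (R := L) (S := K) (A := T) (B := T')).comp f)
    (((Algebra.TensorProduct.includeRight (R := L) (A := T) (B := T')).restrictScalars K).comp g)
    (fun a b => by
      change (f a ⊗ₜ[L] (1 : T')) * ((1 : T) ⊗ₜ[L] g b) = ((1 : T) ⊗ₜ[L] g b) * (f a ⊗ₜ[L] (1 : T'))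
      simp)

@[simp] theorem bqTensor_tmul {R R' T T' : Type u} [Ring R] [Algebra K R] [Ring R'] [Algebra K R']
    [Ring T] [Algebra K T] [Algebra L T] [IsScalarTower K L T]
    [Ring T'] [Algebra K T'] [Algebra L T'] [IsScalarTower K L T']
    (f : R →ₐ[K] T) (g : R' →ₐ[K] T') (a : R) (a' : R') :
    bqTensor (L := L) f g (a ⊗ₜ a') = f a ⊗ₜ[L] g a' := by
  refine (Algebra.TensorProduct.lift_tmul _ _ _ _ _).trans ?_
  change (f a ⊗ₜ[L] (1 : T')) * ((1 : T) ⊗ₜ[L] g a') = _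
  simp

variable {A : Type u} [Ring A] [Algebra K A]

/-- The linear map `x ⊗ y ↦ f x * g y`. -/
abbrev mulPair {R R' S : Type u} [Ring R] [Algebra K R] [Ring R'] [Algebra K R'] [Ring S]
    [Algebra K S] (f : R →ₗ[K] S) (g : R' →ₗ[K] S) : R ⊗[K] R' →ₗ[K] S :=
  LinearMap.mul' K S ∘ₗ TensorProduct.map f g

/-- A coproduct, counit and antipode on `A` with values in `L`, satisfying the axioms of a Hopf
algebra over `L`. -/
structure BaseChangeHopf (K L A : Type u) [CommRing K] [CommRing L] [Algebra K L]
    [Ring A] [Algebra K A] where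
  surj : Function.Surjective (algebraMap K L)
  comul : A →ₐ[K] L ⊗[K] (A ⊗[K] A)
  counit : A →ₐ[K] K
  antipode : A →ₗ[K] A
  -- The axioms are stated on arbitrary representatives `t`, the form in which reductions of maps
  -- between completions can be evaluated.
  coassoc : ∀ (a : A) (t : A ⊗[K] A), comul a = 1 ⊗ₜ t →
    mulPair
      ((LinearMap.baseChange L (TensorProduct.map LinearMap.id
        (Algebra.TensorProduct.includeLeft (R := K) (S := K)
          (A := A) (B := A)).toLinearMap)).restrictScalars K ∘ₗ comul.toLinearMap)
      ((bq K L).comp ((Algebra.TensorProduct.includeRight (R := K) (A := A)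
          (B := A ⊗[K] A)).comp (Algebra.TensorProduct.includeRight (R := K) (A := A)
            (B := A)))).toLinearMap t =
    mulPair
      ((bq K L).comp (Algebra.TensorProduct.includeLeft (R := K) (S := K) (A := A)
        (B := A ⊗[K] A))).toLinearMap
      ((LinearMap.baseChange L (Algebra.TensorProduct.includeRight (R := K) (A := A)
        (B := A ⊗[K] A)).toLinearMap).restrictScalars K ∘ₗ comul.toLinearMap) t
  counit_comul : ∀ (a : A) (t : A ⊗[K] A), comul a = 1 ⊗ₜ t →
    (1 : L) ⊗ₜ[K] mulPair (Algebra.linearMap K A ∘ₗ counit.toLinearMap) LinearMap.id t = 1 ⊗ₜ a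
  comul_counit : ∀ (a : A) (t : A ⊗[K] A), comul a = 1 ⊗ₜ t →
    (1 : L) ⊗ₜ[K] mulPair LinearMap.id (Algebra.linearMap K A ∘ₗ counit.toLinearMap) t = 1 ⊗ₜ a
  antipode_comul : ∀ (a : A) (t : A ⊗[K] A), comul a = 1 ⊗ₜ t →
    (1 : L) ⊗ₜ[K] mulPair antipode LinearMap.id t = 1 ⊗ₜ algebraMap K A (counit a)
  comul_antipode : ∀ (a : A) (t : A ⊗[K] A), comul a = 1 ⊗ₜ t →
    (1 : L) ⊗ₜ[K] mulPair LinearMap.id antipode t = 1 ⊗ₜ algebraMap K A (counit a)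

namespace BaseChangeHopf

variable (H : BaseChangeHopf K L A)

/-- The coproduct of `L ⊗ A`. -/
def comulL : L ⊗[K] A →ₐ[L] (L ⊗[K] A) ⊗[L] (L ⊗[K] A) :=
  bqLift (((bqLift (bqTensor (bq K L) (bq K L))).restrictScalars K).comp H.comul)

theorem comulL_of_eq {a : A} {t : A ⊗[K] A} (h : H.comul a = 1 ⊗ₜ t) :
    H.comulL ((1 : L) ⊗ₜ[K] a) = bqTensor (L := L) (bq K L) (bq K L) t := by
  refine (bqLift_tmul_one _ _).trans ?_
  change bqLift _ (H.comul a) = _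
  rw [h, bqLift_tmul_one]

theorem exists_rep (a : A) : ∃ t : A ⊗[K] A, H.comul a = 1 ⊗ₜ t :=
  (bq_surjective H.surj (H.comul a)).imp fun _ h => h.symm

/-- The counit of `L ⊗ A`. -/
def counitL : L ⊗[K] A →ₐ[L] L := bqLift ((Algebra.ofId K L).comp H.counit)

@[simp] theorem counitL_tmul (a : A) :
    H.counitL ((1 : L) ⊗ₜ[K] a) = algebraMap K L (H.counit a) :=
  bqLift_tmul_one _ _

/-- The antipode of `L ⊗ A`. -/
def antipodeL : L ⊗[K] A →ₗ[L] L ⊗[K] A := LinearMap.baseChange L H.antipode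

@[simp] theorem antipodeL_tmul (a : A) :
    H.antipodeL ((1 : L) ⊗ₜ[K] a) = 1 ⊗ₜ H.antipode a := rfl

theorem coassocL (x : L ⊗[K] A) :
    TensorProduct.assoc L _ _ _ (H.comulL.toLinearMap.rTensor _ (H.comulL x)) =
      H.comulL.toLinearMap.lTensor _ (H.comulL x) := by
  obtain ⟨a, rfl⟩ := bq_surjective H.surj x
  obtain ⟨t, ht⟩ := H.exists_rep a
  -- The axiom is an identity in `L ⊗ (A ⊗ (A ⊗ A))`; this map carries it to the triple tensor
  -- product of `L ⊗ A` over `L`.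
  have key := congrArg (bqLift (L := L) (bqTensor (L := L) (bq K L)
    (bqTensor (L := L) (bq K L) (bq K L)))) (H.coassoc a t ht)
  change TensorProduct.assoc L _ _ _ (H.comulL.toLinearMap.rTensor _ (H.comulL (1 ⊗ₜ a))) =
      H.comulL.toLinearMap.lTensor _ (H.comulL (1 ⊗ₜ a))
  rw [H.comulL_of_eq ht]
  refine Eq.trans ?_ (key.trans ?_)
  · clear key ht
    induction t using TensorProduct.induction_on with
    | zero => simp
    | add x y hx hy => simp only [map_add, hx, hy]
    | tmul x y =>
      obtain ⟨s, hs⟩ := H.exists_rep x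
      rw [bqTensor_tmul, LinearMap.rTensor_tmul, AlgHom.toLinearMap_apply]
      change TensorProduct.assoc L _ _ _ (H.comulL (1 ⊗ₜ x) ⊗ₜ _) = _
      rw [H.comulL_of_eq hs, LinearMap.comp_apply, TensorProduct.map_tmul, LinearMap.mul'_apply,
        map_mul, LinearMap.comp_apply, AlgHom.toLinearMap_apply, hs]
      clear hs
      induction s using TensorProduct.induction_on with
      | zero => simp
      | add x y hx hy =>
        simp only [map_add, TensorProduct.add_tmul, TensorProduct.tmul_add, hx, hy, add_mul]
      | tmul z w => simp
  · clear key ht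
    induction t using TensorProduct.induction_on with
    | zero => simp
    | add x y hx hy => simp only [map_add, hx, hy]
    | tmul x y =>
      obtain ⟨s, hs⟩ := H.exists_rep y
      rw [bqTensor_tmul, LinearMap.lTensor_tmul, AlgHom.toLinearMap_apply]
      change _ = _ ⊗ₜ H.comulL (1 ⊗ₜ y)
      rw [H.comulL_of_eq hs, LinearMap.comp_apply, TensorProduct.map_tmul, LinearMap.mul'_apply,
        map_mul, LinearMap.comp_apply, AlgHom.toLinearMap_apply, AlgHom.toLinearMap_apply, hs]
      clear hs
      induction s using TensorProduct.induction_on with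
      | zero => simp
      | add x y hx hy => simp only [map_add, TensorProduct.tmul_add, hx, hy, mul_add]
      | tmul z w => simp

theorem rTensor_counitL (x : L ⊗[K] A) :
    H.counitL.toLinearMap.rTensor _ (H.comulL x) = 1 ⊗ₜ x := by
  obtain ⟨a, rfl⟩ := bq_surjective H.surj x
  obtain ⟨t, ht⟩ := H.exists_rep a
  change H.counitL.toLinearMap.rTensor _ (H.comulL (1 ⊗ₜ a)) = (1 : L) ⊗ₜ ((1 : L) ⊗ₜ a)
  rw [H.comulL_of_eq ht, ← H.counit_comul a t ht]
  clear ht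
  induction t using TensorProduct.induction_on with
  | zero => simp
  | add x y hx hy => simp only [map_add, hx, hy, TensorProduct.tmul_add]
  | tmul x y =>
    simp only [bqTensor_tmul, Algebra.TensorProduct.includeRight_apply, LinearMap.rTensor_tmul,
      AlgHom.toLinearMap_apply, counitL_tmul, LinearMap.comp_apply, TensorProduct.map_tmul,
      LinearMap.mul'_apply, Algebra.linearMap_apply, LinearMap.id_apply,
      TensorProduct.tmul_smul, Algebra.algebraMap_eq_smul_one, smul_mul_assoc, one_mul]
    rw [← TensorProduct.smul_tmul']

theorem lTensor_counitL (x : L ⊗[K] A) :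
    H.counitL.toLinearMap.lTensor _ (H.comulL x) = x ⊗ₜ 1 := by
  obtain ⟨a, rfl⟩ := bq_surjective H.surj x
  obtain ⟨t, ht⟩ := H.exists_rep a
  change H.counitL.toLinearMap.lTensor _ (H.comulL (1 ⊗ₜ a)) = ((1 : L) ⊗ₜ[K] a) ⊗ₜ (1 : L)
  rw [H.comulL_of_eq ht, ← H.comul_counit a t ht]
  clear ht
  induction t using TensorProduct.induction_on with
  | zero => simp
  | add x y hx hy => simp only [map_add, hx, hy, TensorProduct.tmul_add, TensorProduct.add_tmul]
  | tmul x y =>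
    simp [TensorProduct.tmul_smul, TensorProduct.smul_tmul', Algebra.algebraMap_eq_smul_one]

theorem antipodeL_comulL (x : L ⊗[K] A) :
    LinearMap.mul' L _ (H.antipodeL.rTensor _ (H.comulL x)) = algebraMap L _ (H.counitL x) := by
  obtain ⟨a, rfl⟩ := bq_surjective H.surj x
  obtain ⟨t, ht⟩ := H.exists_rep a
  change LinearMap.mul' L _ (H.antipodeL.rTensor _ (H.comulL (1 ⊗ₜ a))) =
    algebraMap L _ (H.counitL (1 ⊗ₜ a))
  have h := H.antipode_comul a t ht
  rw [H.comulL_of_eq ht, counitL_tmul]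
  refine Eq.trans ?_ (h.trans ?_)
  · clear ht h
    induction t using TensorProduct.induction_on with
    | zero => simp
    | add x y hx hy => simp only [map_add, hx, hy, TensorProduct.tmul_add]
    | tmul x y => simp
  · rw [← IsScalarTower.algebraMap_apply K L]
    exact (bq K L).commutes _

theorem comulL_antipodeL (x : L ⊗[K] A) :
    LinearMap.mul' L _ (H.antipodeL.lTensor _ (H.comulL x)) = algebraMap L _ (H.counitL x) := by
  obtain ⟨a, rfl⟩ := bq_surjective H.surj x
  obtain ⟨t, ht⟩ := H.exists_rep a
  change LinearMap.mul' L _ (H.antipodeL.lTensor _ (H.comulL (1 ⊗ₜ a))) =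
    algebraMap L _ (H.counitL (1 ⊗ₜ a))
  have h := H.comul_antipode a t ht
  rw [H.comulL_of_eq ht, counitL_tmul]
  refine Eq.trans ?_ (h.trans ?_)
  · clear ht h
    induction t using TensorProduct.induction_on with
    | zero => simp
    | add x y hx hy => simp only [map_add, hx, hy, TensorProduct.tmul_add]
    | tmul x y => simp
  · rw [← IsScalarTower.algebraMap_apply K L]
    exact (bq K L).commutes _

/-- The bialgebra `L ⊗ A`. -/
abbrev bialgebra : Bialgebra L (L ⊗[K] A) :=
  letI : Coalgebra L (L ⊗[K] A) :=
    { comul := H.comulL.toLinearMap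
      counit := H.counitL.toLinearMap
      coassoc := LinearMap.ext H.coassocL
      rTensor_counit_comp_comul := LinearMap.ext H.rTensor_counitL
      lTensor_counit_comp_comul := LinearMap.ext H.lTensor_counitL }
  Bialgebra.mk' L (L ⊗[K] A) (map_one H.counitL) (map_mul H.counitL _ _) (map_one H.comulL)
    (map_mul H.comulL _ _)

/-- The Hopf algebra `L ⊗ A`. -/
abbrev hopfAlgebra : HopfAlgebra L (L ⊗[K] A) :=
  letI := H.bialgebra
  { antipode := H.antipodeL
    mul_antipode_rTensor_comul := LinearMap.ext H.antipodeL_comulL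
    mul_antipode_lTensor_comul := LinearMap.ext H.comulL_antipodeL }

/-- The antipode of an ordinary Hopf algebra reverses products; `hopfAlgebra` is constructed in
order to apply this to `L ⊗ A`. -/
theorem antipode_mul (a b : A) :
    (1 : L) ⊗ₜ[K] H.antipode (a * b) = 1 ⊗ₜ (H.antipode b * H.antipode a) := by
  let _ := H.hopfAlgebra
  have h := HopfAlgebra.antipode_mul_antidistrib (R := L) ((1 : L) ⊗ₜ[K] a) (1 ⊗ₜ[K] b)
  rw [Algebra.TensorProduct.tmul_mul_tmul, one_mul] at h
  refine h.trans ?_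
  change ((1 : L) ⊗ₜ[K] H.antipode b) * (1 ⊗ₜ[K] H.antipode a) = _
  rw [Algebra.TensorProduct.tmul_mul_tmul, one_mul]

end BaseChangeHopf
end BaseChangeHopf

/-! ### Complete modules and reduction modulo `h ^ n` -/

section Complete

variable {k : Type u} [Field k]

/-- An `h`-adically separated module in which the series `∑ h ^ n y_n` converge. -/
structure HComplete (k : Type u) [Field k] (M : Type u) [AddCommGroup M] [Module k⟦X⟧ M] :
    Prop where
  sep : ∀ x : M, (∀ n : ℕ, ∃ s : M, x = (PowerSeries.X : k⟦X⟧) ^ n • s) → x = 0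
  sum : ∀ y : ℕ → M, ∃ s : M, ∀ n : ℕ, ∃ z : M,
    s - ∑ i ∈ Finset.range n, (PowerSeries.X : k⟦X⟧) ^ i • y i = (PowerSeries.X : k⟦X⟧) ^ n • z

theorem mem_span_X_pow_smul_top {M : Type u} [AddCommGroup M] [Module k⟦X⟧ M] (n : ℕ) (x : M) :
    x ∈ (Ideal.span {(PowerSeries.X : k⟦X⟧)} ^ n • ⊤ : Submodule k⟦X⟧ M) ↔
      ∃ s : M, x = (PowerSeries.X : k⟦X⟧) ^ n • s := by
  rw [Ideal.span_singleton_pow, Submodule.ideal_span_singleton_smul,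
    Submodule.mem_smul_pointwise_iff_exists]
  exact ⟨fun ⟨s, _, h⟩ => ⟨s, h.symm⟩, fun ⟨s, h⟩ => ⟨s, trivial, h.symm⟩⟩

theorem HComplete.of_isAdicComplete {M : Type u} [AddCommGroup M] [Module k⟦X⟧ M]
    (h : IsAdicComplete (Ideal.span {(PowerSeries.X : k⟦X⟧)}) M) : HComplete k M where
  sep x hx := h.toIsHausdorff.haus x fun n => by
    rw [SModEq.zero, mem_span_X_pow_smul_top]
    exact hx n
  sum y := by
    obtain ⟨s, hs⟩ := h.toIsPrecomplete.prec
      (f := fun n => ∑ i ∈ Finset.range n, (PowerSeries.X : k⟦X⟧) ^ i • y i) (by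
        intro m n hmn
        rw [SModEq.sub_mem, ← neg_mem_iff, neg_sub, ← Finset.sum_range_add_sum_Ico _ hmn,
          add_sub_cancel_left]
        refine Submodule.sum_mem _ fun i hi => ?_
        rw [mem_span_X_pow_smul_top]
        refine ⟨(PowerSeries.X : k⟦X⟧) ^ (i - m) • y i, ?_⟩
        rw [← mul_smul, ← pow_add, Nat.add_sub_cancel' (Finset.mem_Ico.1 hi).1])
    refine ⟨s, fun n => ?_⟩
    rw [← mem_span_X_pow_smul_top, ← SModEq.sub_mem]
    exact (hs n).symm

theorem HComplete.pi {ι : Type} {M : Type u} [AddCommGroup M] [Module k⟦X⟧ M]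
    (h : HComplete k M) : HComplete k (ι → M) where
  sep x hx := funext fun a => h.sep _ fun n => by
    obtain ⟨s, hs⟩ := hx n
    exact ⟨s a, congrFun hs a⟩
  sum y := by
    choose s z hz using fun a => h.sum (fun i => y i a)
    refine ⟨s, fun n => ⟨fun a => z a n, funext fun a => ?_⟩⟩
    rw [Pi.sub_apply, Finset.sum_apply]
    exact hz a n

end Complete

/-! ### Reductions modulo `h ^ n` and maps between completions -/

section Truncation

variable {k : Type u} [Field k]

variable (k) in
/-- The ring `k⟦X⟧ / X ^ n`. -/
abbrev KTrunc (n : ℕ) : Type u := k⟦X⟧ ⧸ Ideal.span {(PowerSeries.X : k⟦X⟧) ^ n}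

/-- Reduction modulo `h ^ n`. -/
abbrev hq {R : Type u} [Ring R] [Algebra k⟦X⟧ R] (n : ℕ) : R →ₐ[k⟦X⟧] HTrunc k R n :=
  bq k⟦X⟧ (KTrunc k n)

variable {R S : Type u} [Ring R] [Algebra k⟦X⟧ R] [Ring S] [Algebra k⟦X⟧ S]

theorem hq_surjective (n : ℕ) : Function.Surjective (hq (k := k) (R := R) n) :=
  bq_surjective Ideal.Quotient.mk_surjective

theorem hq_eq_zero_iff (n : ℕ) (r : R) :
    hq (k := k) n r = 0 ↔ ∃ s : R, r = (PowerSeries.X : k⟦X⟧) ^ n • s := by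
  let e := TensorProduct.quotTensorEquivQuotSMul R (Ideal.span {(PowerSeries.X : k⟦X⟧) ^ n})
  have he : e (hq n r) = Submodule.Quotient.mk r :=
    (TensorProduct.quotTensorEquivQuotSMul_mk_tmul _ 1 r).trans (by rw [one_smul])
  rw [← e.map_eq_zero_iff, he, Submodule.Quotient.mk_eq_zero, ← mem_span_X_pow_smul_top,
    Ideal.span_singleton_pow]

theorem hq_eq_iff (n : ℕ) (r r' : R) :
    hq (k := k) n r = hq n r' ↔ ∃ s : R, r - r' = (PowerSeries.X : k⟦X⟧) ^ n • s := by
  rw [← hq_eq_zero_iff, map_sub, sub_eq_zero]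

theorem hq_map (n : ℕ) (f : R →ₗ[k⟦X⟧] S) {r r' : R} (h : hq (k := k) n r = hq n r') :
    hq (k := k) n (f r) = hq n (f r') :=
  congrArg (LinearMap.baseChange (KTrunc k n) f) h

theorem hq_ext (hR : HComplete k R) {r r' : R} (h : ∀ n, hq (k := k) n r = hq n r') : r = r' := by
  rw [← sub_eq_zero]
  exact hR.sep _ fun n => (hq_eq_iff n r r').1 (h n)

theorem proj_of (n : ℕ) (r : R) : HCompletion.proj k R n (HCompletion.of k R r) = hq n r := rfl

theorem exists_proj_eq (n : ℕ) (x : HCompletion k R) :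
    ∃ r : R, HCompletion.proj k R n x = hq n r :=
  (hq_surjective n _).imp fun _ h => h.symm

theorem HCompletion.hext {x y : HCompletion k R}
    (h : ∀ n, HCompletion.proj k R n x = HCompletion.proj k R n y) : x = y :=
  Subtype.ext (funext h)

theorem of_bijective (hR : HComplete k R) : Function.Bijective (HCompletion.of k R) := by
  constructor
  · intro r r' h
    exact hq_ext hR fun n => congrArg (HCompletion.proj k R n) h
  · intro x
    choose r hr using fun n => exists_proj_eq n x
    -- Representatives of consecutive reductions differ by a multiple of `h ^ n`, so `r` telescopes
    -- into a series `∑ h ^ n y n`, which converges.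
    have hstep : ∀ n, ∃ y : R, r (n + 1) - r n = (PowerSeries.X : k⟦X⟧) ^ n • y := fun n => by
      rw [← hq_eq_iff, ← hr n]
      have h := x.2 n (n + 1) n.le_succ
      refine Eq.trans ?_ h
      exact (congrArg (hTransition k R n.le_succ) (hr (n + 1))).symm
    choose y hy using hstep
    obtain ⟨s, hs⟩ := hR.sum y
    refine ⟨s + r 0, HCompletion.hext fun n => ?_⟩
    rw [proj_of, hr n, hq_eq_iff]
    obtain ⟨z, hz⟩ := hs n
    refine ⟨z, ?_⟩
    rw [← hz, Finset.sum_congr rfl fun i _ => (hy i).symm, Finset.sum_range_sub]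
    abel

/-- Modulo `h ^ n`, a map extended to the completion may be evaluated on any representative. All
later identities between completed maps are reduced to tensors in this way. -/
theorem proj_extend (f : R →ₗ[k⟦X⟧] HCompletion k S) (n : ℕ) {x : HCompletion k R} {r : R}
    (h : HCompletion.proj k R n x = hq n r) :
    HCompletion.proj k S n (HCompletion.extend f x) = HCompletion.proj k S n (f r) := by
  change LinearMap.liftBaseChange _ ((HCompletion.proj k S n).toLinearMap ∘ₗ f)
    (HCompletion.proj k R n x) = _
  rw [h]
  exact (LinearMap.liftBaseChange_tmul _ _ _ _).trans (one_smul _ _)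

theorem proj_map (f : R →ₗ[k⟦X⟧] S) (n : ℕ) {x : HCompletion k R} {r : R}
    (h : HCompletion.proj k R n x = hq n r) :
    HCompletion.proj k S n (HCompletion.map f x) = hq n (f r) :=
  proj_extend _ n h

theorem baseChange_comp_proj (f : R →ₗ[k⟦X⟧] S) (n : ℕ) :
    (LinearMap.baseChange (KTrunc k n) f).restrictScalars k⟦X⟧ ∘ₗ
      (HCompletion.proj k R n).toLinearMap =
      (HCompletion.proj k S n).toLinearMap ∘ₗ HCompletion.map f := by
  refine LinearMap.ext fun x => ?_
  obtain ⟨r, hr⟩ := exists_proj_eq n x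
  exact (congrArg (LinearMap.baseChange (KTrunc k n) f) hr).trans (proj_map f n hr).symm

theorem proj_mulMap {R' : Type u} [Ring R'] [Algebra k⟦X⟧ R'] (f : R →ₗ[k⟦X⟧] HCompletion k S)
    (g : R' →ₗ[k⟦X⟧] HCompletion k S) (n : ℕ) {x : HCompletion k (R ⊗[k⟦X⟧] R')}
    {t : R ⊗[k⟦X⟧] R'} (h : HCompletion.proj k _ n x = hq n t) :
    HCompletion.proj k S n (HCompletion.mulMap f g x) =
      mulPair ((HCompletion.proj k S n).toLinearMap ∘ₗ f)
        ((HCompletion.proj k S n).toLinearMap ∘ₗ g) t := by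
  refine (proj_extend _ n h).trans ?_
  refine LinearMap.congr_fun (f := (HCompletion.proj k S n).toLinearMap ∘ₗ
    (LinearMap.mul' k⟦X⟧ (HCompletion k S) ∘ₗ TensorProduct.map f g)) ?_ t
  exact TensorProduct.ext' fun a b => (HCompletion.proj k S n).map_mul' (f a) (g b)

end Truncation

/-! ### Topological Hopf algebras -/

namespace TopologicalHopfAlgebra

/-- The linear map `x ⊗ y ↦ g y • x`. -/
def rightSlice {k : Type u} [Field k] {B : Type u} [Ring B] [Algebra k⟦X⟧ B]
    (g : B →ₗ[k⟦X⟧] k⟦X⟧) : B ⊗[k⟦X⟧] B →ₗ[k⟦X⟧] B :=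
  (TensorProduct.rid k⟦X⟧ B).toLinearMap ∘ₗ LinearMap.lTensor B g

@[simp] theorem rightSlice_tmul {k : Type u} [Field k] {B : Type u} [Ring B] [Algebra k⟦X⟧ B]
    (g : B →ₗ[k⟦X⟧] k⟦X⟧) (x y : B) :
    rightSlice g (x ⊗ₜ y) = g y • x := by
  simp [rightSlice]

/-- The linear map `x ⊗ y ↦ g x • y`. -/
def leftSlice {k : Type u} [Field k] {B : Type u} [Ring B] [Algebra k⟦X⟧ B]
    (g : B →ₗ[k⟦X⟧] k⟦X⟧) : B ⊗[k⟦X⟧] B →ₗ[k⟦X⟧] B :=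
  (TensorProduct.lid k⟦X⟧ B).toLinearMap ∘ₗ LinearMap.rTensor B g

@[simp] theorem leftSlice_tmul {k : Type u} [Field k] {B : Type u} [Ring B] [Algebra k⟦X⟧ B]
    (g : B →ₗ[k⟦X⟧] k⟦X⟧) (x y : B) :
    leftSlice g (x ⊗ₜ y) = g x • y := by
  simp [leftSlice]

variable {k : Type u} [Field k] {B : Type u} [Ring B] [Algebra k⟦X⟧ B] [TopologicalHopfAlgebra k B]

variable (k B) in
theorem hComplete : HComplete k B := HComplete.of_isAdicComplete (isAdicComplete (k := k))

variable (k B) in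
/-- The reduction of a topological Hopf algebra modulo `h ^ n`. -/
def trunc (n : ℕ) : BaseChangeHopf k⟦X⟧ (KTrunc k n) B where
  surj := Ideal.Quotient.mk_surjective
  comul := (HCompletion.proj k (B ⊗[k⟦X⟧] B) n).comp (comul (k := k))
  counit := counit (k := k)
  antipode := antipode (k := k)
  coassoc a t ht := by
    have ht' : HCompletion.proj k _ n (comul (k := k) a) = hq n t := ht
    have key := congrArg (HCompletion.proj k _ n) (coassoc (k := k) a)
    rw [proj_mulMap _ _ n ht', proj_mulMap _ _ n ht'] at key
    refine Eq.trans ?_ (key.trans ?_)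
    · exact congrArg (fun F => mulPair F _ t)
        (congrArg (· ∘ₗ (comul (k := k)).toLinearMap) (baseChange_comp_proj _ n))
    · exact (congrArg (fun F => mulPair _ F t)
        (congrArg (· ∘ₗ (comul (k := k)).toLinearMap) (baseChange_comp_proj _ n))).symm
  counit_comul a t ht :=
    (proj_map _ n ht).symm.trans (congrArg (HCompletion.proj k _ n) (counit_comul (k := k) a))
  comul_counit a t ht :=
    (proj_map _ n ht).symm.trans (congrArg (HCompletion.proj k _ n) (comul_counit (k := k) a))
  antipode_comul a t ht :=
    (proj_map _ n ht).symm.trans (congrArg (HCompletion.proj k _ n) (antipode_comul (k := k) a))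
  comul_antipode a t ht :=
    (proj_map _ n ht).symm.trans (congrArg (HCompletion.proj k _ n) (comul_antipode (k := k) a))

/-- The identity holds in the Hopf algebra `B / h ^ n B` for every `n`, and `B` is separated. -/
theorem antipode_mul (a b : B) :
    antipode (k := k) (a * b) = antipode (k := k) b * antipode (k := k) a :=
  hq_ext (hComplete k B) fun n => (trunc k B n).antipode_mul a b

variable (k) in
/-- `b ↦ ∑ Γ (b' ⊗ b'')`. -/
def contract (Γ : B ⊗[k⟦X⟧] B →ₗ[k⟦X⟧] B) : B →ₗ[k⟦X⟧] B :=
  (AlgEquiv.ofBijective _ (of_bijective (hComplete k B))).symm.toLinearMap ∘ₗ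
    HCompletion.map Γ ∘ₗ (comul (k := k)).toLinearMap

theorem hq_contract (Γ : B ⊗[k⟦X⟧] B →ₗ[k⟦X⟧] B) {n : ℕ} {b : B} {t : B ⊗[k⟦X⟧] B}
    (h : HCompletion.proj k _ n (comul (k := k) b) = hq n t) :
    hq (k := k) n (contract k Γ b) = hq n (Γ t) := by
  rw [← proj_of, ← proj_map Γ n h]
  exact congrArg (HCompletion.proj k _ n)
    ((AlgEquiv.ofBijective _ (of_bijective (hComplete k B))).apply_symm_apply _)

variable (k B) in
theorem proj_comul_one (n : ℕ) :
    HCompletion.proj k _ n (comul (k := k) (1 : B)) = hq n (1 : B ⊗[k⟦X⟧] B) :=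
  (congrArg (HCompletion.proj k _ n) (comul (k := k)).map_one').trans
    ((HCompletion.proj k (B ⊗[k⟦X⟧] B) n).map_one'.trans
      (hq (k := k) (R := B ⊗[k⟦X⟧] B) n).map_one'.symm)

theorem proj_comul_mul {n : ℕ} {a b : B} {s t : B ⊗[k⟦X⟧] B}
    (hs : HCompletion.proj k _ n (comul (k := k) a) = hq n s)
    (ht : HCompletion.proj k _ n (comul (k := k) b) = hq n t) :
    HCompletion.proj k _ n (comul (k := k) (a * b)) = hq n (s * t) := by
  rw [map_mul, map_mul, hs, ht, map_mul]

variable (k B) in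
theorem antipode_one : antipode (k := k) (1 : B) = 1 := by
  refine hq_ext (hComplete k B) fun n => ?_
  have h := (trunc k B n).antipode_comul 1 1 (proj_comul_one k B n)
  have h1 : mulPair (trunc k B n).antipode LinearMap.id (1 : B ⊗[k⟦X⟧] B) =
      antipode (k := k) (1 : B) := by
    rw [Algebra.TensorProduct.one_def]
    simp [trunc]
  have h2 : algebraMap k⟦X⟧ B ((trunc k B n).counit 1) = 1 := by rw [map_one, map_one]
  rw [h1, h2] at h
  exact h

/-- `b ↦ ∑ g (b'') b'`. -/
def rightHit (g : B →ₗ[k⟦X⟧] k⟦X⟧) : B →ₗ[k⟦X⟧] B := contract k (rightSlice g)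

/-- `b ↦ ∑ g (b') b''`. -/
def leftHit (g : B →ₗ[k⟦X⟧] k⟦X⟧) : B →ₗ[k⟦X⟧] B := contract k (leftSlice g)

theorem rightHit_one (g : B →ₗ[k⟦X⟧] k⟦X⟧) : rightHit g 1 = g 1 • (1 : B) := by
  refine hq_ext (hComplete k B) fun n => ?_
  rw [rightHit, hq_contract _ (proj_comul_one k B n), Algebra.TensorProduct.one_def,
    rightSlice_tmul]

theorem leftHit_one (g : B →ₗ[k⟦X⟧] k⟦X⟧) : leftHit g 1 = g 1 • (1 : B) := by
  refine hq_ext (hComplete k B) fun n => ?_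
  rw [leftHit, hq_contract _ (proj_comul_one k B n), Algebra.TensorProduct.one_def,
    leftSlice_tmul]

theorem rightHit_counit (b : B) : rightHit (counit (k := k)).toLinearMap b = b := by
  refine hq_ext (hComplete k B) fun n => ?_
  obtain ⟨t, ht⟩ := exists_proj_eq n (comul (k := k) b)
  rw [rightHit, hq_contract _ ht]
  refine Eq.trans ?_ ((trunc k B n).comul_counit b t ht)
  refine congrArg (hq n) ?_
  clear ht
  induction t using TensorProduct.induction_on with
  | zero => simp
  | add x y hx hy => simp only [map_add, hx, hy]
  | tmul x y =>
    simp only [rightSlice_tmul, LinearMap.comp_apply, TensorProduct.map_tmul,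
      LinearMap.mul'_apply, LinearMap.id_apply, Algebra.linearMap_apply]
    rw [← Algebra.commutes, ← Algebra.smul_def]
    rfl

/-- Consequence of the multiplicativity of `Δ`. Applied to matrix coefficients, it makes `b ↦ ∑ b'
ρ(b'')` a ring morphism to matrices. -/
theorem rightHit_mul {ι : Type} [Fintype ι] {g : B →ₗ[k⟦X⟧] k⟦X⟧} {p q : ι → B →ₗ[k⟦X⟧] k⟦X⟧}
    (h : ∀ x y, g (x * y) = ∑ l, p l x * q l y) (a b : B) :
    rightHit g (a * b) = ∑ l, rightHit (p l) a * rightHit (q l) b := by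
  refine hq_ext (hComplete k B) fun n => ?_
  obtain ⟨s, hs⟩ := exists_proj_eq n (comul (k := k) a)
  obtain ⟨t, ht⟩ := exists_proj_eq n (comul (k := k) b)
  rw [rightHit, hq_contract _ (proj_comul_mul hs ht), map_sum]
  simp_rw [map_mul, rightHit, hq_contract _ hs, hq_contract _ ht, ← map_mul, ← map_sum]
  refine congrArg (hq n) ?_
  clear hs ht
  induction s using TensorProduct.induction_on with
  | zero => simp
  | add x y hx hy => simp only [map_add, add_mul, hx, hy, Finset.sum_add_distrib]
  | tmul x y =>
    induction t using TensorProduct.induction_on with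
    | zero => simp
    | add x y hx hy => simp only [map_add, mul_add, hx, hy, Finset.sum_add_distrib]
    | tmul z w =>
      simp only [Algebra.TensorProduct.tmul_mul_tmul, rightSlice_tmul, h, Finset.sum_smul,
        smul_mul_smul_comm]

theorem leftHit_mul {g : B →ₗ[k⟦X⟧] k⟦X⟧} (h : ∀ x y, g (x * y) = g x * g y) (a b : B) :
    leftHit g (a * b) = leftHit g a * leftHit g b := by
  refine hq_ext (hComplete k B) fun n => ?_
  obtain ⟨s, hs⟩ := exists_proj_eq n (comul (k := k) a)
  obtain ⟨t, ht⟩ := exists_proj_eq n (comul (k := k) b)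
  rw [leftHit, hq_contract _ (proj_comul_mul hs ht), map_mul (hq (k := k) (R := B) n),
    hq_contract _ hs, hq_contract _ ht, ← map_mul (hq (k := k) (R := B) n)]
  refine congrArg (hq n) ?_
  clear hs ht
  induction s using TensorProduct.induction_on with
  | zero => simp
  | add x y hx hy => simp only [map_add, add_mul, hx, hy]
  | tmul x y =>
    induction t using TensorProduct.induction_on with
    | zero => simp
    | add x y hx hy => simp only [map_add, mul_add, hx, hy]
    | tmul z w =>
      simp only [Algebra.TensorProduct.tmul_mul_tmul, leftSlice_tmul, h, smul_mul_smul_comm]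

variable (k) in
theorem hComplete_base : HComplete k k⟦X⟧ := HComplete.of_isAdicComplete inferInstance

/-- Both sides are `∑ θ(b') g(b'')`. -/
theorem apply_rightHit (θ g : B →ₗ[k⟦X⟧] k⟦X⟧) (b : B) :
    θ (rightHit g b) = g (leftHit θ b) := by
  refine hq_ext (hComplete_base k) fun n => ?_
  obtain ⟨t, ht⟩ := exists_proj_eq n (comul (k := k) b)
  rw [rightHit, leftHit, hq_map n θ (hq_contract _ ht), hq_map n g (hq_contract _ ht)]
  refine congrArg (hq n) ?_
  clear ht
  induction t using TensorProduct.induction_on with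
  | zero => simp
  | add x y hx hy => simp only [map_add, hx, hy]
  | tmul x y => simp [mul_comm]

/-- Coassociativity: both sides are `∑ f(b'') g(b''') b'`. The form `f ∘ₗ rightHit g` is the
convolution of `f` and `g`, so composing hits amounts to convolving forms. -/
theorem rightHit_rightHit (f g : B →ₗ[k⟦X⟧] k⟦X⟧) (b : B) :
    rightHit f (rightHit g b) = rightHit (f ∘ₗ rightHit g) b := by
  refine hq_ext (hComplete k B) fun n => ?_
  obtain ⟨t, ht⟩ := exists_proj_eq n (comul (k := k) b)
  rw [show hq n (rightHit f (rightHit g b)) = hq n (rightHit f (rightSlice g t)) from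
      hq_map n (rightHit f) (hq_contract _ ht),
    show hq n (rightHit (f ∘ₗ rightHit g) b) = hq n (rightSlice (f ∘ₗ rightHit g) t) from
      hq_contract _ ht]
  -- `Ψ` sends `x ⊗ y ⊗ z` to `f(y) g(z) x`; the two sides of coassociativity become the two sides
  -- of the goal.
  let Ψ : B ⊗[k⟦X⟧] (B ⊗[k⟦X⟧] B) →ₗ[k⟦X⟧] B :=
    (TensorProduct.rid k⟦X⟧ B).toLinearMap ∘ₗ LinearMap.lTensor B (mulPair f g)
  have key := congrArg (LinearMap.baseChange (KTrunc k n) Ψ) ((trunc k B n).coassoc b t ht)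
  refine Eq.trans ?_ (key.trans ?_)
  · clear key ht
    induction t using TensorProduct.induction_on with
    | zero => simp
    | add x y hx hy => simp only [map_add, hx, hy]
    | tmul x y =>
      obtain ⟨s, hs⟩ := exists_proj_eq n (comul (k := k) x)
      have hs' : (trunc k B n).comul x = 1 ⊗ₜ s := hs
      rw [rightSlice_tmul, map_smul, map_smul, rightHit, hq_contract _ hs, LinearMap.comp_apply,
        TensorProduct.map_tmul, LinearMap.mul'_apply, LinearMap.comp_apply,
        AlgHom.toLinearMap_apply, hs']
      clear hs hs'
      induction s using TensorProduct.induction_on with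
      | zero => simp
      | add x y hx hy =>
        simp only [map_add, TensorProduct.tmul_add, smul_add, hx, hy, add_mul]
      | tmul z w =>
        have hΨ : Ψ (z ⊗ₜ[k⟦X⟧] (w ⊗ₜ[k⟦X⟧] y)) = g y • f w • z := by
          simp [Ψ, mul_smul, smul_comm (f w)]
        simp [hΨ, TensorProduct.tmul_smul]
  · clear key ht
    induction t using TensorProduct.induction_on with
    | zero => simp
    | add x y hx hy => simp only [map_add, hx, hy]
    | tmul x y =>
      obtain ⟨s, hs⟩ := exists_proj_eq n (comul (k := k) y)
      have hs' : (trunc k B n).comul y = 1 ⊗ₜ s := hs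
      have h1 : hq (k := k) n ((f ∘ₗ rightHit g) y • x) =
          hq n (f (rightSlice g s) • x) :=
        hq_map n (LinearMap.toSpanSingleton k⟦X⟧ B x) (hq_map n f (hq_contract _ hs))
      rw [rightSlice_tmul, h1, LinearMap.comp_apply,
        TensorProduct.map_tmul, LinearMap.mul'_apply, LinearMap.comp_apply,
        AlgHom.toLinearMap_apply, AlgHom.toLinearMap_apply, hs']
      clear hs hs' h1
      induction s using TensorProduct.induction_on with
      | zero => simp
      | add x y hx hy =>
        simp only [map_add, TensorProduct.tmul_add, add_smul, hx, hy, mul_add]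
      | tmul z w =>
        simp [Ψ, TensorProduct.tmul_smul, mul_comm]

/-- The left side is `G(∑ b' S(b''))`, which the antipode axiom evaluates. -/
theorem sum_apply_rightHit_antipode {ι : Type} [Fintype ι] {G : B →ₗ[k⟦X⟧] k⟦X⟧}
    {p q : ι → B →ₗ[k⟦X⟧] k⟦X⟧} (h : ∀ x y, G (x * y) = ∑ l, p l x * q l y) (b : B) :
    ∑ l, p l (rightHit (q l ∘ₗ antipode (k := k)) b) = counit (k := k) b * G 1 := by
  refine hq_ext (hComplete_base k) fun n => ?_
  obtain ⟨t, ht⟩ := exists_proj_eq n (comul (k := k) b)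
  have key := hq_map n G ((trunc k B n).comul_antipode b t ht)
  simp only [map_sum, rightHit, hq_map n (p _) (hq_contract _ ht)]
  rw [← map_sum]
  refine Eq.trans ?_ (key.trans ?_)
  · refine congrArg (hq n) ?_
    clear ht key
    induction t using TensorProduct.induction_on with
    | zero => simp
    | add x y hx hy => simp only [map_add, hx, hy, Finset.sum_add_distrib]
    | tmul x y => simp [h, trunc, mul_comm]
  · refine congrArg (hq n) ?_
    rw [Algebra.algebraMap_eq_smul_one, map_smul]
    rfl

/-- The left side is `G(∑ S(b') b'')`, which the other antipode axiom evaluates. -/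
theorem sum_apply_antipode_rightHit {ι : Type} [Fintype ι] {G : B →ₗ[k⟦X⟧] k⟦X⟧}
    {p q : ι → B →ₗ[k⟦X⟧] k⟦X⟧} (h : ∀ x y, G (x * y) = ∑ l, p l x * q l y) (b : B) :
    ∑ l, p l (antipode (k := k) (rightHit (q l) b)) = counit (k := k) b * G 1 := by
  refine hq_ext (hComplete_base k) fun n => ?_
  obtain ⟨t, ht⟩ := exists_proj_eq n (comul (k := k) b)
  have key := hq_map n G ((trunc k B n).antipode_comul b t ht)
  simp only [map_sum, rightHit,
    hq_map n (p _) (hq_map n (antipode (k := k)) (hq_contract _ ht))]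
  rw [← map_sum]
  refine Eq.trans ?_ (key.trans ?_)
  · refine congrArg (hq n) ?_
    clear ht key
    induction t using TensorProduct.induction_on with
    | zero => simp
    | add x y hx hy => simp only [map_add, hx, hy, Finset.sum_add_distrib]
    | tmul x y => simp [h, trunc, mul_comm]
  · refine congrArg (hq n) ?_
    rw [Algebra.algebraMap_eq_smul_one, map_smul]
    rfl

end TopologicalHopfAlgebra

/-! ### Twisting by matrix coefficients -/

/-- Right `B`-modules `W` give right modules `W^ι` through a matrix representation of `B`
over itself. -/
def Twisted {B : Type u} [Ring B] {ι : Type} [Fintype ι] [DecidableEq ι]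
    (_ : B →+* Matrix ι ι B) (W : Type u) : Type u := ι → W

namespace Twisted

variable {B : Type u} [Ring B] {ι : Type} [Fintype ι] [DecidableEq ι] (σ : B →+* Matrix ι ι B)
variable {W W' W'' H : Type u} [AddCommGroup W] [Module Bᵐᵒᵖ W] [AddCommGroup W'] [Module Bᵐᵒᵖ W']
  [AddCommGroup W''] [Module Bᵐᵒᵖ W''] [AddCommGroup H] [Module Bᵐᵒᵖ H]

instance : AddCommGroup (Twisted σ W) := inferInstanceAs (AddCommGroup (ι → W))

instance : Module Bᵐᵒᵖ (Twisted σ W) where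
  smul u w := fun j => ∑ i, op (σ u.unop i j) • (w i : W)
  one_smul w := funext fun j => by
    change ∑ i, op (σ 1 i j) • (w i : W) = w j
    rw [map_one, Finset.sum_eq_single j]
    · rw [Matrix.one_apply_eq, op_one, one_smul]
    · intro i _ hi
      rw [Matrix.one_apply_ne hi, op_zero, zero_smul]
    · intro h
      exact absurd (Finset.mem_univ j) h
  mul_smul a b w := funext fun j => by
    change ∑ i, op (σ (b.unop * a.unop) i j) • (w i : W) =
      ∑ l, op (σ a.unop l j) • ∑ i, op (σ b.unop i l) • (w i : W)
    simp_rw [map_mul, Matrix.mul_apply, Finset.op_sum, Finset.sum_smul, Finset.smul_sum, op_mul,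
      mul_smul]
    exact Finset.sum_comm
  smul_zero a := funext fun j => by
    change ∑ i, op (σ a.unop i j) • (0 : W) = 0
    simp
  smul_add a w w' := funext fun j => by
    change ∑ i, op (σ a.unop i j) • ((w i : W) + w' i) =
      ∑ i, op (σ a.unop i j) • (w i : W) + ∑ i, op (σ a.unop i j) • (w' i : W)
    simp [Finset.sum_add_distrib]
  add_smul a b w := funext fun j => by
    change ∑ i, op (σ (a.unop + b.unop) i j) • (w i : W) =
      ∑ i, op (σ a.unop i j) • (w i : W) + ∑ i, op (σ b.unop i j) • (w i : W)
    simp [Finset.sum_add_distrib, add_smul]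
  zero_smul w := funext fun j => by
    change ∑ i, op (σ 0 i j) • (w i : W) = 0
    simp

/-- Functoriality of the twist. -/
def map (f : W →ₗ[Bᵐᵒᵖ] W') : Twisted σ W →ₗ[Bᵐᵒᵖ] Twisted σ W' where
  toFun w := fun i => f (w i)
  map_add' w w' := funext fun i => map_add f (w i) (w' i)
  map_smul' u w := funext fun j => by
    change f (∑ i, op (σ u.unop i j) • (w i : W)) = ∑ i, op (σ u.unop i j) • f (w i)
    simp

variable {σ}

/-- The twist changes only the action: kernels and images are those of `ι` copies, taken component
by component. -/
theorem isCohomology_map {f : W →ₗ[Bᵐᵒᵖ] W'} {g : W' →ₗ[Bᵐᵒᵖ] W''} (h : IsCohomology f g H) :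
    IsCohomology (map σ f) (map σ g) (Twisted σ H) := by
  obtain ⟨p, hp, hp0⟩ := h
  have hker : ∀ (z : LinearMap.ker (map σ g)) (i : ι), g (z.1 i) = 0 := fun z i => congrFun z.2 i
  refine ⟨{ toFun := fun z i => p ⟨z.1 i, hker z i⟩, map_add' := ?_, map_smul' := ?_ }, ?_, ?_⟩
  · intro z z'
    exact funext fun i => map_add p ⟨z.1 i, hker z i⟩ ⟨z'.1 i, hker z' i⟩
  · intro u z
    refine funext fun j => ?_
    change p _ = ∑ i, op (σ u.unop i j) • p _
    simp_rw [← map_smul, ← map_sum]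
    refine congrArg p (Subtype.ext ?_)
    rw [AddSubmonoidClass.coe_finsetSum]
    rfl
  · intro w
    choose z hz using fun i => hp (w i)
    exact ⟨⟨fun i => (z i).1, funext fun i => (z i).2⟩, funext hz⟩
  · intro z
    constructor
    · intro h
      choose x hx using fun i => (hp0 _).1 (congrFun h i)
      exact ⟨x, funext hx⟩
    · rintro ⟨x, hx⟩
      exact funext fun i => (hp0 _).2 ⟨x i, congrFun hx i⟩

end Twisted

/-- The matrices of operators on `B` attached to a representation, its dual, and its double dual
by means of a coproduct and an antipode. -/
structure TwistData (B : Type u) [Ring B] (ι : Type) [Fintype ι] [DecidableEq ι] where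
  σ : B →+* Matrix ι ι B
  τ : B →+* Matrix ι ι B
  π : ι → ι → B →+ B
  -- The relations between `σ` and `τ` make `colTwist` invertible, and those between `π` and `τ` do
  -- the same for `rowTwist`.
  sum_σ_τ : ∀ i j b, ∑ l, σ (τ b l i) l j = if i = j then b else 0
  sum_τ_σ : ∀ i j b, ∑ l, τ (σ b i l) j l = if i = j then b else 0
  sum_π_τ : ∀ i l b, ∑ j, π i j (τ b l j) = if i = l then b else 0
  sum_τ_π : ∀ i l b, ∑ j, τ (π j l b) j i = if i = l then b else 0

namespace TwistData

variable {B : Type u} [Ring B] {ι : Type} [Fintype ι] [DecidableEq ι] (D : TwistData B ι)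

/-- Application of `τ` to the entries of a matrix. -/
def expand {m n : Type} (M : Matrix m n B) : Matrix (m × ι) (n × ι) B :=
  fun a b => D.τ (M a.1 b.1) a.2 b.2

/-- The untwisting of row vectors. -/
def rowTwist {m : Type} (x : ι → m → B) : m × ι → B := fun a => ∑ j, D.τ (x j a.1) j a.2

theorem rowTwist_bijective (m : Type) : Function.Bijective (D.rowTwist (m := m)) := by
  refine Function.bijective_iff_has_inverse.2
    ⟨fun y j a => ∑ l, D.π j l (y (a, l)), fun x => ?_, fun y => ?_⟩
  · funext i a
    simp_rw [rowTwist, map_sum]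
    rw [Finset.sum_comm]
    simp_rw [D.sum_π_τ]
    simp
  · funext ⟨a, i⟩
    simp_rw [rowTwist, map_sum, Matrix.sum_apply]
    rw [Finset.sum_comm]
    simp_rw [D.sum_τ_π]
    simp

/-- Multiplicativity of `τ` gives this. The complex of rows with matrices `expand M` is thus
additively a sum of `ι` copies of the original one; exactness needs no more than this additive
comparison. -/
theorem vecMul_expand {m n : Type} [Fintype m] (M : Matrix m n B) (x : ι → m → B) :
    Matrix.vecMul (D.rowTwist x) (D.expand M) = D.rowTwist fun j => Matrix.vecMul (x j) M := by
  funext ⟨b, i⟩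
  simp only [Matrix.vecMul, dotProduct, rowTwist, expand, map_sum, Matrix.sum_apply, map_mul,
    Matrix.mul_apply, Fintype.sum_prod_type, Finset.sum_mul]
  refine Eq.trans ?_ Finset.sum_comm
  exact Finset.sum_congr rfl fun a _ => Finset.sum_comm

/-- The twisted dual of the complex of column vectors. -/
def colTwist (m : Type) : (m × ι → B) ≃ₗ[Bᵐᵒᵖ] Twisted D.σ (m → B) :=
  LinearEquiv.ofBijective
    { toFun := fun x j a => ∑ i, D.σ (x (a, i)) i j
      map_add' := fun x y => by
        funext j a
        change ∑ i, D.σ (x (a, i) + y (a, i)) i j =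
          ∑ i, D.σ (x (a, i)) i j + ∑ i, D.σ (y (a, i)) i j
        simp [Finset.sum_add_distrib]
      map_smul' := fun u x => by
        funext j a
        change ∑ i, D.σ (x (a, i) * u.unop) i j =
          (∑ l, op (D.σ u.unop l j) • fun a => ∑ i, D.σ (x (a, i)) i l) a
        simp only [map_mul, Matrix.mul_apply, Finset.sum_apply, Pi.smul_apply, op_smul_eq_mul,
          Finset.sum_mul]
        exact Finset.sum_comm }
    (by
      refine Function.bijective_iff_has_inverse.2
        ⟨fun y a => ∑ l, D.τ (y l a.1) a.2 l, fun x => ?_, fun y => ?_⟩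
      · funext ⟨a, j⟩
        change ∑ l, D.τ (∑ i, D.σ (x (a, i)) i l) j l = x (a, j)
        simp_rw [map_sum, Matrix.sum_apply]
        rw [Finset.sum_comm]
        simp_rw [D.sum_τ_σ]
        simp
      · funext j a
        change ∑ i, D.σ (∑ l, D.τ ((y l : m → B) a) i l) i j = (y j : m → B) a
        simp_rw [map_sum, Matrix.sum_apply]
        rw [Finset.sum_comm]
        simp_rw [D.sum_σ_τ]
        simp)

/-- After expanding by multiplicativity of `σ`, the contraction of `σ` against `τ` returns the
entries of `M` itself. -/
theorem colTwist_colMap {m n : Type} [Fintype n] (M : Matrix m n B) (x : n × ι → B) :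
    D.colTwist m (colMap (D.expand M) x) = Twisted.map D.σ (colMap M) (D.colTwist n x) := by
  funext j a
  change ∑ i, D.σ (Matrix.mulVec (D.expand M) x (a, i)) i j =
    Matrix.mulVec M (fun b => ∑ i, D.σ (x (b, i)) i j) a
  simp only [Matrix.mulVec, dotProduct, expand, map_sum, Matrix.sum_apply, map_mul,
    Matrix.mul_apply, Fintype.sum_prod_type]
  rw [Finset.sum_comm]
  refine Finset.sum_congr rfl fun b _ => ?_
  rw [Finset.sum_comm, Finset.mul_sum]
  refine Finset.sum_congr rfl fun l _ => ?_
  rw [Finset.sum_comm]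
  simp_rw [← Finset.sum_mul, D.sum_σ_τ, ite_mul, zero_mul]
  simp

/-- The twisted resolution: a resolution of `K` gives a resolution of a module `V` with a basis
on which `B` acts suitably. -/
def resolution {X V : Type u} [AddCommGroup X] [Module B X] [AddCommGroup V] [Module B V]
    (F : FreeResolution B X) (e : (ι → X) ≃+ V) (aug : (F.κ 1 × ι → B) →ₗ[B] V)
    (haug : ∀ x : ι → F.κ 1 → B, aug (D.rowTwist x) = e fun j => F.aug (x j)) :
    FreeResolution B V where
  κ i := F.κ i × ι
  fintype i := inferInstance
  isEmpty := inferInstance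
  mat i := D.expand (F.mat i)
  aug := aug
  aug_surjective v := by
    choose x hx using fun j => F.aug_surjective (e.symm v j)
    exact ⟨D.rowTwist x, by rw [haug, funext hx, e.apply_symm_apply]⟩
  aug_eq_zero_iff y := by
    obtain ⟨x, rfl⟩ := (D.rowTwist_bijective _).2 y
    rw [haug, e.map_eq_zero_iff]
    constructor
    · intro h
      choose z hz using fun j => (F.aug_eq_zero_iff (x j)).1 (congrFun h j)
      exact ⟨D.rowTwist z, by rw [D.vecMul_expand, funext hz]⟩
    · rintro ⟨z, hz⟩
      obtain ⟨z, rfl⟩ := (D.rowTwist_bijective _).2 z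
      rw [D.vecMul_expand] at hz
      have := (D.rowTwist_bijective _).1 hz
      exact funext fun j => (F.aug_eq_zero_iff (x j)).2 ⟨z j, congrFun this j⟩
  exact i y := by
    obtain ⟨x, rfl⟩ := (D.rowTwist_bijective _).2 y
    have h0 : D.rowTwist (m := F.κ (i + 1)) 0 = 0 := by
      funext a
      simp [rowTwist]
    rw [D.vecMul_expand, ← h0, (D.rowTwist_bijective _).1.eq_iff]
    constructor
    · intro h
      choose z hz using fun j => (F.exact i (x j)).1 (congrFun h j)
      exact ⟨D.rowTwist z, by rw [D.vecMul_expand, funext hz]⟩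
    · rintro ⟨z, hz⟩
      obtain ⟨z, rfl⟩ := (D.rowTwist_bijective _).2 z
      rw [D.vecMul_expand] at hz
      have := (D.rowTwist_bijective _).1 hz
      exact funext fun j => (F.exact i (x j)).2 ⟨z j, congrFun this j⟩

end TwistData

/-- Base change of a finite free resolution along a flat morphism. -/
def FreeResolution.induced {R S : Type u} [Ring R] [Ring S] {φ : R →+* S} (flat : IsRightFlat φ)
    {M : Type u} [AddCommGroup M] [Module R M] (F : FreeResolution R M) :
    FreeResolution S (InducedModule φ M) where
  κ := F.κ
  fintype := F.fintype
  isEmpty := F.isEmpty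
  mat i := (F.mat i).map φ
  aug := InducedModule.map φ F.aug ∘ₗ (InducedModule.rowEquiv φ (F.κ 1)).symm.toLinearMap
  aug_surjective := (InducedModule.map_surjective _ F.aug_surjective).comp
    (InducedModule.rowEquiv φ (F.κ 1)).symm.surjective
  aug_eq_zero_iff y := by
    obtain ⟨x, rfl⟩ := (InducedModule.rowEquiv φ (F.κ 1)).surjective y
    have h := InducedModule.map_exact_of_flat flat (rowMap (F.mat 1)) F.aug F.aug_eq_zero_iff x
    rw [LinearMap.comp_apply, LinearEquiv.coe_coe, LinearEquiv.symm_apply_apply, h]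
    constructor
    · rintro ⟨z, rfl⟩
      exact ⟨_, (InducedModule.rowEquiv_map φ _ z).symm⟩
    · rintro ⟨z, hz⟩
      obtain ⟨z, rfl⟩ := (InducedModule.rowEquiv φ (F.κ 2)).surjective z
      exact ⟨z, (InducedModule.rowEquiv φ (F.κ 1)).injective
        ((InducedModule.rowEquiv_map φ _ z).trans hz)⟩
  exact i y := by
    obtain ⟨x, rfl⟩ := (InducedModule.rowEquiv φ (F.κ (i + 2))).surjective y
    have h := InducedModule.map_exact_of_flat flat (rowMap (F.mat (i + 2)))
      (rowMap (F.mat (i + 1))) (F.exact i) x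
    rw [← rowMap_apply, ← InducedModule.rowEquiv_map, LinearEquiv.map_eq_zero_iff, h]
    constructor
    · rintro ⟨z, rfl⟩
      exact ⟨_, (InducedModule.rowEquiv_map φ _ z).symm⟩
    · rintro ⟨z, hz⟩
      obtain ⟨z, rfl⟩ := (InducedModule.rowEquiv φ (F.κ (i + 3))).surjective z
      exact ⟨z, (InducedModule.rowEquiv φ (F.κ (i + 2))).injective
        ((InducedModule.rowEquiv_map φ _ z).trans hz)⟩

/-- `Ext^i_A(A ⊗_B V, A)` is `W ⊗_B A` for the twist `W` of `Ext^i_B(K, B)`. -/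
theorem TwistData.nonempty_extDual_equiv {B A : Type u} [Ring B] [Ring A] {ι : Type} [Fintype ι]
    [DecidableEq ι] (D : TwistData B ι) {φ : B →+* A} (flat : IsRightFlat φ)
    (flat' : IsRightFlat (RingHom.op φ)) {X : ModuleCat.{u} B} {V : Type u} [AddCommGroup V]
    [Module B V] (F : FreeResolution B X) (e : (ι → X) ≃+ V) (aug : (F.κ 1 × ι → B) →ₗ[B] V)
    (haug : ∀ x : ι → F.κ 1 → B, aug (D.rowTwist x) = e fun j => F.aug (x j)) (i : ℕ) :
    Nonempty (ExtDual (ModuleCat.of A (InducedModule φ V)) i ≃ₗ[Aᵐᵒᵖ]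
      InducedModule (RingHom.op φ) (Twisted D.σ (ExtDual X i))) := by
  have h1 := Twisted.isCohomology_map (σ := D.σ) (F.isCohomology_extDual i)
  have h2 : IsCohomology (colMap (D.expand (F.mat i))) (colMap (D.expand (F.mat (i + 1))))
      (Twisted D.σ (ExtDual X i)) := by
    refine h1.congr_left (D.colTwist _).symm (D.colTwist _).symm (D.colTwist _).symm ?_ ?_
    all_goals
      intro y
      rw [LinearEquiv.symm_apply_eq, D.colTwist_colMap, LinearEquiv.apply_symm_apply]
  have h0 : ∀ x, colMap (D.expand (F.mat (i + 1))) (colMap (D.expand (F.mat i)) x) = 0 := by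
    intro x
    apply (D.colTwist _).injective
    rw [D.colTwist_colMap, D.colTwist_colMap, map_zero]
    exact funext fun j => F.colMap_colMap i _
  -- `flat'` takes cohomology through `- ⊗_B A` on right modules, whereas `flat` serves to resolve
  -- `A ⊗_B V`.
  have h3 := InducedModule.isCohomology_map flat' h0 h2
  have h4 := h3.congr_left (InducedModule.colEquiv φ _) (InducedModule.colEquiv φ _)
    (InducedModule.colEquiv φ _) (InducedModule.colEquiv_map φ _) (InducedModule.colEquiv_map φ _)
  exact (((D.resolution F e aug haug).induced flat).isCohomology_extDual
    (M := ModuleCat.of A (InducedModule φ V)) i).nonempty_linearEquiv h4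

/-! ### Lifting resolutions and cohomology along a reduction modulo `h` -/

/-- Successive approximation: iterating `y = f x + h y'` gives `y = ∑ h ^ i f(x_i) + h ^ n y_n`, and
`∑ h ^ i x_i` is a preimage. The predicate `P` records what the remainders must keep satisfying,
such as being a cocycle. -/
theorem HComplete.exists_of_approx {k : Type u} [Field k] {M N : Type u} [AddCommGroup M]
    [Module k⟦X⟧ M] [AddCommGroup N] [Module k⟦X⟧ N] (hM : HComplete k M) (hN : HComplete k N)
    (f : M →+ N) (hf : ∀ (c : k⟦X⟧) x, f (c • x) = c • f x) (P : N → Prop)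
    (h : ∀ y, P y → ∃ x y', P y' ∧ y = f x + (PowerSeries.X : k⟦X⟧) • y') (y : N) (hy : P y) :
    ∃ x, f x = y := by
  choose! x y' hy' hxy using h
  let s : ℕ → N := fun n => Nat.rec y (fun _ z => y' z) n
  have hs : ∀ n, P (s n) := fun n => by
    induction n with
    | zero => exact hy
    | succ n ih => exact hy' _ ih
  have hsum : ∀ n, y = ∑ i ∈ Finset.range n, (PowerSeries.X : k⟦X⟧) ^ i • f (x (s i)) +
      (PowerSeries.X : k⟦X⟧) ^ n • s n := fun n => by
    induction n with
    | zero => simp [s]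
    | succ n ih =>
      rw [Finset.sum_range_succ, add_assoc, pow_succ, mul_smul, ← smul_add]
      rw [show s (n + 1) = y' (s n) from rfl, ← hxy (s n) (hs n)]
      exact ih
  obtain ⟨t, ht⟩ := hM.sum fun i => x (s i)
  refine ⟨t, (sub_eq_zero.1 (hN.sep _ fun n => ?_))⟩
  obtain ⟨z, hz⟩ := ht n
  refine ⟨f z - s n, ?_⟩
  rw [smul_sub, ← hf, ← hz, map_sub, map_sum]
  simp_rw [hf]
  conv_lhs => rw [hsum n]
  abel

/-- A complete `h`-torsion free algebra `B` with its reduction `B₀ = B / h B`. -/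
structure FlatReduction (k : Type u) [Field k] (B₀ B : Type u) [Ring B₀] [Algebra k B₀]
    [Ring B] [Algebra k⟦X⟧ B] where
  red : B →+* B₀
  surjective : Function.Surjective red
  eq_zero_iff : ∀ a : B, red a = 0 ↔ ∃ b : B, a = (PowerSeries.X : k⟦X⟧) • b
  red_smul : ∀ (f : k⟦X⟧) (a : B), red (f • a) = PowerSeries.constantCoeff f • red a
  torsionFree : ∀ a : B, (PowerSeries.X : k⟦X⟧) • a = 0 → a = 0
  complete : HComplete k B

/-- The reduction of a Hopf deformation. -/
def HopfDeformation.toFlatReduction {k : Type u} [Field k] {B₀ B : Type u} [Ring B₀]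
    [HopfAlgebra k B₀] [Ring B] [Algebra k⟦X⟧ B] [TopologicalHopfAlgebra k B]
    (D : HopfDeformation k B₀ B) : FlatReduction k B₀ B where
  red := D.red
  surjective := D.red_surjective
  eq_zero_iff := D.red_eq_zero_iff
  red_smul := D.red_smul
  torsionFree a ha := by
    have h : (PowerSeries.X : B₀⟦X⟧) * D.equiv a = 0 := by
      rw [← PowerSeries.map_X (algebraMap k B₀), ← D.equiv_smul, ha, map_zero]
    rw [← D.equiv.map_eq_zero_iff]
    ext n
    rw [← PowerSeries.coeff_succ_X_mul, h, map_zero, map_zero]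
  complete := TopologicalHopfAlgebra.hComplete k B

namespace FlatReduction

variable {k : Type u} [Field k] {B₀ B : Type u} [Ring B₀] [Algebra k B₀]
    [Ring B] [Algebra k⟦X⟧ B]

section Vectors

variable (D : FlatReduction k B₀ B)

variable {m n : Type}

theorem comp_eq_zero_iff (x : m → B) :
    D.red ∘ x = 0 ↔ ∃ y : m → B, x = (PowerSeries.X : k⟦X⟧) • y := by
  constructor
  · intro h
    choose y hy using fun a => (D.eq_zero_iff (x a)).1 (congrFun h a)
    exact ⟨y, funext hy⟩
  · rintro ⟨y, rfl⟩
    exact funext fun a => (D.eq_zero_iff _).2 ⟨y a, rfl⟩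

theorem comp_eq_iff (x x' : m → B) :
    D.red ∘ x = D.red ∘ x' ↔ ∃ y : m → B, x = x' + (PowerSeries.X : k⟦X⟧) • y := by
  rw [← sub_eq_zero]
  have : D.red ∘ x - D.red ∘ x' = D.red ∘ (x - x') := funext fun a => (map_sub D.red _ _).symm
  rw [this, D.comp_eq_zero_iff]
  simp_rw [sub_eq_iff_eq_add']

theorem exists_comp_eq (y : m → B₀) : ∃ x : m → B, D.red ∘ x = y := by
  choose x hx using fun a => D.surjective (y a)
  exact ⟨x, funext hx⟩

theorem comp_vecMul [Fintype m] (M : Matrix m n B) (x : m → B) :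
    D.red ∘ Matrix.vecMul x M = Matrix.vecMul (D.red ∘ x) (M.map D.red) := by
  funext b
  simp [Matrix.vecMul, dotProduct]

theorem comp_mulVec [Fintype n] (M : Matrix m n B) (x : n → B) :
    D.red ∘ Matrix.mulVec M x = Matrix.mulVec (M.map D.red) (D.red ∘ x) := by
  funext b
  simp [Matrix.mulVec, dotProduct]

theorem eq_zero_of_X_smul (D : FlatReduction k B₀ B) {x : m → B} (h : (PowerSeries.X : k⟦X⟧) • x = 0) : x = 0 :=
  funext fun a => D.torsionFree _ (congrFun h a)

theorem eq_of_X_smul (D : FlatReduction k B₀ B) {x y : m → B}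
    (h : (PowerSeries.X : k⟦X⟧) • x = (PowerSeries.X : k⟦X⟧) • y) : x = y :=
  sub_eq_zero.1 (D.eq_zero_of_X_smul (by rw [smul_sub, h, sub_self]))

end Vectors

/-- A saturated submodule of a finite free module is finitely generated. -/
theorem exists_generators (D : FlatReduction k B₀ B) [IsNoetherianRing B₀] {m : ℕ} (N : Submodule B (Fin m → B))
    (hN : ∀ x, (PowerSeries.X : k⟦X⟧) • x ∈ N → x ∈ N) :
    ∃ (n : ℕ) (M : Matrix (Fin n) (Fin m) B), ∀ x, x ∈ N ↔ ∃ y, Matrix.vecMul y M = x := by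
  -- Noetherianity is applied to the image `N₀` of `N` modulo `h`; lifts to `N` of generators of
  -- `N₀` generate `N` by successive approximation.
  let N₀ : Submodule B₀ (Fin m → B₀) :=
    { carrier := {y | ∃ x ∈ N, D.red ∘ x = y}
      add_mem' := by
        rintro _ _ ⟨x, hx, rfl⟩ ⟨y, hy, rfl⟩
        exact ⟨x + y, N.add_mem hx hy, funext fun a => map_add D.red _ _⟩
      zero_mem' := ⟨0, N.zero_mem, funext fun a => map_zero D.red⟩
      smul_mem' := by
        rintro c _ ⟨x, hx, rfl⟩
        obtain ⟨c, rfl⟩ := D.surjective c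
        exact ⟨c • x, N.smul_mem c hx, funext fun a => map_mul D.red _ _⟩ }
  obtain ⟨n, s, hs⟩ := Submodule.fg_iff_exists_fin_generating_family.1 (IsNoetherian.noetherian N₀)
  have hs' : ∀ i, s i ∈ N₀ := fun i => hs ▸ Submodule.subset_span ⟨i, rfl⟩
  choose M hMN hMs using hs'
  have hM : ∀ y, Matrix.vecMul y (Matrix.of M) ∈ N := fun y => by
    rw [Matrix.vecMul_eq_sum]
    exact N.sum_mem fun i _ => N.smul_mem _ (hMN i)
  refine ⟨n, Matrix.of M, fun x => ⟨fun hx => ?_, ?_⟩⟩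
  · refine HComplete.exists_of_approx (k := k) D.complete.pi D.complete.pi
      (rowMap (Matrix.of M)).toAddMonoidHom (fun c x => Matrix.smul_vecMul c x _) (· ∈ N)
      (fun x hx => ?_) x hx
    have h1 : D.red ∘ x ∈ Submodule.span B₀ (Set.range s) := hs ▸ ⟨x, hx, rfl⟩
    obtain ⟨c₀, hc₀⟩ := (Submodule.mem_span_range_iff_exists_fun B₀).1 h1
    obtain ⟨c, rfl⟩ := D.exists_comp_eq c₀
    have h2 : D.red ∘ x = D.red ∘ Matrix.vecMul c (Matrix.of M) := by
      rw [← hc₀, D.comp_vecMul, Matrix.vecMul_eq_sum]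
      refine Finset.sum_congr rfl fun i _ => ?_
      rw [← hMs i]
      rfl
    obtain ⟨y, hy⟩ := (D.comp_eq_iff _ _).1 h2
    -- Saturation keeps the remainder in `N`: both `x` and the combination of generators lie in `N`,
    -- hence so does `h y`.
    refine ⟨c, y, hN y ?_, hy⟩
    rw [← sub_eq_iff_eq_add'] at hy
    rw [← hy]
    exact N.sub_mem hx (hM c)
  · rintro ⟨y, rfl⟩
    exact hM y

/-- A saturated submodule of some `B ^ m`. -/
structure SaturatedSubmodule (k : Type u) [Field k] (B : Type u) [Ring B] [Algebra k⟦X⟧ B] where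
  m : ℕ
  N : Submodule B (Fin m → B)
  sat : ∀ x, (PowerSeries.X : k⟦X⟧) • x ∈ N → x ∈ N

variable (D : FlatReduction k B₀ B) [IsNoetherianRing B₀]

/-- The number of chosen generators. -/
def rank (N : SaturatedSubmodule k B) : ℕ := (D.exists_generators N.N N.sat).choose

/-- The matrix of chosen generators. -/
def gens (N : SaturatedSubmodule k B) : Matrix (Fin (D.rank N)) (Fin N.m) B :=
  (D.exists_generators N.N N.sat).choose_spec.choose

theorem gens_spec (N : SaturatedSubmodule k B) (x : Fin N.m → B) :
    x ∈ N.N ↔ ∃ y, Matrix.vecMul y (D.gens N) = x :=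
  (D.exists_generators N.N N.sat).choose_spec.choose_spec x

/-- The relations between the chosen generators. -/
def syzygy (N : SaturatedSubmodule k B) : SaturatedSubmodule k B where
  m := D.rank N
  N := LinearMap.ker (rowMap (D.gens N))
  -- Torsion-freeness of `B` makes the kernel saturated, so that the construction can be iterated.
  sat x hx := by
    rw [LinearMap.mem_ker, rowMap_apply] at hx ⊢
    rw [Matrix.smul_vecMul] at hx
    exact D.eq_zero_of_X_smul hx

/-- The iterated syzygies. -/
def syzygies (N : SaturatedSubmodule k B) : ℕ → SaturatedSubmodule k B
  | 0 => N
  | i + 1 => D.syzygy (syzygies N i)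

/-- A resolution of `B ^ m / N` by finite free modules, for a saturated submodule `N`. -/
def resolution (N : SaturatedSubmodule k B) {X : Type u} [AddCommGroup X] [Module B X]
    (aug : (Fin N.m → B) →ₗ[B] X) (haug : Function.Surjective aug)
    (hN : ∀ x, aug x = 0 ↔ x ∈ N.N) : FreeResolution B X where
  κ i := match i with
    | 0 => Fin 0
    | i + 1 => Fin (D.syzygies N i).m
  fintype i := match i with
    | 0 => inferInstanceAs (Fintype (Fin 0))
    | i + 1 => inferInstanceAs (Fintype (Fin (D.syzygies N i).m))
  isEmpty := inferInstanceAs (IsEmpty (Fin 0))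
  mat i := match i with
    | 0 => fun _ b => b.elim0
    | i + 1 => D.gens (D.syzygies N i)
  aug := aug
  aug_surjective := haug
  aug_eq_zero_iff x := (hN x).trans (D.gens_spec N x)
  exact i x := D.gens_spec (D.syzygies N (i + 1)) x

end FlatReduction

/-! ### The cohomology of a deformation -/

theorem HComplete.prod {k : Type u} [Field k] {M N : Type u} [AddCommGroup M]
    [Module k⟦X⟧ M] [AddCommGroup N] [Module k⟦X⟧ N] (hM : HComplete k M) (hN : HComplete k N) :
    HComplete k (M × N) where
  sep x hx := Prod.ext
    (hM.sep _ fun n => (hx n).imp' Prod.fst fun _ h => congrArg Prod.fst h)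
    (hN.sep _ fun n => (hx n).imp' Prod.snd fun _ h => congrArg Prod.snd h)
  sum y := by
    obtain ⟨s, hs⟩ := hM.sum fun i => (y i).1
    obtain ⟨t, ht⟩ := hN.sum fun i => (y i).2
    choose z hz using hs
    choose z' hz' using ht
    refine ⟨(s, t), fun n => ⟨(z n, z' n), Prod.ext ?_ ?_⟩⟩
    · rw [Prod.smul_fst, ← hz n]
      simp [Prod.fst_sum]
    · rw [Prod.smul_snd, ← hz' n]
      simp [Prod.snd_sum]

/-- `Ext^i_R(M, R)` is free of rank one over the base ring exactly when the cocycles are, modulo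
coboundaries. -/
theorem FreeResolution.nonempty_extDual_equiv_iff {K R : Type u} [CommRing K] [Ring R]
    [Algebra K R] {M : ModuleCat.{u} R} (F : FreeResolution R M) (i : ℕ) :
    Nonempty (ExtDual M i ≃ₗ[K] K) ↔ ∃ w : F.κ (i + 1) → R,
      Matrix.mulVec (F.mat (i + 1)) w = 0 ∧
      (∀ y, Matrix.mulVec (F.mat (i + 1)) y = 0 →
        ∃ (c : K) (x : F.κ i → R), y = c • w + Matrix.mulVec (F.mat i) x) ∧
      ∀ (c : K) (x : F.κ i → R), c • w = Matrix.mulVec (F.mat i) x → c = 0 := by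
  obtain ⟨p, hp, hp0⟩ := F.isCohomology_extDual i
  have hsmul : ∀ (c : K) (z : LinearMap.ker (colMap (F.mat (i + 1)))),
      (algebraMap K Rᵐᵒᵖ c • z).1 = c • z.1 := fun c z => funext fun a => by
    change z.1 a * algebraMap K R c = c • z.1 a
    rw [← Algebra.commutes, Algebra.smul_def]
  have hp' : ∀ (c : K) (z : LinearMap.ker (colMap (F.mat (i + 1)))),
      c • p z = p (algebraMap K Rᵐᵒᵖ c • z) := fun c z => (map_smul p _ z).symm
  constructor
  · rintro ⟨e⟩
    obtain ⟨w, hw⟩ := hp (e.symm 1)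
    refine ⟨w.1, w.2, fun y hy => ?_, fun c x hx => ?_⟩
    · let y' : LinearMap.ker (colMap (F.mat (i + 1))) := ⟨y, hy⟩
      have h : p (y' - algebraMap K Rᵐᵒᵖ (e (p y')) • w) = 0 := by
        rw [map_sub, ← hp', hw, ← map_smul, smul_eq_mul, mul_one, e.symm_apply_apply, sub_self]
      obtain ⟨x, hx⟩ := (hp0 _).1 h
      refine ⟨e (p y'), x, ?_⟩
      rw [← hsmul]
      exact (sub_eq_iff_eq_add'.1 hx.symm)
    · have h : p (algebraMap K Rᵐᵒᵖ c • w) = 0 := (hp0 _).2 ⟨x, hx.symm.trans (hsmul c w).symm⟩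
      rw [← hp', hw, ← map_smul, smul_eq_mul, mul_one] at h
      exact (e.symm.map_eq_zero_iff).1 h
  · rintro ⟨w, hw, h1, h2⟩
    let w' : LinearMap.ker (colMap (F.mat (i + 1))) := ⟨w, hw⟩
    refine ⟨(LinearEquiv.ofBijective (LinearMap.toSpanSingleton K (ExtDual M i) (p w'))
      ⟨?_, fun y => ?_⟩).symm⟩
    · rw [← LinearMap.ker_eq_bot, LinearMap.ker_eq_bot']
      intro c hc
      rw [LinearMap.toSpanSingleton_apply, hp'] at hc
      obtain ⟨x, hx⟩ := (hp0 _).1 hc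
      exact h2 c x ((hsmul c w').symm.trans hx.symm)
    · obtain ⟨y, rfl⟩ := hp y
      obtain ⟨c, x, hx⟩ := h1 y.1 y.2
      refine ⟨c, ?_⟩
      rw [LinearMap.toSpanSingleton_apply, hp', ← sub_eq_zero, ← map_sub, hp0]
      refine ⟨-x, ?_⟩
      rw [map_neg]
      refine (neg_eq_iff_eq_neg.2 ?_)
      refine (sub_eq_iff_eq_add'.2 (hx.trans ?_)).symm.trans (neg_sub _ _).symm
      exact congrArg (· + _) (hsmul c w').symm

theorem FreeResolution.subsingleton_extDual_iff {R : Type u} [Ring R] {M : ModuleCat.{u} R}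
    (F : FreeResolution R M) (i : ℕ) :
    Subsingleton (ExtDual M i) ↔ ∀ y, Matrix.mulVec (F.mat (i + 1)) y = 0 →
      ∃ x, Matrix.mulVec (F.mat i) x = y :=
  (F.isCohomology_extDual i).subsingleton_iff

theorem FreeResolution.mulVec_mulVec {R : Type u} [Ring R] {M : ModuleCat.{u} R}
    (F : FreeResolution R M) (i : ℕ) (y : F.κ i → R) :
    Matrix.mulVec (F.mat (i + 1)) (Matrix.mulVec (F.mat i) y) = 0 :=
  F.colMap_colMap i y

/-! ### Reduction of resolutions and lifting of cohomology -/

namespace FlatReduction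

variable {k : Type u} [Field k] {B₀ B : Type u} [Ring B₀] [Algebra k B₀]
    [Ring B] [Algebra k⟦X⟧ B] (D : FlatReduction k B₀ B)

section Reduce

variable {X : ModuleCat.{u} B} {X₀ : ModuleCat.{u} B₀} (F : FreeResolution B X)
  (aug₀ : (F.κ 1 → B₀) →ₗ[B₀] X₀)

include D in
-- The image of each differential is the kernel of a map to a module without `h`-torsion, hence
-- saturated. This is why reduction modulo `h` preserves exactness.
theorem exists_vecMul_eq_of_X_smul
    (htf : ∀ x, F.aug ((PowerSeries.X : k⟦X⟧) • x) = 0 → F.aug x = 0) (i : ℕ)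
    (u : F.κ (i + 1) → B) (h : ∃ x, Matrix.vecMul x (F.mat (i + 1)) = (PowerSeries.X : k⟦X⟧) • u) :
    ∃ x, Matrix.vecMul x (F.mat (i + 1)) = u := by
  cases i with
  | zero => exact (F.aug_eq_zero_iff u).1 (htf u ((F.aug_eq_zero_iff _).2 h))
  | succ i =>
    refine (F.exact i u).1 (D.eq_zero_of_X_smul ?_)
    rw [← Matrix.smul_vecMul]
    exact (F.exact i _).2 h

/-- The reduction of a free resolution. -/
def reduce (haug₀ : Function.Surjective aug₀)
    (hred : ∀ x : F.κ 1 → B, aug₀ (D.red ∘ x) = 0 ↔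
      ∃ x', F.aug x = F.aug ((PowerSeries.X : k⟦X⟧) • x'))
    (htf : ∀ x, F.aug ((PowerSeries.X : k⟦X⟧) • x) = 0 → F.aug x = 0) :
    FreeResolution B₀ X₀ where
  κ := F.κ
  fintype := F.fintype
  isEmpty := F.isEmpty
  mat i := (F.mat i).map D.red
  aug := aug₀
  aug_surjective := haug₀
  aug_eq_zero_iff x := by
    obtain ⟨x, rfl⟩ := D.exists_comp_eq x
    rw [hred]
    constructor
    · rintro ⟨x', hx'⟩
      rw [← sub_eq_zero, ← map_sub, F.aug_eq_zero_iff] at hx'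
      obtain ⟨y, hy⟩ := hx'
      refine ⟨D.red ∘ y, ?_⟩
      rw [← D.comp_vecMul, hy, eq_comm, D.comp_eq_iff]
      exact ⟨x', (sub_add_cancel _ _).symm⟩
    · rintro ⟨y, hy⟩
      obtain ⟨y, rfl⟩ := D.exists_comp_eq y
      rw [← D.comp_vecMul, eq_comm, D.comp_eq_iff] at hy
      obtain ⟨x', rfl⟩ := hy
      refine ⟨x', ?_⟩
      rw [map_add, (F.aug_eq_zero_iff _).2 ⟨y, rfl⟩, zero_add]
  exact i x := by
    obtain ⟨x, rfl⟩ := D.exists_comp_eq x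
    rw [← D.comp_vecMul, D.comp_eq_zero_iff]
    constructor
    · rintro ⟨u, hu⟩
      -- Saturation turns a cycle modulo `h` into a genuine cycle `x - h x'` with the same
      -- reduction.
      obtain ⟨x', rfl⟩ := D.exists_vecMul_eq_of_X_smul F htf i u ⟨x, hu⟩
      rw [← sub_eq_zero, ← Matrix.smul_vecMul, ← Matrix.sub_vecMul, F.exact] at hu
      obtain ⟨y, hy⟩ := hu
      refine ⟨D.red ∘ y, ?_⟩
      rw [← D.comp_vecMul, hy, eq_comm, D.comp_eq_iff]
      exact ⟨x', (sub_add_cancel _ _).symm⟩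
    · rintro ⟨y, hy⟩
      obtain ⟨y, rfl⟩ := D.exists_comp_eq y
      rw [← D.comp_vecMul, eq_comm, D.comp_eq_iff] at hy
      obtain ⟨x', rfl⟩ := hy
      refine ⟨Matrix.vecMul x' (F.mat (i + 1)), ?_⟩
      rw [Matrix.add_vecMul, (F.exact i _).2 ⟨y, rfl⟩, zero_add, Matrix.smul_vecMul]

end Reduce

section Lifting

variable {X : ModuleCat.{u} B} (F : FreeResolution B X)

include D in
theorem mulVec_eq_zero_of_eq_add (i : ℕ) {y y' : F.κ (i + 1) → B}
    {x : F.κ i → B} (h : y = Matrix.mulVec (F.mat i) x + (PowerSeries.X : k⟦X⟧) • y')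
    (hy : Matrix.mulVec (F.mat (i + 1)) y = 0) : Matrix.mulVec (F.mat (i + 1)) y' = 0 := by
  refine D.eq_zero_of_X_smul ?_
  rw [h, Matrix.mulVec_add, F.mulVec_mulVec, zero_add, Matrix.mulVec_smul] at hy
  exact hy

theorem comp_mulVec_eq_zero {m n : Type} [Fintype n] {M : Matrix m n B} {y : n → B}
    (hy : Matrix.mulVec M y = 0) : Matrix.mulVec (M.map D.red) (D.red ∘ y) = 0 := by
  rw [← D.comp_mulVec, hy]
  exact funext fun _ => map_zero D.red

/-- A cocycle is a coboundary up to `h` times an element which, by torsion-freeness, is again a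
cocycle; successive approximation applies. -/
theorem exact_lift (i : ℕ)
    (h : ∀ y, Matrix.mulVec ((F.mat (i + 1)).map D.red) y = 0 →
      ∃ x, Matrix.mulVec ((F.mat i).map D.red) x = y)
    (y : F.κ (i + 1) → B) (hy : Matrix.mulVec (F.mat (i + 1)) y = 0) :
    ∃ x, Matrix.mulVec (F.mat i) x = y := by
  refine HComplete.exists_of_approx (k := k) D.complete.pi D.complete.pi
    (colMap (F.mat i)).toAddMonoidHom (fun c x => Matrix.mulVec_smul _ c x)
    (fun y => Matrix.mulVec (F.mat (i + 1)) y = 0) (fun y hy => ?_) y hy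
  obtain ⟨x, hx⟩ := h _ (D.comp_mulVec_eq_zero hy)
  obtain ⟨x, rfl⟩ := D.exists_comp_eq x
  rw [← D.comp_mulVec, eq_comm, D.comp_eq_iff] at hx
  obtain ⟨y', hy'⟩ := hx
  exact ⟨x, y', D.mulVec_eq_zero_of_eq_add F i hy' hy, hy'⟩

/-- For any lift `w`, the differential of `w` is `h v` with `v` a cocycle one degree higher.
Vanishing of cohomology there writes `v` as the differential of some `x`, and `w - h x` is the
required lift. -/
theorem exists_cocycle_lift (i : ℕ)
    (h : ∀ y, Matrix.mulVec ((F.mat (i + 2)).map D.red) y = 0 →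
      ∃ x, Matrix.mulVec ((F.mat (i + 1)).map D.red) x = y)
    (w₀ : F.κ (i + 1) → B₀) (hw₀ : Matrix.mulVec ((F.mat (i + 1)).map D.red) w₀ = 0) :
    ∃ w, Matrix.mulVec (F.mat (i + 1)) w = 0 ∧ D.red ∘ w = w₀ := by
  obtain ⟨w, rfl⟩ := D.exists_comp_eq w₀
  rw [← D.comp_mulVec, D.comp_eq_zero_iff] at hw₀
  obtain ⟨v, hv⟩ := hw₀
  obtain ⟨x, rfl⟩ := D.exact_lift F (i + 1) h v (D.eq_zero_of_X_smul (by
    rw [← Matrix.mulVec_smul, ← hv, F.mulVec_mulVec]))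
  refine ⟨w - (PowerSeries.X : k⟦X⟧) • x, ?_, ?_⟩
  · rw [Matrix.mulVec_sub, hv, Matrix.mulVec_smul, sub_self]
  · rw [eq_comm, D.comp_eq_iff]
    exact ⟨x, (sub_add_cancel _ _).symm⟩

theorem comp_smul {m : Type} (c : k⟦X⟧) (x : m → B) :
    D.red ∘ (c • x) = PowerSeries.constantCoeff c • (D.red ∘ x) :=
  funext fun a => D.red_smul c (x a)

theorem comp_add {m : Type} (x y : m → B) : D.red ∘ (x + y) = D.red ∘ x + D.red ∘ y :=
  funext fun a => map_add D.red (x a) (y a)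

/-- Successive approximation for the map `(c, x) ↦ c w + M x`, where `M` is `mat i`; the scalar
found over `k` is lifted to a constant power series. -/
theorem exists_eq_smul_add (i : ℕ) (w : F.κ (i + 1) → B)
    (hw : Matrix.mulVec (F.mat (i + 1)) w = 0)
    (h : ∀ y, Matrix.mulVec ((F.mat (i + 1)).map D.red) y = 0 → ∃ (c : k) (x : F.κ i → B₀),
      y = c • (D.red ∘ w) + Matrix.mulVec ((F.mat i).map D.red) x)
    (y : F.κ (i + 1) → B) (hy : Matrix.mulVec (F.mat (i + 1)) y = 0) :
    ∃ (c : k⟦X⟧) (x : F.κ i → B), y = c • w + Matrix.mulVec (F.mat i) x := by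
  let f : k⟦X⟧ × (F.κ i → B) →+ (F.κ (i + 1) → B) :=
    { toFun := fun p => p.1 • w + Matrix.mulVec (F.mat i) p.2
      map_zero' := by simp
      map_add' := fun p q => by
        simp only [Prod.fst_add, Prod.snd_add, add_smul, Matrix.mulVec_add]
        abel }
  obtain ⟨p, hp⟩ := HComplete.exists_of_approx (k := k)
    ((TopologicalHopfAlgebra.hComplete_base k).prod D.complete.pi) D.complete.pi f
    (fun c p => by
      change (c * p.1) • w + Matrix.mulVec (F.mat i) (c • p.2) = c • (p.1 • w + _)
      rw [mul_smul, Matrix.mulVec_smul, smul_add])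
    (fun y => Matrix.mulVec (F.mat (i + 1)) y = 0) (fun y hy => by
      obtain ⟨c, x, hx⟩ := h _ (D.comp_mulVec_eq_zero hy)
      obtain ⟨x, rfl⟩ := D.exists_comp_eq x
      have h1 : D.red ∘ y = D.red ∘ (f (PowerSeries.C c, x)) := by
        rw [hx]
        change _ = D.red ∘ (PowerSeries.C c • w + Matrix.mulVec (F.mat i) x)
        rw [D.comp_add, D.comp_smul, D.comp_mulVec, PowerSeries.constantCoeff_C]
      obtain ⟨y', hy'⟩ := (D.comp_eq_iff _ _).1 h1
      refine ⟨_, y', D.eq_zero_of_X_smul ?_, hy'⟩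
      have h2 : Matrix.mulVec (F.mat (i + 1)) (f (PowerSeries.C c, x)) = 0 := by
        change Matrix.mulVec _ (PowerSeries.C c • w + Matrix.mulVec (F.mat i) x) = 0
        rw [Matrix.mulVec_add, Matrix.mulVec_smul, hw, smul_zero, F.mulVec_mulVec, zero_add]
      rw [hy', Matrix.mulVec_add, h2, zero_add, Matrix.mulVec_smul] at hy
      exact hy) y hy
  exact ⟨p.1, p.2, hp.symm⟩

/-- Vanishing of the cohomology modulo `h` at `κ i` writes `z` as a coboundary plus `h z'`, and the
coboundary is killed by `mat i`. The index `j` excludes `i = 0`, where `κ 0` is empty. -/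
theorem exists_eq_comp_add (i : ℕ)
    (h : ∀ j, j + 1 = i → ∀ y, Matrix.mulVec ((F.mat (j + 1)).map D.red) y = 0 →
      ∃ x, Matrix.mulVec ((F.mat j).map D.red) x = y)
    (z : F.κ i → B) (hz : Matrix.mulVec ((F.mat i).map D.red) (D.red ∘ z) = 0) :
    ∃ z', Matrix.mulVec (F.mat i) z = (PowerSeries.X : k⟦X⟧) • Matrix.mulVec (F.mat i) z' := by
  cases i with
  | zero => exact ⟨0, by rw [Subsingleton.elim z 0, Matrix.mulVec_zero, smul_zero]⟩
  | succ j =>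
    obtain ⟨u, hu⟩ := h j rfl _ hz
    obtain ⟨u, rfl⟩ := D.exists_comp_eq u
    rw [← D.comp_mulVec, eq_comm, D.comp_eq_iff] at hu
    obtain ⟨z', rfl⟩ := hu
    exact ⟨z', by rw [Matrix.mulVec_add, F.mulVec_mulVec, zero_add, Matrix.mulVec_smul]⟩

/-- Reduction modulo `h` shows that `h` divides `c`. Cancelling `h` gives a relation of the same
kind for the quotient, so `c` is divisible by every power of `h`. -/
theorem eq_zero_of_smul_eq (i : ℕ)
    (h : ∀ j, j + 1 = i → ∀ y, Matrix.mulVec ((F.mat (j + 1)).map D.red) y = 0 →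
      ∃ x, Matrix.mulVec ((F.mat j).map D.red) x = y)
    (w : F.κ (i + 1) → B)
    (hw : ∀ (c : k) (x : F.κ i → B₀),
      c • (D.red ∘ w) = Matrix.mulVec ((F.mat i).map D.red) x → c = 0)
    (c : k⟦X⟧) (x : F.κ i → B) (hc : c • w = Matrix.mulVec (F.mat i) x) : c = 0 := by
  have step : ∀ (c : k⟦X⟧) (x : F.κ i → B), c • w = Matrix.mulVec (F.mat i) x →
      ∃ (c' : k⟦X⟧) (x' : F.κ i → B), c = PowerSeries.X * c' ∧
        c' • w = Matrix.mulVec (F.mat i) x' := fun c x hc => by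
    have h0 : PowerSeries.constantCoeff c • (D.red ∘ w) =
        Matrix.mulVec ((F.mat i).map D.red) (D.red ∘ x) := by
      rw [← D.comp_smul, hc, D.comp_mulVec]
    have h1 := hw _ _ h0
    obtain ⟨c', rfl⟩ := PowerSeries.X_dvd_iff.2 h1
    rw [h1, zero_smul] at h0
    obtain ⟨x', hx'⟩ := D.exists_eq_comp_add F i h x h0.symm
    refine ⟨c', x', rfl, D.eq_of_X_smul ?_⟩
    rw [← hx', ← hc, mul_smul]
  refine (TopologicalHopfAlgebra.hComplete_base k).sep c fun n => ?_
  suffices ∃ (c' : k⟦X⟧) (x' : F.κ i → B), c = PowerSeries.X ^ n * c' ∧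
      c' • w = Matrix.mulVec (F.mat i) x' from this.imp fun c' ⟨_, h, _⟩ => h
  induction n with
  | zero => exact ⟨c, x, by simp, hc⟩
  | succ n ih =>
    obtain ⟨c', x', rfl, h'⟩ := ih
    obtain ⟨c'', x'', rfl, h''⟩ := step c' x' h'
    exact ⟨c'', x'', by ring, h''⟩

end Lifting

section Ext

variable {X : ModuleCat.{u} B} {X₀ : ModuleCat.{u} B₀} (F : FreeResolution B X)
  (aug₀ : (F.κ 1 → B₀) →ₗ[B₀] X₀) (haug₀ : Function.Surjective aug₀)
  (hred : ∀ x : F.κ 1 → B, aug₀ (D.red ∘ x) = 0 ↔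
    ∃ x', F.aug x = F.aug ((PowerSeries.X : k⟦X⟧) • x'))
  (htf : ∀ x, F.aug ((PowerSeries.X : k⟦X⟧) • x) = 0 → F.aug x = 0)

include aug₀ haug₀ hred htf

theorem subsingleton_extDual (i : ℕ) (h : Subsingleton (ExtDual X₀ i)) :
    Subsingleton (ExtDual X i) :=
  (F.subsingleton_extDual_iff i).2
    (D.exact_lift F i (((D.reduce F aug₀ haug₀ hred htf).subsingleton_extDual_iff i).1 h))

/-- Vanishing in degree `i + 1` lifts a generating cocycle; vanishing in degree `i - 1` shows that
its class has no torsion. -/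
theorem nonempty_extDual_equiv (i : ℕ) (h : ∀ j, j ≠ i → Subsingleton (ExtDual X₀ j))
    (hi : Nonempty (ExtDual X₀ i ≃ₗ[k] k)) : Nonempty (ExtDual X i ≃ₗ[k⟦X⟧] k⟦X⟧) := by
  let F₀ := D.reduce F aug₀ haug₀ hred htf
  obtain ⟨w₀, hw₀, h1, h2⟩ := (F₀.nonempty_extDual_equiv_iff i).1 hi
  have h' := fun j hj => (F₀.subsingleton_extDual_iff j).1 (h j hj)
  obtain ⟨w, hw, rfl⟩ := D.exists_cocycle_lift F i (h' (i + 1) (Nat.succ_ne_self i)) w₀ hw₀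
  exact (F.nonempty_extDual_equiv_iff i).2 ⟨w, hw, D.exists_eq_smul_add F i w hw h1,
    D.eq_zero_of_smul_eq F i (fun j hj => h' j (by lia)) w h2⟩

end Ext

end FlatReduction

/-! ### The resolution of the trivial module -/

/-- The augmentation of a character. -/
def augmentation {R S : Type u} [Ring R] [Ring S] (χ : R →+* S) :
    (Fin 1 → R) →ₗ[R] characterModule χ where
  toFun x := χ (x 0)
  map_add' x y := map_add χ (x 0) (y 0)
  map_smul' r x := map_mul χ r (x 0)

namespace HopfDeformation

open TopologicalHopfAlgebra

variable {k : Type u} [Field k] {B₀ B : Type u} [Ring B₀] [HopfAlgebra k B₀]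
    [Ring B] [Algebra k⟦X⟧ B] [TopologicalHopfAlgebra k B] (D : HopfDeformation k B₀ B)

theorem counit_augmentation_smul (c : k⟦X⟧) (x : Fin 1 → B) :
    (counit (k := k)).toRingHom ((c • x) 0) = c * (counit (k := k)) (x 0) :=
  map_smul (counit (k := k)) c (x 0)

theorem augmentation_eq_zero_of_X_smul {x : Fin 1 → B}
    (h : augmentation (counit (k := k) (A := B)).toRingHom ((PowerSeries.X : k⟦X⟧) • x) = 0) :
    augmentation (counit (k := k) (A := B)).toRingHom x = 0 :=
  (mul_eq_zero.1 ((counit_augmentation_smul _ x).symm.trans h)).resolve_left PowerSeries.X_ne_zero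

theorem counit_red_eq_zero_iff (b : B) : Coalgebra.counit (R := k) (D.red b) = 0 ↔
    ∃ c : B, counit (k := k) b = counit (k := k) ((PowerSeries.X : k⟦X⟧) • c) := by
  rw [D.red_counit, ← PowerSeries.X_dvd_iff]
  constructor
  · rintro ⟨c, hc⟩
    refine ⟨algebraMap k⟦X⟧ B c, ?_⟩
    rw [hc, map_smul, AlgHom.commutes]
    rfl
  · rintro ⟨c, hc⟩
    exact ⟨counit (k := k) c, hc.trans (map_smul _ _ _)⟩

variable [IsNoetherianRing B₀]

/-- A resolution of the trivial module by finite free modules. -/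
def counitResolution :
    FreeResolution B (characterModule (counit (k := k) (A := B)).toRingHom) :=
  D.toFlatReduction.resolution
    ⟨1, LinearMap.ker (augmentation (counit (k := k) (A := B)).toRingHom),
      fun _ h => augmentation_eq_zero_of_X_smul h⟩
    (augmentation (counit (k := k) (A := B)).toRingHom)
    (fun c => ⟨fun _ => algebraMap k⟦X⟧ B c, (counit (k := k)).commutes c⟩) (fun _ => Iff.rfl)

/-- The index of the generator of degree zero. -/
def generator : D.counitResolution.κ 1 := (0 : Fin 1)

theorem augmentation_red_eq_zero_iff (x : D.counitResolution.κ 1 → B) :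
    augmentation (Bialgebra.counitAlgHom k B₀).toRingHom (D.toFlatReduction.red ∘ x) = 0 ↔
      ∃ x', D.counitResolution.aug x = D.counitResolution.aug ((PowerSeries.X : k⟦X⟧) • x') := by
  refine (D.counit_red_eq_zero_iff (x D.generator)).trans ⟨fun ⟨c, hc⟩ => ⟨fun _ => c, hc⟩,
    fun ⟨x', hx'⟩ => ⟨x' D.generator, hx'⟩⟩

include D in
theorem subsingleton_omega (i : ℕ)
    (h : Subsingleton (ExtDual (characterModule (Bialgebra.counitAlgHom k B₀).toRingHom) i)) :
    Subsingleton (Omega k B i) :=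
  D.toFlatReduction.subsingleton_extDual D.counitResolution
    (augmentation (Bialgebra.counitAlgHom k B₀).toRingHom)
    (fun c => ⟨fun _ => algebraMap k B₀ c, (Bialgebra.counitAlgHom k B₀).commutes c⟩)
    D.augmentation_red_eq_zero_iff (fun _ h => augmentation_eq_zero_of_X_smul h) i h

include D in
theorem nonempty_omega_equiv (d : ℕ)
    (h : ∀ i, i ≠ d →
      Subsingleton (ExtDual (characterModule (Bialgebra.counitAlgHom k B₀).toRingHom) i))
    (hd : Nonempty
      (ExtDual (characterModule (Bialgebra.counitAlgHom k B₀).toRingHom) d ≃ₗ[k] k)) :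
    Nonempty (Omega k B d ≃ₗ[k⟦X⟧] k⟦X⟧) :=
  D.toFlatReduction.nonempty_extDual_equiv D.counitResolution
    (augmentation (Bialgebra.counitAlgHom k B₀).toRingHom)
    (fun c => ⟨fun _ => algebraMap k B₀ c, (Bialgebra.counitAlgHom k B₀).commutes c⟩)
    D.augmentation_red_eq_zero_iff (fun _ h => augmentation_eq_zero_of_X_smul h) d h hd

end HopfDeformation

/-! ### Twisting by a module -/

namespace TopologicalHopfAlgebra

variable {k : Type u} [Field k] {B : Type u} [Ring B] [Algebra k⟦X⟧ B] [TopologicalHopfAlgebra k B]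

/-- Converts orthogonality relations between linear forms into the operator relations of
`TwistData`. -/
theorem rightHit_ite_counit (P : Prop) [Decidable P] {g : B →ₗ[k⟦X⟧] k⟦X⟧}
    (h : ∀ b, g b = counit (k := k) b * if P then 1 else 0) (b : B) :
    rightHit g b = if P then b else 0 := by
  split_ifs with hP
  · have hg : g = (counit (k := k)).toLinearMap :=
      LinearMap.ext fun x => by rw [h, if_pos hP, mul_one]; rfl
    rw [hg, rightHit_counit]
  · refine hq_ext (hComplete k B) fun n => ?_
    obtain ⟨t, ht⟩ := exists_proj_eq n (comul (k := k) b)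
    have hg : g = 0 := LinearMap.ext fun x => by rw [h, if_neg hP, mul_zero]; rfl
    rw [rightHit, hq_contract _ ht, hg, rightSlice, LinearMap.lTensor_zero]
    simp

theorem sum_rightHit {ι : Type} [Fintype ι] (g : ι → B →ₗ[k⟦X⟧] k⟦X⟧) (b : B) :
    ∑ l, rightHit (g l) b = rightHit (∑ l, g l) b := by
  classical
  refine hq_ext (hComplete k B) fun n => ?_
  obtain ⟨t, ht⟩ := exists_proj_eq n (comul (k := k) b)
  rw [map_sum]
  simp_rw [rightHit, hq_contract _ ht]
  rw [← map_sum]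
  refine congrArg (hq n) ?_
  clear ht
  induction t using TensorProduct.induction_on with
  | zero => simp
  | add x y hx hy => simp only [map_add, hx, hy, Finset.sum_add_distrib]
  | tmul x y => simp [Finset.sum_smul]

variable {ι : Type} [Fintype ι] [DecidableEq ι]

/-- A matrix of linear forms that is a matrix representation of `B`. -/
structure IsMatrixRep (ρ : ι → ι → B →ₗ[k⟦X⟧] k⟦X⟧) : Prop where
  mul : ∀ i j x y, ρ i j (x * y) = ∑ l, ρ i l x * ρ l j y
  one : ∀ i j, ρ i j 1 = if i = j then 1 else 0

/-- `b ↦ ∑ b' ρ (b'')` -/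
def IsMatrixRep.hit {ρ : ι → ι → B →ₗ[k⟦X⟧] k⟦X⟧} (h : IsMatrixRep ρ) : B →+* Matrix ι ι B where
  toFun b := Matrix.of fun i j => rightHit (ρ i j) b
  map_one' := by
    ext i j
    rw [Matrix.of_apply, rightHit_one, h.one, Matrix.one_apply]
    split_ifs <;> simp
  map_mul' a b := by
    ext i j
    exact rightHit_mul (h.mul i j) a b
  map_zero' := by
    ext i j
    exact map_zero (rightHit (ρ i j))
  map_add' a b := by
    ext i j
    exact map_add (rightHit (ρ i j)) a b

theorem IsMatrixRep.hit_apply {ρ : ι → ι → B →ₗ[k⟦X⟧] k⟦X⟧} (h : IsMatrixRep ρ) (b : B) (i j : ι) :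
    h.hit b i j = rightHit (ρ i j) b := rfl

/-- Both transposition and the antipode reverse products, so their combination preserves them. -/
theorem IsMatrixRep.dual {ρ : ι → ι → B →ₗ[k⟦X⟧] k⟦X⟧} (h : IsMatrixRep ρ) :
    IsMatrixRep fun i j => ρ j i ∘ₗ antipode (k := k) where
  mul i j x y := by
    simp only [LinearMap.comp_apply, antipode_mul, h.mul]
    exact Finset.sum_congr rfl fun l _ => mul_comm _ _
  one i j := by
    simp only [LinearMap.comp_apply, antipode_one, h.one, eq_comm]

/-- The twists attached to a matrix representation. -/
def IsMatrixRep.twistData {ρ : ι → ι → B →ₗ[k⟦X⟧] k⟦X⟧} (h : IsMatrixRep ρ) : TwistData B ι where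
  -- Dualizing twice undoes the transposition and leaves a composition with `S²`: this is the source
  -- of the `S²` in the twisted action.
  σ := h.dual.dual.hit
  τ := h.dual.hit
  π i j := (rightHit (ρ i j)).toAddMonoidHom
  sum_σ_τ i j b := by
    simp only [hit_apply, rightHit_rightHit, sum_rightHit]
    refine rightHit_ite_counit _ (fun b => ?_) b
    rw [LinearMap.sum_apply, ← h.one i j, ← antipode_one k B]
    exact sum_apply_antipode_rightHit (G := ρ i j ∘ₗ antipode (k := k))
      (p := fun l => ρ l j ∘ₗ antipode (k := k)) (q := fun l => ρ i l ∘ₗ antipode (k := k))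
      (h.dual.mul j i · · |>.trans (Finset.sum_congr rfl fun l _ => rfl)) b
  sum_τ_σ i j b := by
    simp only [hit_apply, rightHit_rightHit, sum_rightHit]
    refine rightHit_ite_counit _ (fun b => ?_) b
    rw [LinearMap.sum_apply, ← h.one i j, ← antipode_one k B]
    exact sum_apply_rightHit_antipode (G := ρ i j ∘ₗ antipode (k := k))
      (p := fun l => ρ l j ∘ₗ antipode (k := k)) (q := fun l => ρ i l ∘ₗ antipode (k := k))
      (h.dual.mul j i) b
  sum_π_τ i l b := by
    change ∑ j, rightHit (ρ i j) (h.dual.hit b l j) = _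
    simp only [hit_apply, rightHit_rightHit, sum_rightHit]
    refine rightHit_ite_counit _ (fun b => ?_) b
    rw [LinearMap.sum_apply, ← h.one i l]
    exact sum_apply_rightHit_antipode (h.mul i l) b
  sum_τ_π i l b := by
    change ∑ j, h.dual.hit (rightHit (ρ j l) b) j i = _
    simp only [hit_apply, rightHit_rightHit, sum_rightHit]
    refine rightHit_ite_counit _ (fun b => ?_) b
    rw [LinearMap.sum_apply, ← h.one i l]
    exact sum_apply_antipode_rightHit (h.mul i l) b

end TopologicalHopfAlgebra

namespace TopologicalHopfAlgebra

section Coefficients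

variable {k : Type u} [Field k] {B : Type u} [Ring B] [Algebra k⟦X⟧ B] {ι : Type}

variable {V : Type u} [AddCommGroup V] [Module k⟦X⟧ V] [Module B V] [IsScalarTower k⟦X⟧ B V]
  (b : Module.Basis ι k⟦X⟧ V)

/-- The matrix coefficients of a module in a basis. -/
def coefficient (i j : ι) : B →ₗ[k⟦X⟧] k⟦X⟧ :=
  b.coord i ∘ₗ (LinearMap.toSpanSingleton B V (b j)).restrictScalars k⟦X⟧

theorem coefficient_apply (i j : ι) (x : B) : coefficient b i j x = b.repr (x • b j) i := rfl

theorem sum_coefficient [Fintype ι] (x : B) (j : ι) : ∑ i, coefficient b i j x • b i = x • b j :=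
  b.sum_repr (x • b j)

variable [Fintype ι] [DecidableEq ι]

theorem isMatrixRep_coefficient : IsMatrixRep (coefficient (B := B) b) where
  mul i j x y := by
    rw [coefficient_apply, mul_smul, ← sum_coefficient b y j, Finset.smul_sum, map_sum,
      Finsupp.finsetSum_apply]
    refine Finset.sum_congr rfl fun l _ => ?_
    rw [← algebraMap_smul B (coefficient b l j y) (b l), smul_smul, ← Algebra.commutes, mul_smul,
      algebraMap_smul, map_smul, Finsupp.smul_apply, smul_eq_mul, mul_comm, coefficient_apply,
      coefficient_apply]
  one i j := by
    rw [coefficient_apply, one_smul, b.repr_self, Finsupp.single_apply]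
    exact if_congr eq_comm rfl rfl

/-- The left side is `∑ x' S(x'') • b j`. This makes the augmentation of the twisted resolution
match the counit in each component. -/
theorem sum_rightHit_smul [TopologicalHopfAlgebra k B] (x : B) (j : ι) :
    ∑ i, rightHit (coefficient b i j ∘ₗ antipode (k := k)) x • b i = counit (k := k) x • b j := by
  refine b.ext_elem fun l => ?_
  have h := sum_apply_rightHit_antipode ((isMatrixRep_coefficient b).mul l j) x
  rw [(isMatrixRep_coefficient b).one] at h
  rw [map_sum, Finsupp.finsetSum_apply, map_smul, Finsupp.smul_apply, b.repr_self,
    Finsupp.single_apply, smul_eq_mul]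
  refine h.trans (congrArg _ (if_congr eq_comm rfl rfl))

end Coefficients

end TopologicalHopfAlgebra

open TopologicalHopfAlgebra in
/-- `Ext^i_A(A ⊗_B V, A)` in terms of `Ext^i_B(K, B)`. -/
theorem HopfDeformation.nonempty_extDual_equiv_twisted {k : Type u} [Field k] {B₀ B A : Type u}
    [Ring B₀] [HopfAlgebra k B₀] [Ring B] [Algebra k⟦X⟧ B] [TopologicalHopfAlgebra k B] [Ring A]
    [IsNoetherianRing B₀] (D : HopfDeformation k B₀ B) {φ : B →+* A} (flat : IsRightFlat φ)
    (flat' : IsRightFlat (RingHom.op φ)) {V : Type u} [AddCommGroup V] [Module k⟦X⟧ V] [Module B V]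
    [IsScalarTower k⟦X⟧ B V] {ι : Type} [Fintype ι] [DecidableEq ι] (b : Module.Basis ι k⟦X⟧ V)
    (i : ℕ) :
    Nonempty (ExtDual (ModuleCat.of A (InducedModule φ V)) i ≃ₗ[Aᵐᵒᵖ]
      InducedModule (RingHom.op φ)
        (Twisted (isMatrixRep_coefficient (B := B) b).twistData.σ (Omega k B i))) := by
  let aug : (D.counitResolution.κ 1 × ι → B) →ₗ[B] V :=
    { toFun := fun y => ∑ i, y (D.generator, i) • b i
      map_add' := fun y z => by simp [add_smul, Finset.sum_add_distrib]
      map_smul' := fun c y => by simp [mul_smul, Finset.smul_sum] }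
  refine (isMatrixRep_coefficient (B := B) b).twistData.nonempty_extDual_equiv flat flat'
    D.counitResolution b.equivFun.symm.toAddEquiv aug (fun x => ?_) i
  change ∑ i, (∑ j, rightHit (coefficient b i j ∘ₗ antipode (k := k)) (x j D.generator)) • b i =
    b.equivFun.symm fun j => counit (k := k) (x j D.generator)
  simp only [Finset.sum_smul]
  rw [Finset.sum_comm, b.equivFun_symm_apply]
  exact Finset.sum_congr rfl fun j _ => sum_rightHit_smul b _ j

/-! ### The twisted action on `Ω ⊗ V*` -/

/-- A ring acts through a character on a bimodule that is free of rank one over the base. -/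
theorem exists_character {K R Ω : Type u} [CommRing K] [Ring R] [Algebra K R] [AddCommGroup Ω]
    [Module K Ω] [Module Rᵐᵒᵖ Ω] (h : ∀ (c : K) (ω : Ω), op (algebraMap K R c) • ω = c • ω)
    (e : Ω ≃ₗ[K] K) : ∃ θ : R →ₐ[K] K, ∀ (u : R) (ω : Ω), op u • ω = θ u • ω := by
  have hcomm : ∀ (u : R) (c : K) (ω : Ω), op u • c • ω = c • op u • ω := fun u c ω => by
    rw [← h, ← h, smul_smul, smul_smul, ← op_mul, ← op_mul, Algebra.commutes]
  have hx : ∀ ω : Ω, e ω • e.symm 1 = ω := fun ω => by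
    rw [← map_smul, smul_eq_mul, mul_one, e.symm_apply_apply]
  have key : ∀ (u : R) (ω : Ω), op u • ω = e (op u • e.symm 1) • ω := fun u ω => by
    conv_lhs => rw [← hx ω, hcomm, ← hx (op u • e.symm 1)]
    rw [smul_comm, hx]
  refine ⟨AlgHom.ofLinearMap
    { toFun := fun u => e (op u • e.symm 1)
      map_add' := fun u v => by rw [MulOpposite.op_add, add_smul, map_add]
      map_smul' := fun c u => by
        rw [Algebra.smul_def, op_mul, mul_smul, h, hcomm, map_smul]
        rfl } ?_ ?_, key⟩
  · change e (op 1 • e.symm 1) = 1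
    rw [op_one, one_smul, e.apply_symm_apply]
  -- Commutativity of `K` makes the right action give a morphism, rather than an antimorphism.
  · intro u v
    change e (op (u * v) • e.symm 1) = e (op u • e.symm 1) * e (op v • e.symm 1)
    rw [op_mul, mul_smul, key v (op u • e.symm 1), map_smul, smul_eq_mul, mul_comm]

namespace TopologicalHopfAlgebra

variable {k : Type u} [Field k] {B : Type u} [Ring B] [Algebra k⟦X⟧ B] [TopologicalHopfAlgebra k B]
  (θ : B →ₐ[k⟦X⟧] k⟦X⟧) (Ω : Type u) [AddCommGroup Ω] [Module k⟦X⟧ Ω]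
  (V : Type u) [AddCommGroup V] [Module k⟦X⟧ V] [Module B V] [IsScalarTower k⟦X⟧ B V]

variable (k) in
/-- The endomorphism `ω ⊗ f ↦ ω ⊗ f · S²(b)` of `Ω ⊗ V*`. -/
def dualAction : B →ₗ[k⟦X⟧] Module.End k⟦X⟧ (Ω ⊗[k⟦X⟧] Module.Dual k⟦X⟧ V) :=
  LinearMap.lTensorHom Ω ∘ₗ Module.Dual.transpose ∘ₗ
    (Algebra.lsmul k⟦X⟧ k⟦X⟧ V : B →ₐ[k⟦X⟧] Module.End k⟦X⟧ V).toLinearMap ∘ₗ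
      antipode (k := k) ∘ₗ antipode (k := k)

theorem dualAction_tmul (b : B) (ω : Ω) (f : Module.Dual k⟦X⟧ V) :
    dualAction k Ω V b (ω ⊗ₜ f) =
      ω ⊗ₜ (f ∘ₗ Algebra.lsmul k⟦X⟧ k⟦X⟧ V (antipode (k := k) (antipode (k := k) b))) := rfl

theorem dualAction_one : dualAction k Ω V (1 : B) = 1 := by
  refine TensorProduct.ext' fun ω f => ?_
  rw [dualAction_tmul, antipode_one, antipode_one, map_one]
  rfl

theorem dualAction_mul (a b : B) :
    dualAction k Ω V (a * b) = dualAction k Ω V b * dualAction k Ω V a := by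
  refine TensorProduct.ext' fun ω f => ?_
  rw [Module.End.mul_apply, dualAction_tmul, dualAction_tmul, dualAction_tmul, antipode_mul,
    antipode_mul, map_mul]
  rfl

/-- The endomorphism depends on `t` only through `∑ θ(x_j) y_j`. The limit can therefore be taken in
`B`, where it is `leftHit θ u`, before acting on `Ω ⊗ V*`. -/
theorem twist_eq (t : B ⊗[k⟦X⟧] B) :
    twist θ Ω V t = dualAction k Ω V (leftSlice θ.toLinearMap t) := by
  induction t using TensorProduct.induction_on with
  | zero => simp
  | add x y hx hy => simp only [map_add, hx, hy]
  | tmul x y =>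
    refine TensorProduct.ext' fun ω f => ?_
    rw [leftSlice_tmul, map_smul, LinearMap.smul_apply, dualAction_tmul, twist_tmul,
      TensorProduct.smul_tmul']
    rfl

/-- The twisted right action on `Ω ⊗ V*`. -/
def twistedAction : Bᵐᵒᵖ →ₐ[k⟦X⟧] Module.End k⟦X⟧ (Ω ⊗[k⟦X⟧] Module.Dual k⟦X⟧ V) :=
  AlgHom.ofLinearMap
    (dualAction k Ω V ∘ₗ leftHit θ.toLinearMap ∘ₗ (opLinearEquiv k⟦X⟧).symm.toLinearMap)
    (by
      change dualAction k Ω V (leftHit θ.toLinearMap 1) = 1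
      rw [leftHit_one, AlgHom.toLinearMap_apply, map_one, one_smul, dualAction_one])
    (fun a b => by
      change dualAction k Ω V (leftHit θ.toLinearMap (b.unop * a.unop)) = _
      rw [leftHit_mul (map_mul θ), dualAction_mul]
      rfl)

theorem twistedAction_op (u : B) :
    twistedAction θ Ω V (op u) = dualAction k Ω V (leftHit θ.toLinearMap u) := rfl

theorem isTwistedAction_twistedAction : IsTwistedAction θ Ω V (twistedAction θ Ω V) := by
  intro u t ht ω f N
  obtain ⟨n₀, hn₀⟩ := ht N
  refine ⟨n₀, fun n hn => ?_⟩
  have h := hn₀ n hn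
  rw [proj_of] at h
  obtain ⟨s, hs⟩ := (hq_eq_iff N _ _).1 (hq_contract (leftSlice θ.toLinearMap) h)
  refine ⟨dualAction k Ω V s (ω ⊗ₜ f), ?_⟩
  change twistedAction θ Ω V (op u) (ω ⊗ₜ f) - twist θ Ω V (t n) (ω ⊗ₜ f) = _
  rw [twistedAction_op, twist_eq, ← LinearMap.sub_apply, ← map_sub, leftHit, hs, map_smul,
    LinearMap.smul_apply]

variable {Ω V} {ι : Type} [Fintype ι] [DecidableEq ι] (b : Module.Basis ι k⟦X⟧ V)

variable (Ω) in
/-- Coordinates on `Ω ⊗ V*`. -/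
def dualCoordinates : (ι → Ω) ≃ₗ[k⟦X⟧] Ω ⊗[k⟦X⟧] Module.Dual k⟦X⟧ V :=
  (Finsupp.linearEquivFunOnFinite k⟦X⟧ Ω ι).symm.trans
    (TensorProduct.equivFinsuppOfBasisRight b.dualBasis).symm

theorem dualCoordinates_apply (w : ι → Ω) :
    dualCoordinates Ω b w = ∑ i, w i ⊗ₜ b.coord i := by
  rw [dualCoordinates, LinearEquiv.trans_apply, TensorProduct.equivFinsuppOfBasisRight_symm_apply,
    Finsupp.sum_fintype _ _ (by simp)]
  simp

omit [TopologicalHopfAlgebra k B] in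
theorem coord_comp_lsmul (x : B) (i : ι) :
    b.coord i ∘ₗ Algebra.lsmul k⟦X⟧ k⟦X⟧ V x = ∑ j, coefficient b i j x • b.coord j := by
  refine b.ext fun j => ?_
  rw [LinearMap.sum_apply, LinearMap.comp_apply]
  simp [Finsupp.single_apply, coefficient_apply]

theorem dualAction_dualCoordinates (x : B) (w : ι → Ω) :
    dualAction k Ω V x (dualCoordinates Ω b w) = dualCoordinates Ω b fun j =>
      ∑ i, coefficient b i j (antipode (k := k) (antipode (k := k) x)) • w i := by
  rw [dualCoordinates_apply, dualCoordinates_apply, map_sum]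
  simp_rw [dualAction_tmul, coord_comp_lsmul, TensorProduct.tmul_sum, TensorProduct.sum_tmul,
    TensorProduct.tmul_smul, TensorProduct.smul_tmul']
  exact Finset.sum_comm

variable [Module Bᵐᵒᵖ Ω]

/-- If `B` acts on `Ω` through a character, the twist of `Ω` is `Ω ⊗ V*` with its twisted
action. -/
def twistedEquiv (h : ∀ (u : B) (ω : Ω), op u • ω = θ u • ω) :
    Twisted (isMatrixRep_coefficient (B := B) b).twistData.σ Ω ≃ₗ[Bᵐᵒᵖ]
      RepModule (twistedAction θ Ω V) :=
  { (dualCoordinates Ω b).toAddEquiv with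
    map_smul' := fun u w => by
      let w' : ι → Ω := w
      change dualCoordinates Ω b (fun j => ∑ i, op (rightHit _ u.unop) • w' i) =
        dualAction k Ω V (leftHit θ.toLinearMap u.unop) (dualCoordinates Ω b w')
      rw [dualAction_dualCoordinates]
      refine congrArg _ (funext fun j => Finset.sum_congr rfl fun i _ => ?_)
      rw [h]
      -- Both scalars are `∑ θ(u') ρ_ij(S²(u''))`.
      exact congrArg (· • w' i) (apply_rightHit θ.toLinearMap _ u.unop) }

/-- A bijective antipode identifies `B` with its opposite ring. -/
def antipodeEquiv (h : Function.Bijective (antipode (k := k) (A := B))) : B ≃+* Bᵐᵒᵖ :=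
  RingEquiv.ofBijective
    ({ toFun := fun x => op (antipode (k := k) x),
       map_one' := congrArg op (antipode_one k B),
       map_mul' := fun x y => congrArg op (antipode_mul x y),
       map_zero' := congrArg op (map_zero _),
       map_add' := fun x y => congrArg op (map_add _ x y) } : B →+* Bᵐᵒᵖ)
    (op_bijective.comp h)

end TopologicalHopfAlgebra

open TopologicalHopfAlgebra in
/-- Right flatness is the same as left flatness. -/
theorem TopologicalHopfHom.isRightFlat_op {k : Type u} [Field k] {B A : Type u} [Ring B]
    [Algebra k⟦X⟧ B] [TopologicalHopfAlgebra k B] [Ring A] [Algebra k⟦X⟧ A]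
    [TopologicalHopfAlgebra k A] (φ : TopologicalHopfHom k B A)
    (flat : IsRightFlat φ.toAlgHom.toRingHom)
    (hA : Function.Bijective (antipode (k := k) (A := A)))
    (hB : Function.Bijective (antipode (k := k) (A := B))) :
    IsRightFlat (RingHom.op φ.toAlgHom.toRingHom) :=
  -- The antipodes are ring isomorphisms onto the opposite rings, and they commute with `φ`.
  flat.of_ringEquiv _ (antipodeEquiv hB) (antipodeEquiv hA)
    (fun b => congrArg op (φ.map_antipode b).symm)

instance InducedModule.subsingleton {R S : Type u} [Ring R] [Ring S] (φ : R →+* S) (M : Type u)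
    [AddCommGroup M] [Module R M] [Subsingleton M] : Subsingleton (InducedModule φ M) := by
  have h : (LinearMap.id : InducedModule φ M →ₗ[S] InducedModule φ M) = 0 :=
    hom_ext fun m => by rw [Subsingleton.elim m 0, map_zero, map_zero, map_zero]
  exact ⟨fun x y => (LinearMap.congr_fun h x).trans (LinearMap.congr_fun h y).symm⟩

end

/-! ### The duality theorem for induced modules -/

theorem mainTheorem3 {k : Type u} [Field k] [CharZero k]
    {A₀ B₀ A B : Type u} [Ring A₀] [HopfAlgebra k A₀] [Ring B₀] [HopfAlgebra k B₀]
    [Ring A] [Algebra k⟦X⟧ A] [TopologicalHopfAlgebra k A]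
    [Ring B] [Algebra k⟦X⟧ B] [TopologicalHopfAlgebra k B]
    (defA : HopfDeformation k A₀ A) (defB : HopfDeformation k B₀ B)
    (antipode_bijective_A : Function.Bijective (TopologicalHopfAlgebra.antipode (k := k) (A := A)))
    (antipode_bijective_B : Function.Bijective (TopologicalHopfAlgebra.antipode (k := k) (A := B)))
    (φ : TopologicalHopfHom k B A) (flat : IsRightFlat φ.toAlgHom.toRingHom)
    [IsNoetherianRing B₀] (d : ℕ)
    (ext_ne : ∀ i : ℕ, i ≠ d →
      Subsingleton (ExtDual (characterModule (Bialgebra.counitAlgHom k B₀).toRingHom) i))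
    (ext_eq : Nonempty
      (ExtDual (characterModule (Bialgebra.counitAlgHom k B₀).toRingHom) d ≃ₗ[k] k))
    (V : Type u) [AddCommGroup V] [Module k⟦X⟧ V] [Module B V] [IsScalarTower k⟦X⟧ B V]
    [Module.Free k⟦X⟧ V] [Module.Finite k⟦X⟧ V]
    [HasDerivedCategory.{w} (ModuleCat.{u} Aᵐᵒᵖ)] :
    (∀ i : ℕ, i ≠ d →
      Subsingleton (ExtDual (ModuleCat.of A (InducedModule φ.toAlgHom.toRingHom V)) i)) ∧
    ∃ θ : B →ₐ[k⟦X⟧] k⟦X⟧,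
      Nonempty (Omega k B d ≃ₗ[k⟦X⟧] k⟦X⟧) ∧
      (∀ (u : B) (ω : Omega k B d), op u • ω = θ u • ω) ∧
      ∃ ρ : Bᵐᵒᵖ →ₐ[k⟦X⟧]
          Module.End k⟦X⟧ (Omega k B d ⊗[k⟦X⟧] Module.Dual k⟦X⟧ V),
        IsTwistedAction θ (Omega k B d) V ρ ∧
        Nonempty (ExtDual (ModuleCat.of A (InducedModule φ.toAlgHom.toRingHom V)) d ≃ₗ[Aᵐᵒᵖ]
          InducedModule (RingHom.op φ.toAlgHom.toRingHom) (RepModule ρ)) ∧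
        ∀ P : ProjectiveResolution (ModuleCat.of A (InducedModule φ.toAlgHom.toRingHom V)),
          Nonempty (rHomDual P ≅ (DerivedCategory.singleFunctor (ModuleCat.{u} Aᵐᵒᵖ) (d : ℤ)).obj
            (ModuleCat.of Aᵐᵒᵖ
              (InducedModule (RingHom.op φ.toAlgHom.toRingHom) (RepModule ρ)))) := by
  have flat' := φ.isRightFlat_op flat antipode_bijective_A antipode_bijective_B
  let b := Module.finBasis k⟦X⟧ V
  have hext := defB.nonempty_extDual_equiv_twisted flat flat' b
  have ha : ∀ i : ℕ, i ≠ d →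
      Subsingleton (ExtDual (ModuleCat.of A (InducedModule φ.toAlgHom.toRingHom V)) i) := by
    intro i hi
    have := defB.subsingleton_omega i (ext_ne i hi)
    have : Subsingleton (Twisted
        (TopologicalHopfAlgebra.isMatrixRep_coefficient (B := B) b).twistData.σ (Omega k B i)) :=
      inferInstanceAs (Subsingleton (_ → Omega k B i))
    exact (hext i).some.toEquiv.subsingleton
  obtain ⟨e⟩ := defB.nonempty_omega_equiv d ext_ne ext_eq
  -- The `K`-module structure on `Ω` is by definition right multiplication by the image of `K` in
  -- `B`.
  obtain ⟨θ, hθ⟩ := exists_character (R := B) (fun _ _ => rfl) e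
  have e' := (hext d).some.trans
    (InducedModule.congr (TopologicalHopfAlgebra.twistedEquiv θ b hθ))
  exact ⟨ha, θ, ⟨e⟩, hθ, _, TopologicalHopfAlgebra.isTwistedAction_twistedAction θ _ V, ⟨e'⟩,
    fun P => nonempty_rHomDual_iso_single P d ha _ e'⟩
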